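/- Let $n\ge 2$, and let $H_n=\mathbb{C}^n\times\mathbb{R}$ be the Heisenberg group with coordinates $(z,t)$, $z=x+iy$, contact form $\Theta=dt+\sum_j(x_j\,dy_j-y_j\,dx_j)$, contact bundle $\xi=\ker\Theta$, standard CR structure $J$ on $\xi$, Levi metric $\sum_j(dx_j^2+dy_j^2)$ on $\xi$, pseudohermitian connection $\nabla$, and $T=\partial/\partial t$. Let $\Sigma\subset H_n$ be a connected, closed (that is, compact and without boundary), embedded hypersurface of class $C^2$ which is of class $C^\infty$ near its regular points; here $p\in\Sigma$ is singular if $\xi_p=T_p\Sigma$, and regular otherwise. On the regular part put $\xi'=(\xi\cap T\Sigma)\cap J(\xi\cap T\Sigma)$, choose (continuously) a unit vector field $e_n$ in $\xi\cap T\Sigma$ orthogonal to $\xi'$, let $e_{2n}=Je_n$ be the horizontal normal, and let $\alpha$ be the function with $\alpha e_{2n}+T\in T\Sigma$. The shape operator on $\xi\cap T\Sigma$ is $\mathfrak{S}(v)=-\nabla_v e_{2n}+\alpha J'v$, where $J'=J$ on $\xi'$ and $J'e_n=0$, and the $p$-mean curvature $H$ is the trace of $\mathfrak{S}$. Suppose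 that (i) $\Sigma$ has constant $p$-mean curvature $H=c>0$ on its regular part; (ii) $\Sigma$ is umbilic: at every regular point $\mathfrak{S}(\xi')\subset\xi'$, and all eigenvalues of $\mathfrak{S}$ on $\xi'$ are the same; (iii) $\Sigma$ has at least one singular point. Then there is a Heisenberg rigid motion, that is, a composition of a map $(z,t)\mapsto(Az,t)$ with $A\in U(n)$ and a left translation of $H_n$, which maps $\Sigma$ onto the Pansu sphere $S_\lambda$ with $\lambda=\frac{c}{2n}$. Here $S_\lambda$ is the union of the graphs of $g$ and $-g$, where $$g(z)=\frac{1}{2\lambda^2}\left(\lambda|z|\sqrt{1-\lambda^2|z|^2}+\cos^{-1}(\lambda|z|)\right),\qquad |z|\le\frac1\lambda .$$ -/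

import Mathlib

open Set Filter Topology
open scoped ContDiff

noncomputable section

namespace Heisenberg

/-- Complex `n`-space with its Euclidean norm; a point is `z = x + i y`. -/
abbrev Cn (n : ℕ) : Type := EuclideanSpace ℂ (Fin n)

/-- The Heisenberg group `H_n`, as the manifold `ℂⁿ × ℝ` with points `(z, t)`. Its tangent space at
every point is identified with `ℂⁿ × ℝ` through the coordinates `(x, y, t)`. -/
abbrev H (n : ℕ) : Type := Cn n × ℝ

variable {n : ℕ}

/-! ### The pseudohermitian structure of `H_n` -/

/-- The symplectic form `∑ⱼ (xⱼ y'ⱼ - yⱼ x'ⱼ)` of `z = x + i y` and `z' = x' + i y'`, linear in the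
second variable. -/
def sympl (z : Cn n) : Cn n →ₗ[ℝ] ℝ where
  toFun w := ∑ j, ((z j).re * (w j).im - (z j).im * (w j).re)
  map_add' a b := by
    rw [← Finset.sum_add_distrib]
    refine Finset.sum_congr rfl fun j _ => ?_
    simp only [PiLp.add_apply, Complex.add_re, Complex.add_im]
    ring
  map_smul' r a := by
    rw [RingHom.id_apply, smul_eq_mul, Finset.mul_sum]
    refine Finset.sum_congr rfl fun j _ => ?_
    simp only [PiLp.smul_apply, Complex.smul_re, Complex.smul_im, smul_eq_mul]
    ring

/-- The contact form `Θ = dt + ∑ⱼ (xⱼ dyⱼ - yⱼ dxⱼ)` at the point `p`. -/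
def contactForm (p : H n) : H n →ₗ[ℝ] ℝ :=
  LinearMap.snd ℝ (Cn n) ℝ + sympl p.1 ∘ₗ LinearMap.fst ℝ (Cn n) ℝ

/-- The contact hyperplane `ξ = ker Θ` at the point `p`. -/
def contactPlane (p : H n) : Submodule ℝ (H n) := LinearMap.ker (contactForm p)

/-- The left-invariant frame of `ξ` consists of `∂/∂xⱼ + yⱼ ∂/∂t` and `∂/∂yⱼ - xⱼ ∂/∂t`.
It is orthonormal for the Levi metric and identifies `ξ` at each point with `ℂⁿ`:
`horiz p a` is the vector `∑ⱼ (Re aⱼ (∂/∂xⱼ + yⱼ ∂/∂t) + Im aⱼ (∂/∂yⱼ - xⱼ ∂/∂t))` at `p`.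
In this identification the Levi metric is the real inner product of `ℂⁿ` and the CR structure
is multiplication by `i`. -/
def horiz (p : H n) : Cn n →ₗ[ℝ] H n :=
  LinearMap.prod LinearMap.id (-sympl p.1)

theorem horiz_mem_contactPlane (p : H n) (a : Cn n) : horiz p a ∈ contactPlane p := by
  simp [contactPlane, contactForm, horiz]

/-- The CR structure `J` on `ξ ≃ ℂⁿ`. -/
def J : Cn n →ₗ[ℝ] Cn n where
  toFun a := Complex.I • a
  map_add' a b := smul_add _ a b
  map_smul' r a := smul_comm _ r a

/-- The vector field `T = ∂/∂t`. -/
def T : H n := (0, 1)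

/-! ### Hypersurfaces, singular and regular points -/

/-- `S` is, near `p`, the regular zero set of a function of class `C^k`. -/
def IsRegularLevelSetAt (k : WithTop ℕ∞) (S : Set (H n)) (p : H n) : Prop :=
  ∃ (U : Set (H n)) (u : H n → ℝ), IsOpen U ∧ p ∈ U ∧ ContDiffOn ℝ k u U ∧
    (∀ q ∈ U, fderiv ℝ u q ≠ 0) ∧ ∀ q ∈ U, q ∈ S ↔ u q = 0

/-- The tangent space of `S` at `p`, spanned by the velocities at `p` of the curves in `S`.
(On a hypersurface these velocities form a linear subspace already.) -/
def tangent (S : Set (H n)) (p : H n) : Submodule ℝ (H n) :=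
  Submodule.span ℝ {v | ∃ γ : ℝ → H n, γ 0 = p ∧ (∀ᶠ s in 𝓝 (0 : ℝ), γ s ∈ S) ∧ HasDerivAt γ v 0}

/-- The set of singular points of `S`, where `ξ = TS`. -/
def singularSet (S : Set (H n)) : Set (H n) := {p ∈ S | contactPlane p = tangent S p}

/-- The set of regular points of `S`. -/
def regularSet (S : Set (H n)) : Set (H n) := {p ∈ S | contactPlane p ≠ tangent S p}

/-- An embedded hypersurface (without boundary) of `H_n`: of class `C^2`, and of class `C^∞` near
its regular points. -/
structure IsHypersurface (S : Set (H n)) : Prop where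
  contDiff_two : ∀ p ∈ S, IsRegularLevelSetAt 2 S p
  smooth : ∀ p ∈ regularSet S, IsRegularLevelSetAt ∞ S p

/-! ### The shape operator -/

/-- `ξ ∩ TS` at `p`, as a subspace of `ξ ≃ ℂⁿ`. -/
def horizTangent (S : Set (H n)) (p : H n) : Submodule ℝ (Cn n) := (tangent S p).comap (horiz p)

/-- `ξ' = (ξ ∩ TS) ∩ J (ξ ∩ TS)` at `p`, as a subspace of `ξ ≃ ℂⁿ`. -/
def xiPrime (S : Set (H n)) (p : H n) : Submodule ℝ (Cn n) :=
  horizTangent S p ⊓ (horizTangent S p).map J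

/-- `e` is a continuous choice, over the regular points of `S`, of the unit vector `e_n` in
`(ξ ∩ TS) ∩ (ξ')^⊥`, and `α` is the function with `α e_{2n} + T ∈ TS`, for the horizontal
normal `e_{2n} = J e_n`. -/
structure IsHorizontalFrame (S : Set (H n)) (e : H n → Cn n) (α : H n → ℝ) : Prop where
  continuousOn : ContinuousOn e (regularSet S)
  norm_eq_one : ∀ p ∈ regularSet S, ‖e p‖ = 1
  mem_horizTangent : ∀ p ∈ regularSet S, e p ∈ horizTangent S p
  orthogonal : ∀ p ∈ regularSet S, e p ∈ (xiPrime S p)ᗮ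
  alpha_mem : ∀ p ∈ regularSet S, horiz p (α p • J (e p)) + T ∈ tangent S p

/-- The derivative `∇_v X` at `p` of a section `X` of `ξ` along `S`, for the pseudohermitian
connection of `H_n` and `v ∈ ξ ∩ TS`. The left-invariant frame is parallel for this connection,
so that `∇_v` differentiates the coefficients of `X` in the direction of `v`. -/
def covDeriv (S : Set (H n)) (X : H n → Cn n) (p : H n) : horizTangent S p →ₗ[ℝ] Cn n :=
  (fderivWithin ℝ X S p : H n →ₗ[ℝ] Cn n) ∘ₗ horiz p ∘ₗ (horizTangent S p).subtype

/-- `J'` on `ξ ∩ TS`: equal to `J` on `ξ'` and to `0` on its orthogonal complement. -/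
def Jprime (S : Set (H n)) (p : H n) : horizTangent S p →ₗ[ℝ] Cn n :=
  J ∘ₗ ((xiPrime S p).starProjection : Cn n →ₗ[ℝ] Cn n) ∘ₗ (horizTangent S p).subtype

/-- The shape operator `v ↦ -∇_v e_{2n} + α J' v` on `ξ ∩ TS`. Its values lie in `ξ ∩ TS` too;
they are written as elements of `ξ`. -/
def shape (S : Set (H n)) (e : H n → Cn n) (α : H n → ℝ) (p : H n) :
    horizTangent S p →ₗ[ℝ] Cn n :=
  -covDeriv S (fun q => J (e q)) p + α p • Jprime S p

/-- The point `p` is umbilic: the shape operator maps `ξ'` to itself, and all its eigenvalues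
on `ξ'` are the same. -/
def IsUmbilicAt (S : Set (H n)) (e : H n → Cn n) (α : H n → ℝ) (p : H n) : Prop :=
  (∀ v : horizTangent S p, (v : Cn n) ∈ xiPrime S p → shape S e α p v ∈ xiPrime S p) ∧
  ∃ k : ℝ, ∀ (μ : ℝ) (v : horizTangent S p), (v : Cn n) ∈ xiPrime S p → v ≠ 0 →
    shape S e α p v = μ • (v : Cn n) → μ = k

/-- The `p`-mean curvature: the trace of the shape operator on `ξ ∩ TS`. -/
def pMeanCurvature (S : Set (H n)) (e : H n → Cn n) (α : H n → ℝ) (p : H n) : ℝ :=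
  LinearMap.trace ℝ (horizTangent S p)
    (((horizTangent S p).orthogonalProjectionOnto : Cn n →ₗ[ℝ] horizTangent S p) ∘ₗ shape S e α p)

/-! ### Pansu spheres and Heisenberg rigid motions -/

/-- The height of the upper half of the Pansu sphere with parameter `lam` over `z`. -/
def pansuHeight (lam : ℝ) (z : Cn n) : ℝ :=
  1 / (2 * lam ^ 2) * (lam * ‖z‖ * √(1 - lam ^ 2 * ‖z‖ ^ 2) + Real.arccos (lam * ‖z‖))

/-- The Pansu sphere with parameter `lam`, for `lam > 0`. -/
def pansuSphere (n : ℕ) (lam : ℝ) : Set (H n) :=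
  {p | ‖p.1‖ ≤ 1 / lam ∧ (p.2 = pansuHeight lam p.1 ∨ p.2 = -pansuHeight lam p.1)}

/-- Left translation by `p = (z, t)` in the Heisenberg group:
`(z', t') ↦ (z + z', t + t' + ∑ⱼ (yⱼ x'ⱼ - xⱼ y'ⱼ))`. -/
def leftTranslation (p q : H n) : H n := (p.1 + q.1, p.2 + q.2 - sympl p.1 q.1)

/-- A Heisenberg rigid motion, that is, an element of `PSH(n)`: a unitary rotation of `ℂⁿ`
followed by a left translation. -/
def IsRigidMotion (Φ : H n → H n) : Prop :=
  ∃ (p : H n) (A : Cn n ≃ₗᵢ[ℂ] Cn n), ∀ q, Φ q = leftTranslation p (A q.1, q.2)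

end Heisenberg

end

noncomputable section

namespace Heisenberg

variable {n : ℕ}

/-! Write ν for the horizontal normal e_{2n}, k for the eigenvalue of the shape operator on ξ' and l
for its eigenvalue on e_n, so that (2n-2)k + l = c. Since the left-invariant frame is parallel, ν is
simply a ℂⁿ-valued map on the regular part, and umbilicity prescribes its derivative on ξ ∩ TS
(`first_order`).

Symmetry of the second derivative of ν (`codazzi`) then determines everything else. With ζ = ⟨e_n,
dz⟩ - kΘ one gets dν = -(k - iα)dz + ζ((k - l)e_n - αν), dk = α(l - 2k)ζ and dα = (k² - kl - α²)ζ
along S (`structure_equations`). Hence F = z + ν/(k - iα) and (k - c/2n)(k² + α²)^{-n} are locally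
constant wherever k - iα ≠ 0.

Singular points supply the initial condition. They are isolated (`eventually_regular_of_singular`),
and near them α → ∞ while k = O(α) (`alpha_of_singular`). So the second constant is 0 there, that is
k = λ = c/2n, and connectedness carries this over all of S (`kap_eq`). Now F is globally constant,
and so is the height of the centre. After a left translation every regular point satisfies |z|² =
1/(λ² + α²) and t = h(α), with h = `heightFun`; this is the Pansu sphere parametrized by α
(`exists_leftTranslation`).

Thus the translate of S lies in S_λ. It is closed there by compactness. It is open there because
lines transversal to S still meet S when moved slightly, while suitable vertical or radial lines
meet S_λ only once locally. As S_λ is connected, the two sets agree (`exists_image_eq_pansuSphere`).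
-/

/-! ### Dimension and connectedness preliminaries. -/

theorem finrank_Cn : Module.finrank ℝ (Cn n) = 2 * n := by
  rw [(WithLp.linearEquiv 2 ℝ (Fin n → ℂ)).finrank_eq, Module.finrank_pi_fintype]
  simp [Complex.finrank_real_complex, mul_comm]

/-- The radial map y ↦ r y / (1 + |y|) carries the complement of the origin, connected in dimension
at least two, onto the punctured ball. -/
theorem isPreconnected_ball_diff_center {E : Type*} [NormedAddCommGroup E] [NormedSpace ℝ E]
    (h : 1 < Module.rank ℝ E) (r : ℝ) : IsPreconnected (Metric.ball (0 : E) r \ {0}) := by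
  rcases le_or_gt r 0 with hr | hr
  · simp [Metric.ball_eq_empty.2 hr, isPreconnected_empty]
  have hpos : ∀ y : E, 0 < 1 + ‖y‖ := fun y => by positivity
  have hA : ContinuousOn (fun y : E => (r / (1 + ‖y‖)) • y) {0}ᶜ := by
    refine Continuous.continuousOn ?_
    exact (continuous_const.div (by fun_prop) fun y => (hpos y).ne').smul continuous_id
  have hB := (isConnected_compl_singleton_of_one_lt_rank h (0 : E)).isPreconnected.image _ hA
  convert hB using 1
  ext x
  simp only [Set.mem_sdiff, Metric.mem_ball, dist_zero_right, mem_singleton_iff, mem_image,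
    mem_compl_iff]
  constructor
  · rintro ⟨hx, hx0⟩
    have h1 : 0 < r - ‖x‖ := by linarith
    refine ⟨(1 / (r - ‖x‖)) • x, smul_ne_zero (by positivity) hx0, ?_⟩
    rw [norm_smul, smul_smul, Real.norm_of_nonneg (by positivity)]
    have : r / (1 + 1 / (r - ‖x‖) * ‖x‖) * (1 / (r - ‖x‖)) = 1 := by
      have h2 : 1 + 1 / (r - ‖x‖) * ‖x‖ = r / (r - ‖x‖) := by field_simp; ring
      rw [h2]
      field_simp
    rw [this, one_smul]
  · rintro ⟨y, hy, rfl⟩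
    have := hpos y
    refine ⟨?_, smul_ne_zero (by positivity) hy⟩
    rw [norm_smul, Real.norm_of_nonneg (by positivity), div_mul_eq_mul_div, div_lt_iff₀ this]
    nlinarith

/-! ### Defining functions of hypersurfaces -/

/-- On the open set `U`, the set `S` is the regular zero set of the `C^k` function `u`. -/
structure IsDefiningFunction (k : WithTop ℕ∞) (S U : Set (H n)) (u : H n → ℝ) : Prop where
  isOpen : IsOpen U
  contDiffOn : ContDiffOn ℝ k u U
  fderiv_ne : ∀ q ∈ U, fderiv ℝ u q ≠ 0
  mem_iff : ∀ q ∈ U, q ∈ S ↔ u q = 0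

theorem IsRegularLevelSetAt.exists_isDefiningFunction {k : WithTop ℕ∞} {S : Set (H n)} {p : H n}
    (h : IsRegularLevelSetAt k S p) : ∃ U u, p ∈ U ∧ IsDefiningFunction k S U u := by
  obtain ⟨U, u, hU, hp, hu, hd, hm⟩ := h
  exact ⟨U, u, hp, hU, hu, hd, hm⟩

namespace IsDefiningFunction

variable {k : WithTop ℕ∞} {S U : Set (H n)} {u : H n → ℝ} {p : H n}

theorem mono {U' : Set (H n)} (h : IsDefiningFunction k S U u) (hU' : IsOpen U') (hsub : U' ⊆ U) :
    IsDefiningFunction k S U' u :=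
  ⟨hU', h.contDiffOn.mono hsub, fun q hq => h.fderiv_ne q (hsub hq),
    fun q hq => h.mem_iff q (hsub hq)⟩

theorem contDiffAt (h : IsDefiningFunction k S U u) (hp : p ∈ U) : ContDiffAt ℝ k u p :=
  h.contDiffOn.contDiffAt (h.isOpen.mem_nhds hp)

theorem differentiableAt (h : IsDefiningFunction k S U u) (hk : 1 ≤ k) (hp : p ∈ U) :
    DifferentiableAt ℝ u p :=
  (h.contDiffAt hp).differentiableAt (by rintro rfl; simp at hk)

/-- A hypersurface is locally parametrized by the kernel of the differential of a defining
function. -/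
theorem exists_chart (h : IsDefiningFunction k S U u) (hk : 1 ≤ k) (hpU : p ∈ U) (hp : p ∈ S) :
    ∃ (Ψ : (fderiv ℝ u p).ker → H n)
      (π : H n → (fderiv ℝ u p).ker),
      Ψ 0 = p ∧ π p = 0 ∧ Continuous π ∧
      HasFDerivAt Ψ (fderiv ℝ u p).ker.subtypeL 0 ∧
      (∀ᶠ x in 𝓝 0, DifferentiableAt ℝ Ψ x ∧ Ψ x ∈ S ∧ π (Ψ x) = x) ∧
      ∀ᶠ q in 𝓝 p, q ∈ S → Ψ (π q) = q := by
  have hk0 : k ≠ 0 := by rintro rfl; simp at hk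
  have hf : HasStrictFDerivAt u (fderiv ℝ u p) p := (h.contDiffAt hpU).hasStrictFDerivAt hk0
  have hr : (fderiv ℝ u p).range = ⊤ := by
    apply LinearMap.range_eq_top.mpr
    apply LinearMap.surjective
    intro h0
    exact h.fderiv_ne p hpU (ContinuousLinearMap.coe_injective h0)
  have hker : (fderiv ℝ u p).ker.ClosedComplemented :=
    Submodule.ClosedComplemented.of_finiteDimensional _
  set φ := HasStrictFDerivAt.implicitFunctionDataOfComplemented u (fderiv ℝ u p) hf hr hker with hφ
  have hup : u p = 0 := (h.mem_iff p hpU).1 hp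
  have hpt : φ.pt = p := rfl
  have hright : φ.rightFun = fun x => Classical.choose hker (x - p) := rfl
  have hleft : φ.leftFun = u := rfl
  have hr0 : φ.rightFun p = 0 := by simp [hright]
  have hcont : Continuous φ.rightFun := by rw [hright]; fun_prop
  have hval : φ.prodFun φ.pt = (0, 0) := by
    rw [ImplicitFunctionData.prodFun_apply, hpt, hr0, hleft, hup]
  have himg := φ.implicitFunction_apply_image
  rw [hpt, hleft] at himg
  have hinv := φ.prodFun_implicitFunction
  rw [hval] at hinv
  -- The implicit function theorem gives a derivative at the base point only. Differentiability of
  -- the chart at nearby points comes from the inverse of a C¹ local homeomorphism being C¹.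
  have hcd : ContDiffAt ℝ 1 φ.toOpenPartialHomeomorph.symm ((0 : ℝ), 0) := by
    have hsrc := φ.map_pt_mem_toOpenPartialHomeomorph_target
    have e0 : (φ.leftFun φ.pt, φ.rightFun φ.pt) = ((0 : ℝ), 0) := hval
    rw [e0] at hsrc
    refine φ.toOpenPartialHomeomorph.contDiffAt_symm (f₀' :=
      φ.leftDeriv.equivProdOfSurjectiveOfIsCompl φ.rightDeriv φ.range_leftDeriv φ.range_rightDeriv
          φ.isCompl_ker) hsrc ?_ ?_
    · have : φ.toOpenPartialHomeomorph.symm (0, 0) = φ.pt := by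
        rw [← hval]
        exact φ.toOpenPartialHomeomorph.left_inv φ.pt_mem_toOpenPartialHomeomorph_source
      rw [this]
      exact φ.hasStrictFDerivAt.hasFDerivAt
    · have : φ.toOpenPartialHomeomorph.symm (0, 0) = φ.pt := by
        rw [← hval]
        exact φ.toOpenPartialHomeomorph.left_inv φ.pt_mem_toOpenPartialHomeomorph_source
      rw [this]
      refine ContDiffAt.prodMk ((h.contDiffAt hpU).of_le hk) ?_
      rw [hright]
      fun_prop
  have hcurve : ContDiffAt ℝ 1 (φ.implicitFunction 0) 0 := by
    have hpair : ContDiffAt ℝ 1 (fun x : (fderiv ℝ u p).ker => ((0 : ℝ), x)) 0 := by fun_prop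
    exact ContDiffAt.comp (g := φ.toOpenPartialHomeomorph.symm) (0 : (fderiv ℝ u p).ker) hcd hpair
  have h0 : φ.implicitFunction 0 0 = p := by
    have := himg.self_of_nhds
    rwa [hup, hr0] at this
  have hstrict := hf.to_implicitFunctionOfComplemented hr hker
  refine ⟨φ.implicitFunction 0, φ.rightFun, h0, hr0, hcont, ?_, ?_, ?_⟩
  · have := hstrict.hasFDerivAt
    rw [hup] at this
    exact this
  · have e1 : ∀ᶠ x in 𝓝 (0 : (fderiv ℝ u p).ker), DifferentiableAt ℝ (φ.implicitFunction 0) x :=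
      (hcurve.eventually (by simp)).mono fun x hx => hx.differentiableAt (by simp)
    have e2 : ∀ᶠ x in 𝓝 (0 : (fderiv ℝ u p).ker),
        φ.prodFun (φ.implicitFunction 0 x) = (0, x) := by
      have ht : Tendsto (fun x : (fderiv ℝ u p).ker => ((0 : ℝ), x)) (𝓝 0) (𝓝 (0, 0)) :=
        (Continuous.prodMk_right (0 : ℝ)).tendsto 0
      exact ht.eventually hinv
    have e3 : ∀ᶠ x in 𝓝 (0 : (fderiv ℝ u p).ker), φ.implicitFunction 0 x ∈ U := by
      have := hcurve.continuousAt
      apply this.eventually_mem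
      rw [h0]
      exact h.isOpen.mem_nhds hpU
    filter_upwards [e1, e2, e3] with x h1 h2 h3
    rw [ImplicitFunctionData.prodFun_apply, Prod.mk.injEq] at h2
    exact ⟨h1, (h.mem_iff _ h3).2 h2.1, h2.2⟩
  · filter_upwards [himg, h.isOpen.mem_nhds hpU] with q h1 h2 h3
    rw [(h.mem_iff q h2).1 h3] at h1
    exact h1

/-- Every vector annihilated by the differential of a defining function is the velocity of a curve
in the hypersurface. -/
theorem exists_curve (h : IsDefiningFunction k S U u) (hk : 1 ≤ k) (hpU : p ∈ U) (hp : p ∈ S)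
    {v : H n} (hv : fderiv ℝ u p v = 0) :
    ∃ γ : ℝ → H n, γ 0 = p ∧ (∀ᶠ s in 𝓝 (0 : ℝ), γ s ∈ S) ∧ HasDerivAt γ v 0 := by
  obtain ⟨Ψ, π, h0, -, -, hΨ, hS, -⟩ := h.exists_chart hk hpU hp
  have hc : Continuous fun s : ℝ => s • (⟨v, hv⟩ : (fderiv ℝ u p).ker) := by fun_prop
  refine ⟨fun s => Ψ (s • ⟨v, hv⟩), by simp [h0], ?_, ?_⟩
  · have ht := hc.tendsto 0
    rw [zero_smul] at ht
    exact (ht.eventually hS).mono fun s hs => hs.2.1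
  · have h1 : HasDerivAt (fun s : ℝ => s • (⟨v, hv⟩ : (fderiv ℝ u p).ker)) ⟨v, hv⟩ 0 := by
      simpa using (hasDerivAt_id (0 : ℝ)).smul_const (⟨v, hv⟩ : (fderiv ℝ u p).ker)
    have h2 : HasFDerivAt Ψ (fderiv ℝ u p).ker.subtypeL
        ((0 : ℝ) • (⟨v, hv⟩ : (fderiv ℝ u p).ker)) := by
      rwa [zero_smul]
    exact h2.comp_hasDerivAt 0 h1

/-- The chain rule along curves in S gives one inclusion; `exists_curve` realizes every vector of
the kernel as a velocity. -/
theorem tangent_eq_ker (h : IsDefiningFunction k S U u) (hk : 1 ≤ k) (hpU : p ∈ U) (hp : p ∈ S) :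
    tangent S p = (fderiv ℝ u p).ker := by
  apply le_antisymm
  · refine Submodule.span_le.2 ?_
    rintro v ⟨γ, h0, hS, hγ⟩
    have h1 : HasDerivAt (u ∘ γ) (fderiv ℝ u p v) 0 := by
      subst h0
      exact (h.differentiableAt hk hpU).hasFDerivAt.comp_hasDerivAt 0 hγ
    have h2 : (u ∘ γ) =ᶠ[𝓝 0] fun _ => 0 := by
      have : ∀ᶠ s in 𝓝 (0 : ℝ), γ s ∈ U := by
        apply hγ.continuousAt.eventually_mem
        rw [h0]
        exact h.isOpen.mem_nhds hpU
      filter_upwards [hS, this] with s hs hs'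
      exact (h.mem_iff _ hs').1 hs
    exact h1.unique ((hasDerivAt_const 0 (0 : ℝ)).congr_of_eventuallyEq h2)
  · intro v hv
    exact Submodule.subset_span (h.exists_curve hk hpU hp hv)

end IsDefiningFunction

/-! ### Differentiation along a hypersurface. -/

/-- The derivative within `S` is determined along the tangent space. -/
theorem eq_on_tangent {F : Type*} [NormedAddCommGroup F] [NormedSpace ℝ F] {S : Set (H n)}
    {p : H n} {f g : H n → F} {f' g' : H n →L[ℝ] F} (hf : HasFDerivWithinAt f f' S p)
    (hg : HasFDerivWithinAt g g' S p) (hfg : f =ᶠ[𝓝[S] p] g) (hp : p ∈ S) {v : H n}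
    (hv : v ∈ tangent S p) : f' v = g' v := by
  have hf2 : HasFDerivWithinAt g f' S p :=
    hf.congr_of_eventuallyEq hfg.symm (hfg.self_of_nhdsWithin hp).symm
  have : tangent S p ≤ LinearMap.eqLocus (f' : H n →ₗ[ℝ] F) (g' : H n →ₗ[ℝ] F) := by
    refine Submodule.span_le.2 ?_
    rintro w ⟨γ, h0, hS, hγ⟩
    have hev : γ ⁻¹' S ∈ 𝓝 (0 : ℝ) := hS
    subst h0
    have h1 := (hf2.comp_hasDerivWithinAt 0 (hγ.hasDerivWithinAt (s := γ ⁻¹' S))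
      (fun x hx => hx)).hasDerivAt hev
    have h2 := (hg.comp_hasDerivWithinAt 0 (hγ.hasDerivWithinAt (s := γ ⁻¹' S))
      (fun x hx => hx)).hasDerivAt hev
    exact h1.unique h2
  exact this hv

theorem fderivWithin_eq_on_tangent {F : Type*} [NormedAddCommGroup F] [NormedSpace ℝ F]
    {S : Set (H n)} {p : H n} {f g : H n → F} {g' : H n →L[ℝ] F}
    (hg : HasFDerivWithinAt g g' S p) (hfg : f =ᶠ[𝓝[S] p] g) (hp : p ∈ S) {v : H n}
    (hv : v ∈ tangent S p) : fderivWithin ℝ f S p v = g' v := by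
  have : DifferentiableWithinAt ℝ f S p :=
    (hg.congr_of_eventuallyEq hfg (hfg.self_of_nhdsWithin hp)).differentiableWithinAt
  exact eq_on_tangent this.hasFDerivWithinAt hg hfg hp hv

/-- A form which vanishes along the tangent spaces of `S` has symmetric derivative there. -/
theorem IsDefiningFunction.symmetric_of_vanishing {F : Type*} [NormedAddCommGroup F]
    [NormedSpace ℝ F] {k : WithTop ℕ∞} {S U : Set (H n)} {u : H n → ℝ} {p : H n}
    (h : IsDefiningFunction k S U u) (hk : 2 ≤ k) (hpU : p ∈ U) (hp : p ∈ S)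
    {θ : H n → H n →ₗ[ℝ] F} {θ' : H n → H n →L[ℝ] F}
    (hθ : ∀ X, HasFDerivWithinAt (fun q => θ q X) (θ' X) S p)
    (hvan : ∀ᶠ q in 𝓝[S] p, ∀ X ∈ tangent S q, θ q X = 0)
    {X Y : H n} (hX : X ∈ tangent S p) (hY : Y ∈ tangent S p) : θ' X Y = θ' Y X := by
  have hk1 : 1 ≤ k := le_trans (by norm_num) hk
  obtain ⟨w, hw⟩ : ∃ w, fderiv ℝ u p w ≠ 0 := by
    by_contra! h0
    exact h.fderiv_ne p hpU (ContinuousLinearMap.ext h0)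
  have hU : ∀ᶠ q in 𝓝[S] p, q ∈ U ∧ q ∈ S := by
    filter_upwards [mem_nhdsWithin_of_mem_nhds (h.isOpen.mem_nhds hpU), self_mem_nhdsWithin]
      with q h1 h2 using ⟨h1, h2⟩
  have hd1 : ContDiffAt ℝ 1 (fderiv ℝ u) p :=
    (h.contDiffAt hpU).fderiv_right (by rw [one_add_one_eq_two]; exact hk)
  have hd2 : HasFDerivAt (fderiv ℝ u) (fderiv ℝ (fderiv ℝ u) p) p :=
    (hd1.differentiableAt (by simp)).hasFDerivAt
  have hd : ∀ Z, HasFDerivAt (fun q => fderiv ℝ u q Z)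
      ((ContinuousLinearMap.apply ℝ ℝ Z).comp (fderiv ℝ (fderiv ℝ u) p)) p := fun Z =>
    (ContinuousLinearMap.apply ℝ ℝ Z).hasFDerivAt.comp p hd2
  have hsymm : IsSymmSndFDerivAt ℝ u p := (h.contDiffAt hpU).isSymmSndFDerivAt (by simpa using hk)
  -- Since θ vanishes on ker du, it is a multiple of du: du(w) θ(X) = du(X) θ(w) along S for a fixed
  -- w transversal to S. Differentiating this in the direction Y leaves only the Hessian of u, which
  -- is symmetric. Only differentiability of θ within S is needed.
  have key : ∀ X ∈ tangent S p, ∀ Y ∈ tangent S p,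
      fderiv ℝ u p w • θ' X Y = fderiv ℝ (fderiv ℝ u) p Y X • θ p w := by
    intro X hX Y hY
    have hXk : fderiv ℝ u p X = 0 := by
      rw [h.tangent_eq_ker hk1 hpU hp] at hX; exact hX
    have hYk : Y ∈ tangent S p := hY
    have h1 := (hd w).hasFDerivWithinAt (s := S) |>.smul (hθ X)
    have h2 := (hd X).hasFDerivWithinAt (s := S) |>.smul (hθ w)
    have heq : (fun q => fderiv ℝ u q w • θ q X) =ᶠ[𝓝[S] p] fun q => fderiv ℝ u q X • θ q w := by
      filter_upwards [hU, hvan] with q hq hv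
      -- This combination lies in ker du at q, hence is tangent to S.
      have := hv (fderiv ℝ u q w • X - fderiv ℝ u q X • w) (by
        rw [h.tangent_eq_ker hk1 hq.1 hq.2, LinearMap.mem_ker]
        simp [mul_comm])
      rw [map_sub, map_smul, map_smul, sub_eq_zero] at this
      exact this
    have := eq_on_tangent h1 h2 heq hp hY
    have hX0 : θ p X = 0 := hvan.self_of_nhdsWithin hp X hX
    simpa [hXk, hX0] using this
  have e1 := key X hX Y hY
  have e2 := key Y hY X hX
  rw [hsymm.eq Y X, ← e2] at e1
  exact smul_right_injective F hw e1

/-- This makes a chart domain connected after removal of its centre, so that isolated singular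
points do not disconnect S locally. -/
theorem one_lt_rank_ker_fderiv (hn : 1 ≤ n) (u : H n → ℝ) (p : H n) :
    1 < Module.rank ℝ (fderiv ℝ u p).ker := by
  apply Module.one_lt_rank_of_one_lt_finrank
  have h1 := LinearMap.finrank_range_add_finrank_ker (fderiv ℝ u p : H n →ₗ[ℝ] ℝ)
  have h2 : Module.finrank ℝ (LinearMap.range (fderiv ℝ u p : H n →ₗ[ℝ] ℝ)) ≤ 1 := by
    simpa using Submodule.finrank_le (LinearMap.range (fderiv ℝ u p : H n →ₗ[ℝ] ℝ))
  have h3 : Module.finrank ℝ (H n) = 2 * n + 1 := by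
    rw [Module.finrank_prod, finrank_Cn, Module.finrank_self]
  omega

/-- A hypersurface has no isolated points. -/
theorem neBot_punctured (hn : 1 ≤ n) {k : WithTop ℕ∞} {S : Set (H n)} {p : H n}
    (h : IsRegularLevelSetAt k S p) (hk : 1 ≤ k) (hp : p ∈ S) : (𝓝[S \ {p}] p).NeBot := by
  obtain ⟨U, u, hpU, hu⟩ := h.exists_isDefiningFunction
  obtain ⟨Ψ, π, h0, hπ0, hπ, hΨ, hS, hinv⟩ := hu.exists_chart hk hpU hp
  have : Nontrivial (fderiv ℝ u p).ker :=
    (rank_pos_iff_nontrivial (R := ℝ)).1 (zero_lt_one.trans (one_lt_rank_ker_fderiv hn u p))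
  have : (𝓝[≠] (0 : (fderiv ℝ u p).ker)).NeBot := Module.punctured_nhds_neBot ℝ _ 0
  have ht : Tendsto Ψ (𝓝[≠] 0) (𝓝[S \ {p}] p) := by
    rw [tendsto_nhdsWithin_iff]
    refine ⟨?_, ?_⟩
    · have := hΨ.continuousAt.tendsto
      rw [h0] at this
      exact this.mono_left nhdsWithin_le_nhds
    · filter_upwards [hS.filter_mono nhdsWithin_le_nhds, self_mem_nhdsWithin] with x hx hx0
      refine ⟨hx.2.1, fun hp => hx0 ?_⟩
      rw [mem_singleton_iff] at hp ⊢
      rw [← hx.2.2, hp, hπ0]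
  exact ht.neBot

/-- A function on a punctured neighbourhood in a hypersurface, with vanishing derivative along
the tangent spaces, is constant near the puncture. -/
theorem eventually_const_of_tangential (hn : 1 ≤ n) {F : Type*} [NormedAddCommGroup F]
    [NormedSpace ℝ F] {k : WithTop ℕ∞} {S : Set (H n)} {p : H n} (h : IsRegularLevelSetAt k S p)
    (hk : 1 ≤ k) (hp : p ∈ S) {f : H n → F}
    (hf : ∀ᶠ q in 𝓝[S \ {p}] p, ∃ f' : H n →L[ℝ] F, HasFDerivWithinAt f f' S q ∧
      ∀ v ∈ tangent S q, f' v = 0) :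
    ∃ a, ∀ᶠ q in 𝓝[S \ {p}] p, f q = a := by
  obtain ⟨U, u, hpU, hu⟩ := h.exists_isDefiningFunction
  obtain ⟨Ψ, π, h0, hπ0, hπ, hΨ, hS, hinv⟩ := hu.exists_chart hk hpU hp
  rw [eventually_nhdsWithin_iff] at hf
  have hc : ContinuousAt Ψ 0 := hΨ.continuousAt
  have hf' := hc.tendsto.eventually (h0.symm ▸ hf)
  obtain ⟨r, hr, hball⟩ := Metric.eventually_nhds_iff_ball.1 (hS.and (hf'.and hS.eventually_nhds))
  have hrank := one_lt_rank_ker_fderiv hn u p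
  have hconn : IsPreconnected (Metric.ball (0 : (fderiv ℝ u p).ker) r \ {0}) := 
    isPreconnected_ball_diff_center hrank r
  have hopen : IsOpen (Metric.ball (0 : (fderiv ℝ u p).ker) r \ {0}) :=
    Metric.isOpen_ball.sdiff isClosed_singleton
  have hder : ∀ x ∈ Metric.ball (0 : (fderiv ℝ u p).ker) r \ {0},
      HasFDerivAt (f ∘ Ψ) (0 : (fderiv ℝ u p).ker →L[ℝ] F) x := by
    rintro x ⟨hx, hx0⟩
    obtain ⟨⟨h1, h2, h3⟩, h4, h5⟩ := hball x hx
    obtain ⟨f', hf', hv⟩ := h4 ⟨h2, fun h => hx0 (by rw [← h3, h, h0]; exact hπ0)⟩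
    have hm : Ψ ⁻¹' S ∈ 𝓝 x := h5.mono fun y hy => hy.2.1
    have := (hf'.comp x (h1.hasFDerivAt.hasFDerivWithinAt (s := Ψ ⁻¹' S))
      fun y hy => hy).hasFDerivAt hm
    -- Images of vectors under the derivative of the chart are velocities of curves in S, on which
    -- f' vanishes.
    have h0' : f'.comp (fderiv ℝ Ψ x) = 0 := by
      refine ContinuousLinearMap.ext fun y => hv _ ?_
      apply Submodule.subset_span
      have hd : HasDerivAt (fun s : ℝ => x + s • y) y 0 := by
        simpa using ((hasDerivAt_id (0 : ℝ)).smul_const y).const_add x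
      refine ⟨fun s => Ψ (x + s • y), by simp, ?_, ?_⟩
      · have ht : Tendsto (fun s : ℝ => x + s • y) (𝓝 0) (𝓝 x) := by
          simpa using hd.continuousAt.tendsto
        exact ht.eventually hm
      · have h6 : HasFDerivAt Ψ (fderiv ℝ Ψ x) (x + (0 : ℝ) • y) := by
          simpa using h1.hasFDerivAt
        exact h6.comp_hasDerivAt 0 hd
    rwa [h0'] at this
  have hπm : ∀ᶠ q in 𝓝 p, π q ∈ Metric.ball (0 : (fderiv ℝ u p).ker) r := by
    apply hπ.continuousAt.eventually_mem
    rw [hπ0]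
    exact Metric.ball_mem_nhds _ hr
  by_cases hex : ∃ x₀, x₀ ∈ Metric.ball (0 : (fderiv ℝ u p).ker) r \ {0}
  · obtain ⟨x₀, hx₀⟩ := hex
    refine ⟨f (Ψ x₀), ?_⟩
    rw [eventually_nhdsWithin_iff]
    filter_upwards [hinv, hπm] with q h1 h2 h3
    have h4 : π q ∈ Metric.ball (0 : (fderiv ℝ u p).ker) r \ {0} := by
      refine ⟨h2, fun h => h3.2 ?_⟩
      rw [mem_singleton_iff] at h ⊢
      rw [← h1 h3.1, h, h0]
    have := hopen.is_const_of_fderiv_eq_zero hconn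
      (fun x hx => (hder x hx).differentiableAt.differentiableWithinAt)
      (fun x hx => (hder x hx).fderiv) h4 hx₀
    simpa [h1 h3.1] using this
  -- If the punctured ball were empty, no point of S near p would differ from p, and any value would
  -- do.
  · refine ⟨0, ?_⟩
    rw [eventually_nhdsWithin_iff]
    filter_upwards [hinv, hπm] with q h1 h2 h3
    refine absurd ⟨π q, h2, fun h => h3.2 ?_⟩ hex
    rw [mem_singleton_iff] at h ⊢
    rw [← h1 h3.1, h, h0]

open scoped RealInnerProductSpace

/-! ### The complex structure and the horizontal gradient -/

theorem J_apply (a : Cn n) : J a = Complex.I • a := rfl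

theorem complex_smul_eq (c : ℂ) (w : Cn n) : c • w = c.re • w + c.im • J w := by
  ext j
  simp only [PiLp.smul_apply, PiLp.add_apply, J_apply, smul_eq_mul, Complex.real_smul]
  conv_lhs => rw [← Complex.re_add_im c]
  ring

theorem real_inner_eq_sum (a b : Cn n) :
    ⟪a, b⟫ = ∑ j, ((a j).re * (b j).re + (a j).im * (b j).im) := by
  rw [PiLp.inner_apply]
  refine Finset.sum_congr rfl fun j _ => ?_
  rw [Complex.inner]
  simp
  ring

@[simp] theorem J_J (a : Cn n) : J (J a) = -a := by
  rw [J_apply, J_apply, smul_smul, Complex.I_mul_I, neg_one_smul]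

theorem sympl_eq_inner (z w : Cn n) : sympl z w = ⟪J z, w⟫ := by
  rw [real_inner_eq_sum]
  change ∑ j, ((z j).re * (w j).im - (z j).im * (w j).re) = _
  refine Finset.sum_congr rfl fun j _ => ?_
  simp [J_apply]
  ring

@[simp] theorem inner_J_J (a b : Cn n) : ⟪J a, J b⟫ = ⟪a, b⟫ := by
  rw [real_inner_eq_sum, real_inner_eq_sum]
  refine Finset.sum_congr rfl fun j _ => ?_
  simp [J_apply]
  ring

theorem inner_J_left (a b : Cn n) : ⟪J a, b⟫ = -⟪a, J b⟫ := by
  rw [← inner_J_J a (J b), J_J, inner_neg_right, neg_neg]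

@[simp] theorem inner_J_self (a : Cn n) : ⟪J a, a⟫ = 0 := by
  have := inner_J_left a a
  rw [real_inner_comm] at this ⊢
  linarith

@[simp] theorem inner_self_J (a : Cn n) : ⟪a, J a⟫ = 0 := by
  rw [real_inner_comm, inner_J_self]

@[simp] theorem norm_J (a : Cn n) : ‖J a‖ = ‖a‖ := by
  rw [J_apply, norm_smul, Complex.norm_I, one_mul]

/-- The complex structure as a continuous linear map. -/
def JL : Cn n →L[ℝ] Cn n := LinearMap.toContinuousLinearMap J

@[simp] theorem JL_apply (a : Cn n) : JL a = J a := rfl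

/-- The vector `horiz q v` as a continuous bilinear function of `q` and `v`, up to the
constant term. -/
theorem horiz_apply (q : H n) (v : Cn n) : horiz q v = (v, -⟪J q.1, v⟫) := by
  simp [horiz, sympl_eq_inner]

theorem contactForm_apply (q X : H n) : contactForm q X = X.2 + ⟪J q.1, X.1⟫ := by
  simp [contactForm, sympl_eq_inner]

@[simp] theorem horiz_fst (q : H n) (v : Cn n) : (horiz q v).1 = v := rfl

@[simp] theorem T_fst : (T : H n).1 = 0 := rfl

@[simp] theorem T_snd : (T : H n).2 = 1 := rfl

@[simp] theorem contactForm_horiz (q : H n) (v : Cn n) : contactForm q (horiz q v) = 0 := by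
  simp [contactForm_apply, horiz_apply]

@[simp] theorem contactForm_T (q : H n) : contactForm q T = 1 := by
  simp [contactForm_apply]

theorem eq_horiz_add (q X : H n) : X = horiz q X.1 + contactForm q X • T := by
  ext1
  · simp
  · simp [horiz_apply, contactForm_apply]

theorem continuous_horiz : Continuous fun x : H n × Cn n => horiz x.1 x.2 := by
  simp only [horiz_apply]
  exact continuous_snd.prodMk
    ((((JL (n := n)).continuous.comp (continuous_fst.comp continuous_fst)).inner
      continuous_snd).neg)

theorem contDiff_horiz {m : WithTop ℕ∞} : ContDiff ℝ m fun x : H n × Cn n => horiz x.1 x.2 := by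
  simp only [horiz_apply]
  exact contDiff_snd.prodMk
    ((((JL (n := n)).contDiff.comp (contDiff_fst.comp contDiff_fst)).inner ℝ contDiff_snd).neg)

/-- The horizontal gradient. -/
def hgrad (u : H n → ℝ) (q : H n) : Cn n :=
  ∑ i, fderiv ℝ u q (horiz q (stdOrthonormalBasis ℝ (Cn n) i)) • stdOrthonormalBasis ℝ (Cn n) i

theorem inner_hgrad (u : H n → ℝ) (q : H n) (w : Cn n) :
    ⟪hgrad u q, w⟫ = fderiv ℝ u q (horiz q w) := by
  conv_rhs => rw [← (stdOrthonormalBasis ℝ (Cn n)).sum_repr' w]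
  simp only [hgrad, sum_inner, map_sum, map_smul, real_inner_smul_left, smul_eq_mul]
  exact Finset.sum_congr rfl fun i _ => mul_comm _ _

theorem fderiv_apply_eq (u : H n → ℝ) (q X : H n) :
    fderiv ℝ u q X = ⟪hgrad u q, X.1⟫ + contactForm q X * fderiv ℝ u q T := by
  conv_lhs => rw [eq_horiz_add q X]
  rw [map_add, map_smul, inner_hgrad, smul_eq_mul]

theorem hgrad_const_mul (s : ℝ) (u : H n → ℝ) (q : H n) (hu : DifferentiableAt ℝ u q) :
    hgrad (fun x => s * u x) q = s • hgrad u q := by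
  simp only [hgrad, Finset.smul_sum, smul_smul]
  refine Finset.sum_congr rfl fun i _ => ?_
  rw [fderiv_const_mul hu]
  simp

/-- The unit horizontal normal of the level sets of `u`. -/
def unitNormal (u : H n → ℝ) (q : H n) : Cn n := ‖hgrad u q‖⁻¹ • hgrad u q

theorem norm_unitNormal {u : H n → ℝ} {q : H n} (h : hgrad u q ≠ 0) : ‖unitNormal u q‖ = 1 := by
  rw [unitNormal, norm_smul, norm_inv, norm_norm, inv_mul_cancel₀ (norm_ne_zero_iff.2 h)]

theorem norm_smul_unitNormal (u : H n → ℝ) (q : H n) :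
    ‖hgrad u q‖ • unitNormal u q = hgrad u q := by
  by_cases h : hgrad u q = 0
  · simp [h]
  · rw [unitNormal, smul_smul, mul_inv_cancel₀ (norm_ne_zero_iff.2 h), one_smul]

/-! ### The horizontal geometry of S in terms of a defining function. -/

namespace IsDefiningFunction

variable {k : WithTop ℕ∞} {S U : Set (H n)} {u : H n → ℝ} {p : H n}

theorem contDiffOn_hgrad {m : WithTop ℕ∞} (h : IsDefiningFunction k S U u) (hm : m + 1 ≤ k) :
    ContDiffOn ℝ m (hgrad u) U := by
  have h1 : ContDiffOn ℝ m (fderiv ℝ u) U := h.contDiffOn.fderiv_of_isOpen h.isOpen hm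
  refine ContDiffOn.sum fun i _ => ContDiffOn.smul (h1.clm_apply ?_) contDiffOn_const
  exact (contDiff_horiz.comp (contDiff_id.prodMk contDiff_const)).contDiffOn

theorem contDiffOn_fderiv_T {m : WithTop ℕ∞} (h : IsDefiningFunction k S U u) (hm : m + 1 ≤ k) :
    ContDiffOn ℝ m (fun q => fderiv ℝ u q T) U :=
  (h.contDiffOn.fderiv_of_isOpen h.isOpen hm).clm_apply contDiffOn_const

theorem mem_tangent_iff (h : IsDefiningFunction k S U u) (hk : 1 ≤ k) (hpU : p ∈ U) (hp : p ∈ S)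
    (X : H n) :
    X ∈ tangent S p ↔ ⟪hgrad u p, X.1⟫ + contactForm p X * fderiv ℝ u p T = 0 := by
  rw [h.tangent_eq_ker hk hpU hp, LinearMap.mem_ker, ← fderiv_apply_eq]
  rfl

/-- The horizontal gradient represents du on ξ. If it vanishes then Tu ≠ 0, as du ≠ 0, so du is a
nonzero multiple of Θ. -/
theorem contactPlane_eq_iff (h : IsDefiningFunction k S U u) (hk : 1 ≤ k) (hpU : p ∈ U)
    (hp : p ∈ S) : contactPlane p = tangent S p ↔ hgrad u p = 0 := by
  constructor
  · intro heq
    rw [← inner_self_eq_zero (𝕜 := ℝ), inner_hgrad]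
    have := horiz_mem_contactPlane p (hgrad u p)
    rw [heq, h.tangent_eq_ker hk hpU hp] at this
    exact this
  · intro h0
    have hT : fderiv ℝ u p T ≠ 0 := by
      intro hT
      refine h.fderiv_ne p hpU (ContinuousLinearMap.ext fun X => ?_)
      rw [fderiv_apply_eq, h0, hT]
      simp
    ext X
    rw [h.mem_tangent_iff hk hpU hp, h0, inner_zero_left, zero_add, contactPlane,
      LinearMap.mem_ker, mul_eq_zero, or_iff_left hT]

theorem mem_regularSet_iff (h : IsDefiningFunction k S U u) (hk : 1 ≤ k) (hpU : p ∈ U)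
    (hp : p ∈ S) : p ∈ regularSet S ↔ hgrad u p ≠ 0 := by
  rw [regularSet, Set.mem_ofPred_eq, Ne, h.contactPlane_eq_iff hk hpU hp]
  exact and_iff_right hp

theorem mem_singularSet_iff (h : IsDefiningFunction k S U u) (hk : 1 ≤ k) (hpU : p ∈ U)
    (hp : p ∈ S) : p ∈ singularSet S ↔ hgrad u p = 0 := by
  rw [singularSet, Set.mem_ofPred_eq, h.contactPlane_eq_iff hk hpU hp]
  exact and_iff_right hp

theorem mem_horizTangent_iff (h : IsDefiningFunction k S U u) (hk : 1 ≤ k) (hpU : p ∈ U)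
    (hp : p ∈ S) (v : Cn n) : v ∈ horizTangent S p ↔ ⟪hgrad u p, v⟫ = 0 := by
  rw [horizTangent, Submodule.mem_comap, h.mem_tangent_iff hk hpU hp]
  simp

theorem mem_xiPrime_iff (h : IsDefiningFunction k S U u) (hk : 1 ≤ k) (hpU : p ∈ U)
    (hp : p ∈ S) (v : Cn n) :
    v ∈ xiPrime S p ↔ ⟪hgrad u p, v⟫ = 0 ∧ ⟪J (hgrad u p), v⟫ = 0 := by
  rw [xiPrime, Submodule.mem_inf, h.mem_horizTangent_iff hk hpU hp, Submodule.mem_map]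
  refine and_congr_right fun _ => ⟨?_, fun hv => ⟨-J v, ?_, by simp⟩⟩
  · rintro ⟨w, hw, rfl⟩
    rw [h.mem_horizTangent_iff hk hpU hp] at hw
    rw [inner_J_J, hw]
  · rw [h.mem_horizTangent_iff hk hpU hp, inner_neg_right, ← inner_J_left, hv]

theorem const_mul (h : IsDefiningFunction k S U u) (hk : 1 ≤ k) {s : ℝ} (hs : s ≠ 0) :
    IsDefiningFunction k S U fun x => s * u x where
  isOpen := h.isOpen
  contDiffOn := contDiffOn_const.mul h.contDiffOn
  fderiv_ne q hq := by
    rw [fderiv_const_mul (h.differentiableAt hk hq)]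
    exact smul_ne_zero hs (h.fderiv_ne q hq)
  mem_iff q hq := by
    rw [h.mem_iff q hq, mul_eq_zero, or_iff_right hs]

end IsDefiningFunction

/-- The projection of `x` to the orthogonal complement of the complex line of a unit vector. -/
theorem inner_sub_proj {ν : Cn n} (hν : ‖ν‖ = 1) (x : Cn n) :
    ⟪ν, x - ⟪ν, x⟫ • ν - ⟪J ν, x⟫ • J ν⟫ = 0 ∧ ⟪J ν, x - ⟪ν, x⟫ • ν - ⟪J ν, x⟫ • J ν⟫ = 0 := by
  simp [inner_sub_right, real_inner_smul_right, hν]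

variable {S : Set (H n)} {e : H n → Cn n} {α : H n → ℝ}

/-- In terms of a defining function, the horizontal normal is the normalized horizontal gradient,
up to a sign. -/
theorem IsHorizontalFrame.J_eq {k : WithTop ℕ∞} {U : Set (H n)} {u : H n → ℝ} {p : H n}
    (hframe : IsHorizontalFrame S e α) (h : IsDefiningFunction k S U u) (hk : 1 ≤ k)
    (hpU : p ∈ U) (hp : p ∈ regularSet S) :
    J (e p) = ⟪J (e p), unitNormal u p⟫ • unitNormal u p ∧ |⟪J (e p), unitNormal u p⟫| = 1 ∧
      α p * ‖hgrad u p‖ = -(⟪J (e p), unitNormal u p⟫ * fderiv ℝ u p T) := by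
  have hN : hgrad u p ≠ 0 := (h.mem_regularSet_iff hk hpU hp.1).1 hp
  set ν := unitNormal u p with hν
  have hν1 : ‖ν‖ = 1 := norm_unitNormal hN
  have hNν : hgrad u p = ‖hgrad u p‖ • ν := (norm_smul_unitNormal u p).symm
  have hpos : 0 < ‖hgrad u p‖ := norm_pos_iff.2 hN
  have hνe : ⟪ν, e p⟫ = 0 := by
    have := (h.mem_horizTangent_iff hk hpU hp.1 _).1 (hframe.mem_horizTangent p hp)
    rw [hν, unitNormal, real_inner_smul_left, this, mul_zero]
  obtain ⟨h1, h2⟩ := inner_sub_proj hν1 (e p)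
  have hw : e p - ⟪ν, e p⟫ • ν - ⟪J ν, e p⟫ • J ν ∈ xiPrime S p := by
    rw [h.mem_xiPrime_iff hk hpU hp.1, hNν]
    simp only [map_smul, real_inner_smul_left, h1, h2, mul_zero, and_self]
  have h3 := (Submodule.mem_orthogonal _ _).1 (hframe.orthogonal p hp) _ hw
  -- The remainder lies in ξ', to which e_n is orthogonal; it is also orthogonal to ν and Jν, hence
  -- to itself.
  have h4 : e p - ⟪ν, e p⟫ • ν - ⟪J ν, e p⟫ • J ν = 0 := by
    rw [← inner_self_eq_zero (𝕜 := ℝ)]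
    nth_rw 2 [sub_sub]
    rw [inner_sub_right, h3, inner_add_right, real_inner_smul_right, real_inner_smul_right,
      real_inner_comm _ (e p - _ - _), h1, real_inner_comm _ (e p - _ - _), h2]
    simp
  rw [hνe, zero_smul, sub_zero, sub_eq_zero] at h4
  have h5 : J (e p) = -⟪J ν, e p⟫ • ν := by
    conv_lhs => rw [h4]
    simp
  have h6 : ⟪J (e p), ν⟫ = -⟪J ν, e p⟫ := by
    rw [inner_J_left, real_inner_comm]
  have h7 : |⟪J (e p), ν⟫| = 1 := by
    have := hframe.norm_eq_one p hp
    rw [← norm_J, h5, norm_smul, hν1, mul_one, Real.norm_eq_abs] at this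
    rw [h6, this]
  refine ⟨by rw [h6]; exact h5, h7, ?_⟩
  have h8 := (h.mem_tangent_iff hk hpU hp.1 _).1 (hframe.alpha_mem p hp)
  rw [h6]
  rw [h5, hNν] at h8
  simp only [Prod.fst_add, horiz_fst, T_fst, add_zero, map_add, contactForm_horiz, contactForm_T,
    zero_add, one_mul, real_inner_smul_left, real_inner_smul_right, real_inner_self_eq_norm_sq,
    hν1] at h8
  have h9 : (⟪J ν, e p⟫) ^ 2 = 1 := by
    rw [h6, abs_neg] at h7
    rw [← sq_abs, h7, one_pow]
  linear_combination (-⟪J ν, e p⟫) * h8 - (α p * ‖hgrad u p‖) * h9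

/-- Near a regular point there is a defining function whose normalized horizontal gradient is
the horizontal normal. -/
theorem IsHorizontalFrame.exists_adapted {k : WithTop ℕ∞} {p : H n}
    (hframe : IsHorizontalFrame S e α) (hp : p ∈ regularSet S) (h : IsRegularLevelSetAt k S p)
    (hk : 2 ≤ k) :
    ∃ U u, p ∈ U ∧ IsDefiningFunction k S U u ∧ (∀ q ∈ U, hgrad u q ≠ 0) ∧
      ∀ q ∈ U, q ∈ S → q ∈ regularSet S ∧ J (e q) = unitNormal u q ∧
        α q = -(‖hgrad u q‖⁻¹ * fderiv ℝ u q T) := by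
  have hk1 : 1 ≤ k := le_trans (by norm_num) hk
  have hk2 : (1 : WithTop ℕ∞) + 1 ≤ k := by rw [one_add_one_eq_two]; exact hk
  obtain ⟨U, u, hpU, hu⟩ := h.exists_isDefiningFunction
  have hN : hgrad u p ≠ 0 := (hu.mem_regularSet_iff hk1 hpU hp.1).1 hp
  have hNc : ContinuousOn (hgrad u) U := (hu.contDiffOn_hgrad hk2).continuousOn
  obtain ⟨V, hV, hpV, hVU, hVN⟩ : ∃ V, IsOpen V ∧ p ∈ V ∧ V ⊆ U ∧ ∀ q ∈ V, hgrad u q ≠ 0 := by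
    refine ⟨U ∩ hgrad u ⁻¹' {0}ᶜ, hNc.isOpen_inter_preimage hu.isOpen isOpen_compl_singleton,
      ⟨hpU, hN⟩, inter_subset_left, fun q hq => hq.2⟩
  have hreg : ∀ q ∈ V, q ∈ S → q ∈ regularSet S := fun q hq hqS =>
    (hu.mem_regularSet_iff hk1 (hVU hq) hqS).2 (hVN q hq)
  have hνc : ContinuousOn (unitNormal u) V :=
    ((hNc.mono hVU).norm.inv₀ fun q hq => norm_ne_zero_iff.2 (hVN q hq)).smul (hNc.mono hVU)
  have hs : ContinuousOn (fun q => ⟪J (e q), unitNormal u q⟫) (V ∩ S) := by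
    refine ContinuousOn.inner ((JL (n := n)).continuous.comp_continuousOn
      (hframe.continuousOn.mono fun q hq => hreg q hq.1 hq.2)) (hνc.mono inter_subset_left)
  set s := ⟪J (e p), unitNormal u p⟫ with hsdef
  have hs1 : ∀ q ∈ V, q ∈ S → |⟪J (e q), unitNormal u q⟫| = 1 := fun q hq hqS =>
    (hframe.J_eq hu hk1 (hVU hq) (hreg q hq hqS)).2.1
  have hsp : |s| = 1 := hs1 p hpV hp.1
  -- A continuous function with values ±1 is locally constant. Replacing u by s u then aligns the
  -- two normals.
  have hev : ∀ᶠ q in 𝓝[V ∩ S] p, ⟪J (e q), unitNormal u q⟫ = s := by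
    have h1 := (hs p ⟨hpV, hp.1⟩).tendsto.eventually (Metric.ball_mem_nhds s one_pos)
    filter_upwards [h1, self_mem_nhdsWithin] with q h2 h3
    have h4 := hs1 q h3.1 h3.2
    rw [Real.dist_eq] at h2
    rcases abs_eq (zero_le_one) |>.1 h4 with h5 | h5 <;>
    rcases abs_eq (zero_le_one) |>.1 hsp with h6 | h6 <;> rw [h5, h6] at h2 ⊢ <;> norm_num at h2
  rw [eventually_nhdsWithin_iff] at hev
  obtain ⟨W, hWs, hW, hpW⟩ := eventually_nhds_iff.1 hev
  have hs0 : s ≠ 0 := by intro h0; rw [h0] at hsp; simp at hsp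
  have hN' : ∀ q ∈ V, hgrad (fun x => s * u x) q = s • hgrad u q := fun q hq =>
    hgrad_const_mul s u q (hu.differentiableAt hk1 (hVU hq))
  have hn' : ∀ q ∈ V, ‖hgrad (fun x => s * u x) q‖ = ‖hgrad u q‖ := fun q hq => by
    rw [hN' q hq, norm_smul, Real.norm_eq_abs, hsp, one_mul]
  refine ⟨V ∩ W, fun x => s * u x, ⟨hpV, hpW⟩,
    (hu.const_mul hk1 hs0).mono (hV.inter hW) fun q hq => hVU hq.1, ?_, ?_⟩
  · intro q hq
    rw [hN' q hq.1]
    exact smul_ne_zero hs0 (hVN q hq.1)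
  · intro q hq hqS
    have hr := hreg q hq.1 hqS
    obtain ⟨h1, h2, h3⟩ := hframe.J_eq hu hk1 (hVU hq.1) hr
    rw [hWs q hq.2 ⟨hq.1, hqS⟩] at h1 h3
    refine ⟨hr, ?_, ?_⟩
    · rw [h1, unitNormal, unitNormal, hn' q hq.1, hN' q hq.1, smul_comm]
    · rw [hn' q hq.1, fderiv_const_mul (hu.differentiableAt hk1 (hVU hq.1))]
      have : ‖hgrad u q‖ ≠ 0 := norm_ne_zero_iff.2 (hVN q hq.1)
      field_simp
      rw [h3]
      simp

/-! ### First order consequences of umbilicity -/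

/-- A symmetric operator with only one eigenvalue is scalar. -/
theorem eq_smul_of_symmetric {E : Type*} [NormedAddCommGroup E] [InnerProductSpace ℝ E]
    [FiniteDimensional ℝ E] {W : Submodule ℝ E} (A : W →ₗ[ℝ] E) (hAW : ∀ v, A v ∈ W)
    (hA : ∀ v w : W, ⟪A v, (w : E)⟫ = ⟪(v : E), A w⟫) {k : ℝ}
    (hk : ∀ (m : ℝ) (v : W), v ≠ 0 → A v = m • (v : E) → m = k) (v : W) :
    A v = k • (v : E) := by
  have hs : (A.codRestrict W hAW).IsSymmetric := hA
  have : A.codRestrict W hAW = k • LinearMap.id := by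
    refine (hs.eigenvectorBasis rfl).toBasis.ext fun i => ?_
    have h1 := hs.apply_eigenvectorBasis rfl i
    have h2 := hk _ _ ((hs.eigenvectorBasis rfl).orthonormal.ne_zero i)
      (congrArg Subtype.val h1)
    simp only [OrthonormalBasis.coe_toBasis]
    rw [h1, h2]
    rfl
  exact congrArg Subtype.val (LinearMap.congr_fun this v)

/-! ### Umbilic hypersurfaces: the normal, its derivative and the eigenvalues. -/

/-- The hypotheses on an umbilic hypersurface of constant `p`-mean curvature. -/
structure IsUmbilicCMC (S : Set (H n)) (e : H n → Cn n) (α : H n → ℝ) (c : ℝ) : Prop where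
  two_le : 2 ≤ n
  hypersurface : IsHypersurface S
  frame : IsHorizontalFrame S e α
  pMean : ∀ p ∈ regularSet S, pMeanCurvature S e α p = c
  umbilic : ∀ p ∈ regularSet S, IsUmbilicAt S e α p

/-- The horizontal normal `e_{2n}`. -/
def normal (e : H n → Cn n) (q : H n) : Cn n := J (e q)

/-- The derivative of the horizontal normal. -/
def dNormal (S : Set (H n)) (e : H n → Cn n) (q : H n) : H n →L[ℝ] Cn n :=
  fderivWithin ℝ (normal e) S q

/-- The eigenvalue of the shape operator in the direction `e_n`. -/
def ell (S : Set (H n)) (e : H n → Cn n) (q : H n) : ℝ := -⟪dNormal S e q (horiz q (e q)), e q⟫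

/-- The eigenvalue of the shape operator on `ξ'`, for a hypersurface of `p`-mean curvature `c`. -/
def kap (c : ℝ) (S : Set (H n)) (e : H n → Cn n) (q : H n) : ℝ := (c - ell S e q) / (2 * n - 2)

/-- The complex number `k - i α`. -/
def mu (c : ℝ) (S : Set (H n)) (e : H n → Cn n) (α : H n → ℝ) (q : H n) : ℂ :=
  (kap c S e q : ℂ) - Complex.I * (α q : ℂ)

theorem mu_smul (c : ℝ) (q : H n) (v : Cn n) :
    mu c S e α q • v = kap c S e q • v - α q • J v := by
  rw [complex_smul_eq]
  simp [mu, sub_eq_add_neg]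

namespace IsHorizontalFrame

variable {p : H n}

theorem norm_normal (hframe : IsHorizontalFrame S e α) (hp : p ∈ regularSet S) :
    ‖normal e p‖ = 1 := by
  rw [normal, norm_J, hframe.norm_eq_one p hp]

theorem mem_tangent_iff (hframe : IsHorizontalFrame S e α) (hp : p ∈ regularSet S)
    (h : IsRegularLevelSetAt 2 S p) (X : H n) :
    X ∈ tangent S p ↔ ⟪normal e p, X.1⟫ = α p * contactForm p X := by
  obtain ⟨U, u, hpU, hu, hN, hu'⟩ := hframe.exists_adapted hp h le_rfl
  obtain ⟨-, h2, h3⟩ := hu' p hpU hp.1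
  have := norm_ne_zero_iff.2 (hN p hpU)
  rw [hu.mem_tangent_iff (by norm_num) hpU hp.1, normal, h2, h3, unitNormal,
    real_inner_smul_left]
  field_simp
  constructor <;> intro h <;> linarith

theorem mem_horizTangent_iff (hframe : IsHorizontalFrame S e α) (hp : p ∈ regularSet S)
    (h : IsRegularLevelSetAt 2 S p) (v : Cn n) :
    v ∈ horizTangent S p ↔ ⟪normal e p, v⟫ = 0 := by
  rw [horizTangent, Submodule.mem_comap, hframe.mem_tangent_iff hp h]
  simp

theorem mem_xiPrime_iff (hframe : IsHorizontalFrame S e α) (hp : p ∈ regularSet S)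
    (h : IsRegularLevelSetAt 2 S p) (v : Cn n) :
    v ∈ xiPrime S p ↔ ⟪normal e p, v⟫ = 0 ∧ ⟪e p, v⟫ = 0 := by
  rw [xiPrime, Submodule.mem_inf, hframe.mem_horizTangent_iff hp h, Submodule.mem_map]
  refine and_congr_right fun _ => ⟨?_, fun hv => ⟨-J v, ?_, by simp⟩⟩
  · rintro ⟨w, hw, rfl⟩
    rw [hframe.mem_horizTangent_iff hp h] at hw
    rw [← inner_J_J, J_J, inner_neg_right, ← normal, hw, neg_zero]
  · rw [hframe.mem_horizTangent_iff hp h, inner_neg_right, normal, inner_J_J, hv, neg_zero]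

theorem differentiableWithinAt (hframe : IsHorizontalFrame S e α) (hp : p ∈ regularSet S)
    (h : IsRegularLevelSetAt 2 S p) :
    DifferentiableWithinAt ℝ (normal e) S p ∧ DifferentiableWithinAt ℝ α S p := by
  obtain ⟨U, u, hpU, hu, hN, hu'⟩ := hframe.exists_adapted hp h le_rfl
  have hUp : U ∈ 𝓝 p := hu.isOpen.mem_nhds hpU
  have h1 : DifferentiableAt ℝ (hgrad u) p :=
    ((hu.contDiffOn_hgrad (m := 1) (by norm_num)).contDiffAt hUp).differentiableAt (by simp)
  have h2 : DifferentiableAt ℝ (fun q => fderiv ℝ u q T) p :=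
    ((hu.contDiffOn_fderiv_T (m := 1) (by norm_num)).contDiffAt hUp).differentiableAt (by simp)
  have h3 : DifferentiableAt ℝ (fun q => ‖hgrad u q‖⁻¹) p :=
    (h1.norm ℝ (hN p hpU)).inv (norm_ne_zero_iff.2 (hN p hpU))
  have hev : ∀ᶠ q in 𝓝[S] p, q ∈ U ∧ q ∈ S := by
    filter_upwards [mem_nhdsWithin_of_mem_nhds hUp, self_mem_nhdsWithin] with q h1 h2
      using ⟨h1, h2⟩
  constructor
  · refine (h3.smul h1).differentiableWithinAt.congr_of_eventuallyEq ?_ (hu' p hpU hp.1).2.1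
    filter_upwards [hev] with q hq using (hu' q hq.1 hq.2).2.1
  · refine (h3.mul h2).neg.differentiableWithinAt.congr_of_eventuallyEq ?_ (hu' p hpU hp.1).2.2
    filter_upwards [hev] with q hq using (hu' q hq.1 hq.2).2.2

theorem eventually_regularSet (hframe : IsHorizontalFrame S e α) (hp : p ∈ regularSet S)
    (h : IsRegularLevelSetAt 2 S p) : ∀ᶠ q in 𝓝[S] p, q ∈ regularSet S := by
  obtain ⟨U, u, hpU, hu, hN, hu'⟩ := hframe.exists_adapted hp h le_rfl
  filter_upwards [mem_nhdsWithin_of_mem_nhds (hu.isOpen.mem_nhds hpU), self_mem_nhdsWithin]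
    with q h1 h2 using (hu' q h1 h2).1

/-- The horizontal normal has unit length, so its derivative is orthogonal to it. -/
theorem inner_normal_dNormal (hframe : IsHorizontalFrame S e α) (hp : p ∈ regularSet S)
    (h : IsRegularLevelSetAt 2 S p) {X : H n} (hX : X ∈ tangent S p) :
    ⟪normal e p, dNormal S e p X⟫ = 0 := by
  have h1 := (hframe.differentiableWithinAt hp h).1.hasFDerivWithinAt
  have h2 := h1.inner ℝ h1
  have h3 := eq_on_tangent h2 (hasFDerivWithinAt_const (1 : ℝ) p S) (by
    filter_upwards [hframe.eventually_regularSet hp h] with q hq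
    rw [real_inner_self_eq_norm_sq, hframe.norm_normal hq, one_pow]) hp.1 hX
  simp only [ContinuousLinearMap.comp_apply, ContinuousLinearMap.prod_apply,
    fderivInnerCLM_apply, zero_apply] at h3
  rw [real_inner_comm (normal e p)] at h3
  change ⟪normal e p, fderivWithin ℝ (normal e) S p X⟫ = 0
  linarith

theorem hasFDerivWithinAt_contactForm (s : Set (H n)) (p X : H n) :
    HasFDerivWithinAt (fun q : H n => contactForm q X)
      (((innerSL ℝ X.1).comp JL).comp (ContinuousLinearMap.fst ℝ (Cn n) ℝ)) s p := by
  have h : (fun q : H n => contactForm q X) = fun q =>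
      X.2 + (((innerSL ℝ X.1).comp JL).comp (ContinuousLinearMap.fst ℝ (Cn n) ℝ)) q := by
    funext q
    simp [contactForm_apply, real_inner_comm]
  rw [h]
  exact (ContinuousLinearMap.hasFDerivWithinAt _).const_add _

/-- The tangential part of the exterior derivative of the relation
`⟨e_{2n}, dz⟩ = α Θ` along `S`. -/
theorem dNormal_antisymm (hframe : IsHorizontalFrame S e α) (hp : p ∈ regularSet S)
    (h : ∀ q ∈ S, IsRegularLevelSetAt 2 S q) {X Y : H n} (hX : X ∈ tangent S p)
    (hY : Y ∈ tangent S p) :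
    ⟪dNormal S e p Y, X.1⟫ - ⟪dNormal S e p X, Y.1⟫ =
      fderivWithin ℝ α S p Y * contactForm p X - fderivWithin ℝ α S p X * contactForm p Y
        + 2 * α p * ⟪J Y.1, X.1⟫ := by
  obtain ⟨U, u, hpU, hu⟩ := (h p hp.1).exists_isDefiningFunction
  obtain ⟨hν, hα⟩ := hframe.differentiableWithinAt hp (h p hp.1)
  -- The form ⟨ν, dz⟩ - αΘ vanishes on TS; differentiating Θ produces the term with J.
  have key := hu.symmetric_of_vanishing le_rfl hpU hp.1
    (θ := fun q => innerₛₗ ℝ (normal e q) ∘ₗ LinearMap.fst ℝ (Cn n) ℝ - α q • contactForm q)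
    (θ' := fun X => (innerSL ℝ X.1).comp (dNormal S e p) -
      (α p • (((innerSL ℝ X.1).comp JL).comp (ContinuousLinearMap.fst ℝ (Cn n) ℝ)) +
        contactForm p X • fderivWithin ℝ α S p)) (fun X => by
      refine HasFDerivWithinAt.sub ?_ ?_
      · have := (innerSL ℝ X.1).hasFDerivAt.comp_hasFDerivWithinAt p hν.hasFDerivWithinAt
        refine this.congr_of_eventuallyEq (Eventually.of_forall fun q => ?_) ?_ <;>
        simp [real_inner_comm]
      · exact hα.hasFDerivWithinAt.mul (hasFDerivWithinAt_contactForm S p X)) (by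
      filter_upwards [hframe.eventually_regularSet hp (h p hp.1)] with q hq X hX
      rw [hframe.mem_tangent_iff hq (h q hq.1)] at hX
      simp [hX]) hX hY
  simp only [_root_.sub_apply, _root_.add_apply,
    _root_.smul_apply, ContinuousLinearMap.comp_apply, innerSL_apply_apply, JL_apply,
    ContinuousLinearMap.coe_fst', smul_eq_mul] at key
  rw [real_inner_comm X.1 (dNormal S e p Y), real_inner_comm Y.1 (dNormal S e p X)]
  have h1 : ⟪Y.1, J X.1⟫ = -⟪X.1, J Y.1⟫ := by
    rw [real_inner_comm, inner_J_left]
  rw [h1] at key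
  rw [real_inner_comm X.1 (J Y.1)]
  linarith

end IsHorizontalFrame

namespace IsUmbilicCMC

variable {c : ℝ} {p : H n}

theorem levelSet (h : IsUmbilicCMC S e α c) : ∀ q ∈ S, IsRegularLevelSetAt 2 S q :=
  h.hypersurface.contDiff_two

theorem horiz_mem_tangent (h : IsUmbilicCMC S e α c) (hp : p ∈ regularSet S) {v : Cn n}
    (hv : ⟪normal e p, v⟫ = 0) : horiz p v ∈ tangent S p := by
  rw [h.frame.mem_tangent_iff hp (h.levelSet p hp.1)]
  simpa using hv

theorem inner_normal_e : ⟪normal e p, e p⟫ = 0 := by simp [normal]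

theorem inner_e_normal : ⟪e p, normal e p⟫ = 0 := by simp [normal]

/-- The eigenvalue equations for the shape operator. -/
theorem first_order (h : IsUmbilicCMC S e α c) (hp : p ∈ regularSet S) :
    (∀ v, ⟪normal e p, v⟫ = 0 → ⟪e p, v⟫ = 0 →
      dNormal S e p (horiz p v) = -(mu c S e α p • v)) ∧
    dNormal S e p (horiz p (e p)) = -(ell S e p • e p) := by
  have hlev := h.levelSet p hp.1
  have hf := h.frame
  have he1 := hf.norm_eq_one p hp
  have hν1 := hf.norm_normal hp
  have hxi := hf.mem_xiPrime_iff hp hlev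
  have hht := hf.mem_horizTangent_iff hp hlev
  have hanti : ∀ v w, ⟪normal e p, v⟫ = 0 → ⟪normal e p, w⟫ = 0 →
      ⟪dNormal S e p (horiz p v), w⟫ - ⟪dNormal S e p (horiz p w), v⟫ = 2 * α p * ⟪J v, w⟫ := by
    intro v w hv hw
    simpa using hf.dNormal_antisymm hp h.levelSet (h.horiz_mem_tangent hp hw)
      (h.horiz_mem_tangent hp hv)
  obtain ⟨hinv, k, hk⟩ := h.umbilic p hp
  have hshape : ∀ v (hv : v ∈ horizTangent S p), v ∈ xiPrime S p →
      shape S e α p ⟨v, hv⟩ = -dNormal S e p (horiz p v) + α p • J v := by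
    intro v hv hv'
    have : (xiPrime S p).starProjection v = v := Submodule.starProjection_eq_self_iff.2 hv'
    simp only [shape, LinearMap.add_apply, LinearMap.neg_apply, LinearMap.smul_apply, covDeriv,
      Jprime, LinearMap.comp_apply, Submodule.subtype_apply, ContinuousLinearMap.coe_coe, this]
    rfl
  -- By `hanti` the antisymmetric part of dν on ξ' is αJ, which the term αJ' of the shape operator
  -- cancels. So the shape operator is symmetric on ξ', and a single eigenvalue makes it scalar.
  have hA := eq_smul_of_symmetric (W := xiPrime S p)
    (shape S e α p ∘ₗ Submodule.inclusion inf_le_left) (fun v => hinv _ v.2)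
    (fun v w => by
      have h1 := hanti v w ((hxi v).1 v.2).1 ((hxi w).1 w.2).1
      have h2 := inner_J_left (v : Cn n) (w : Cn n)
      have h3 := hshape _ ((inf_le_left : xiPrime S p ≤ _) v.2) v.2
      have h4 := hshape _ ((inf_le_left : xiPrime S p ≤ _) w.2) w.2
      change ⟪shape S e α p ⟨v, _⟩, (w : Cn n)⟫ = ⟪(v : Cn n), shape S e α p ⟨w, _⟩⟫
      rw [h3, h4, inner_add_left, inner_add_right, inner_neg_left, inner_neg_right,
        real_inner_smul_left, real_inner_smul_right, real_inner_comm (dNormal S e p (horiz p w))]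
      linear_combination -h1 - α p * h2)
    (k := k) fun m v hv hm =>
      hk m (Submodule.inclusion inf_le_left v) v.2
        (fun h0 => hv (by rw [← Submodule.coe_eq_zero] at h0 ⊢; exact h0)) hm
  have hkv : ∀ v, ⟪normal e p, v⟫ = 0 → ⟪e p, v⟫ = 0 →
      dNormal S e p (horiz p v) = -(k • v) + α p • J v := by
    intro v hv hv'
    have h1 : v ∈ xiPrime S p := (hxi v).2 ⟨hv, hv'⟩
    have h2 : shape S e α p ⟨v, (hht v).2 hv⟩ = k • v := hA ⟨v, h1⟩
    rw [hshape v _ h1] at h2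
    rw [← h2]
    abel
  have hJxi : ∀ v, ⟪normal e p, v⟫ = 0 → ⟪e p, v⟫ = 0 → ⟪e p, J v⟫ = 0 := by
    intro v hv _
    have := inner_J_left (e p) v
    rw [← normal, hv] at this
    linarith
  have hell : dNormal S e p (horiz p (e p)) = -(ell S e p • e p) := by
    -- The error x is orthogonal to e_n by the choice of `ell`, and to ν because |ν| = 1, so x ∈ ξ'.
    -- Since dν maps ξ' to itself, `hanti` for the pair e_n, x gives |x|² = 0.
    set x := dNormal S e p (horiz p (e p)) + ell S e p • e p with hx
    have hxe : ⟪e p, x⟫ = 0 := by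
      rw [hx, inner_add_right, real_inner_smul_right, real_inner_self_eq_norm_sq, he1, ell,
        real_inner_comm]
      ring
    have hxν : ⟪normal e p, x⟫ = 0 := by
      rw [hx, inner_add_right, real_inner_smul_right, inner_normal_e,
        hf.inner_normal_dNormal hp hlev (h.horiz_mem_tangent hp inner_normal_e)]
      simp
    have hx0 : ⟪x, x⟫ = 0 := by
      have h1 := hanti (e p) x inner_normal_e hxν
      have z1 : ⟪x, e p⟫ = 0 := by rw [real_inner_comm, hxe]
      have z2 : ⟪J x, e p⟫ = 0 := by rw [real_inner_comm, hJxi x hxν hxe]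
      rw [hkv x hxν hxe, inner_add_left, inner_neg_left, real_inner_smul_left,
        real_inner_smul_left, z1, z2, ← normal, hxν] at h1
      nth_rw 1 [hx]
      rw [inner_add_left, real_inner_smul_left, hxe]
      linarith
    rw [inner_self_eq_zero] at hx0
    rw [hx] at hx0
    exact eq_neg_of_add_eq_zero_left hx0
  have htrace : (2 * n - 2) * k + ell S e p = c := by
    rw [← h.pMean p hp, pMeanCurvature]
    have heH : e p ∈ horizTangent S p := (hht _).2 inner_normal_e
    -- The shape operator is k plus (l - k) times the projection to e_n, on a space of dimension 2n
    -- - 1.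
    have hB : ((horizTangent S p).orthogonalProjectionOnto : Cn n →ₗ[ℝ] horizTangent S p) ∘ₗ
        shape S e α p = k • LinearMap.id + (ell S e p - k) •
          (((innerₛₗ ℝ (e p)) ∘ₗ (horizTangent S p).subtype).smulRight
            (⟨e p, heH⟩ : horizTangent S p)) := by
      refine LinearMap.ext fun x => ?_
      have hxν := (hht _).1 x.2
      have hv : ⟪normal e p, (x : Cn n) - ⟪e p, x⟫ • e p⟫ = 0 := by
        rw [inner_sub_right, real_inner_smul_right, inner_normal_e, hxν]
        simp
      have hv' : ⟪e p, (x : Cn n) - ⟪e p, x⟫ • e p⟫ = 0 := by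
        rw [inner_sub_right, real_inner_smul_right, real_inner_self_eq_norm_sq, he1]
        ring
      have hvx := (hxi _).2 ⟨hv, hv'⟩
      have hx : x = ⟨_, (hht _).2 hv⟩ + ⟪e p, x⟫ • ⟨e p, heH⟩ := Subtype.ext (by simp)
      have hse : shape S e α p ⟨e p, heH⟩ = ell S e p • e p := by
        have h0 : (xiPrime S p).starProjection (e p) = 0 :=
          (Submodule.starProjection_apply_eq_zero_iff _).2 (hf.orthogonal p hp)
        simp only [shape, LinearMap.add_apply, LinearMap.neg_apply, LinearMap.smul_apply, covDeriv,
          Jprime, LinearMap.comp_apply, Submodule.subtype_apply, ContinuousLinearMap.coe_coe, h0,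
          map_zero, smul_zero, add_zero]
        rw [← neg_neg (ell S e p • e p), ← hell]
        rfl
      have hsx : shape S e α p x =
          k • ((x : Cn n) - ⟪e p, x⟫ • e p) + ⟪e p, x⟫ • ell S e p • e p := by
        conv_lhs => rw [hx]
        rw [map_add, map_smul, hse]
        exact congrArg (· + _) (hA ⟨_, hvx⟩)
      have hmem : shape S e α p x ∈ horizTangent S p := by
        rw [hsx, hht, inner_add_right, real_inner_smul_right, hv, real_inner_smul_right,
          real_inner_smul_right, inner_normal_e]
        simp
      refine Subtype.ext ?_
      have h1 := Submodule.starProjection_eq_self_iff.2 hmem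
      refine Eq.trans (b := shape S e α p x) h1 ?_
      rw [hsx]
      simp only [LinearMap.add_apply, LinearMap.smul_apply, LinearMap.id_apply,
        LinearMap.smulRight_apply, LinearMap.comp_apply, Submodule.subtype_apply,
        innerₛₗ_apply_apply, Submodule.coe_add, Submodule.coe_smul]
      module
    rw [hB, map_add, map_smul, map_smul, LinearMap.trace_id, LinearMap.trace_smulRight]
    have hfin : Module.finrank ℝ (horizTangent S p) = 2 * n - 1 := by
      have h1 : horizTangent S p = (ℝ ∙ normal e p)ᗮ := by
        ext v
        rw [hht, Submodule.mem_orthogonal_singleton_iff_inner_right]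
      have : Fact (Module.finrank ℝ (Cn n) = (2 * n - 1) + 1) :=
        ⟨by have := h.two_le; rw [finrank_Cn]; omega⟩
      rw [h1]
      exact Submodule.finrank_orthogonal_span_singleton (norm_ne_zero_iff.1 (by rw [hν1]; simp))
    have hcast : ((2 * n - 1 : ℕ) : ℝ) = 2 * n - 1 := by
      have := h.two_le
      rw [Nat.cast_sub (by omega)]
      push_cast
      ring
    rw [hfin, hcast]
    simp only [smul_eq_mul, LinearMap.comp_apply, Submodule.subtype_apply, innerₛₗ_apply_apply,
      real_inner_self_eq_norm_sq, he1]
    ring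
  refine ⟨fun v hv hv' => ?_, hell⟩
  have hn : (2 * (n : ℝ) - 2) ≠ 0 := by
    have : (2 : ℝ) ≤ n := by exact_mod_cast h.two_le
    linarith
  have hkk : kap c S e p = k := by
    rw [kap, ← htrace, add_sub_cancel_right, mul_div_cancel_left₀ _ hn]
  rw [hkv v hv hv', mu_smul, hkk]
  abel

end IsUmbilicCMC

/-! ### The Codazzi equations -/

theorem two_le_infty : (2 : WithTop ℕ∞) ≤ ∞ :=
  WithTop.coe_le_coe.2 (le_top : (2 : ℕ∞) ≤ ⊤)

/-- The component of the derivative of the horizontal normal along the contact form. -/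
def transversal (c : ℝ) (S : Set (H n)) (e : H n → Cn n) (α : H n → ℝ) (q : H n) : Cn n :=
  dNormal S e q (horiz q (α q • normal e q) + T) + mu c S e α q • (α q • normal e q)

namespace IsUmbilicCMC

variable {c : ℝ} {p : H n}

theorem transversal_mem_tangent (h : IsUmbilicCMC S e α c) (hp : p ∈ regularSet S) :
    horiz p (α p • normal e p) + T ∈ tangent S p := h.frame.alpha_mem p hp

/-- The derivative of the horizontal normal in terms of the coframe of `S`. -/
theorem dNormal_apply (h : IsUmbilicCMC S e α c) (hp : p ∈ regularSet S) {X : H n}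
    (hX : X ∈ tangent S p) :
    dNormal S e p X = -(mu c S e α p • X.1) + contactForm p X • transversal c S e α p +
      ⟪e p, X.1⟫ • ((kap c S e p - ell S e p) • e p - α p • normal e p) := by
  obtain ⟨h1, h2⟩ := h.first_order hp
  rw [h.frame.mem_tangent_iff hp (h.levelSet p hp.1)] at hX
  have he1 := h.frame.norm_eq_one p hp
  have hν1 := h.frame.norm_normal hp
  -- TS is spanned by ξ', e_n and αν + T; v is the component of X in ξ'.
  set v := X.1 - ⟪e p, X.1⟫ • e p - (α p * contactForm p X) • normal e p with hv
  have hdec : X = horiz p v + ⟪e p, X.1⟫ • horiz p (e p) +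
      contactForm p X • (horiz p (α p • normal e p) + T) := by
    conv_lhs => rw [eq_horiz_add p X]
    rw [hv]
    simp only [map_sub, map_smul]
    module
  have hvν : ⟪normal e p, v⟫ = 0 := by
    simp only [hv, inner_sub_right, real_inner_smul_right, inner_normal_e, hX,
      real_inner_self_eq_norm_sq, hν1]
    ring
  have hve : ⟪e p, v⟫ = 0 := by
    simp only [hv, inner_sub_right, real_inner_smul_right, inner_e_normal,
      real_inner_self_eq_norm_sq, he1]
    ring
  conv_lhs => rw [hdec]
  rw [map_add, map_add, map_smul, map_smul, h1 v hvν hve, h2, transversal, hv]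
  have hJe : J (e p) = normal e p := rfl
  simp only [mu_smul, map_sub, map_smul, hJe]
  module

/-- The geometric quantities of `S` extend smoothly to a neighbourhood of a regular point. -/
theorem exists_extension (h : IsUmbilicCMC S e α c) (hp : p ∈ regularSet S) :
    ∃ (U : Set (H n)) (u : H n → ℝ) (ν A : H n → Cn n) (a l : H n → ℝ), p ∈ U ∧
      IsDefiningFunction ∞ S U u ∧ ContDiffOn ℝ ∞ ν U ∧ ContDiffOn ℝ ∞ A U ∧
      ContDiffOn ℝ ∞ a U ∧ ContDiffOn ℝ ∞ l U ∧
      ∀ q ∈ U, q ∈ S → q ∈ regularSet S ∧ normal e q = ν q ∧ α q = a q ∧ ell S e q = l q ∧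
        transversal c S e α q = A q ∧ ∀ X ∈ tangent S q, dNormal S e q X = fderiv ℝ ν q X := by
  obtain ⟨U, u, hpU, hu, hN, hu'⟩ := h.frame.exists_adapted hp (h.hypersurface.smooth p hp)
    two_le_infty
  have hinf : (∞ : WithTop ℕ∞) + 1 ≤ ∞ := by simp
  have c1 : ContDiffOn ℝ ∞ (hgrad u) U := hu.contDiffOn_hgrad hinf
  have c2 : ContDiffOn ℝ ∞ (fun q => fderiv ℝ u q T) U := hu.contDiffOn_fderiv_T hinf
  have c3 : ContDiffOn ℝ ∞ (fun q => ‖hgrad u q‖⁻¹) U :=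
    (c1.norm ℝ hN).inv fun q hq => norm_ne_zero_iff.2 (hN q hq)
  have c4 : ContDiffOn ℝ ∞ (unitNormal u) U := c3.smul c1
  have c5 : ContDiffOn ℝ ∞ (fun q => -(‖hgrad u q‖⁻¹ * fderiv ℝ u q T)) U := (c3.mul c2).neg
  have c6 : ContDiffOn ℝ ∞ (fun q => -J (unitNormal u q)) U :=
    ((JL (n := n)).contDiff.comp_contDiffOn c4).neg
  have c7 : ContDiffOn ℝ ∞ (fderiv ℝ (unitNormal u)) U := c4.fderiv_of_isOpen hu.isOpen hinf
  set a := fun q => -(‖hgrad u q‖⁻¹ * fderiv ℝ u q T) with ha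
  set l := fun q => -⟪fderiv ℝ (unitNormal u) q (horiz q (-J (unitNormal u q))),
    -J (unitNormal u q)⟫ with hl
  have c8 : ContDiffOn ℝ ∞ l U :=
    ((c7.clm_apply (contDiff_horiz.comp_contDiffOn (contDiffOn_id.prodMk c6))).inner ℝ c6).neg
  set A := fun q => fderiv ℝ (unitNormal u) q (horiz q (a q • unitNormal u q) + T) +
    (((c - l q) / (2 * n - 2)) • a q • unitNormal u q - a q • a q • J (unitNormal u q)) with hA
  have c9 : ContDiffOn ℝ ∞ A U := by
    refine (c7.clm_apply ((contDiff_horiz.comp_contDiffOn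
      (contDiffOn_id.prodMk (c5.smul c4))).add contDiffOn_const)).add ?_
    exact (((contDiffOn_const.sub c8).div_const _).smul (c5.smul c4)).sub
      (c5.smul (c5.smul ((JL (n := n)).contDiff.comp_contDiffOn c4)))
  refine ⟨U, u, unitNormal u, A, a, l, hpU, hu, c4, c9, c5, c8, fun q hq hqS => ?_⟩
  obtain ⟨hr, hν, hα⟩ := hu' q hq hqS
  have hd : ∀ X ∈ tangent S q, dNormal S e q X = fderiv ℝ (unitNormal u) q X := by
    intro X hX
    have h1 : HasFDerivAt (unitNormal u) (fderiv ℝ (unitNormal u) q) q :=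
      ((c4.contDiffAt (hu.isOpen.mem_nhds hq)).differentiableAt (by simp)).hasFDerivAt
    refine fderivWithin_eq_on_tangent h1.hasFDerivWithinAt ?_ hqS hX
    filter_upwards [mem_nhdsWithin_of_mem_nhds (hu.isOpen.mem_nhds hq), self_mem_nhdsWithin]
      with q' h1 h2 using (hu' q' h1 h2).2.1
  have hν' : normal e q = unitNormal u q := hν
  replace hα : α q = a q := hα
  have he : e q = -J (unitNormal u q) := by rw [← hν']; simp [normal]
  have hl' : ell S e q = l q := by
    rw [ell, hd _ (h.horiz_mem_tangent hr inner_normal_e), he]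
  refine ⟨hr, hν, hα, hl', ?_, hd⟩
  rw [transversal, hd _ (h.transversal_mem_tangent hr), mu_smul, kap, hl', hν', hα, map_smul J]

/-- The derivative of the component `(k - l) e_n - α e_{2n}` of the second fundamental form. -/
def _root_.Heisenberg.dCross (c : ℝ) (S : Set (H n)) (e : H n → Cn n) (α : H n → ℝ) (p : H n) :
    H n →L[ℝ] Cn n :=
  (((kap c S e p - ell S e p) • -(JL.comp (dNormal S e p)) +
    (fderivWithin ℝ (kap c S e) S p - fderivWithin ℝ (ell S e) S p).smulRight (e p)) -
    (α p • dNormal S e p + (fderivWithin ℝ α S p).smulRight (normal e p)))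

theorem differentiableWithinAt (h : IsUmbilicCMC S e α c) (hp : p ∈ regularSet S) :
    DifferentiableWithinAt ℝ (ell S e) S p ∧ DifferentiableWithinAt ℝ (kap c S e) S p ∧
      DifferentiableWithinAt ℝ (transversal c S e α) S p := by
  obtain ⟨U, u, ν, A, a, l, hpU, hu, cν, cA, ca, cl, hU⟩ := h.exists_extension hp
  have hUp : U ∈ 𝓝 p := hu.isOpen.mem_nhds hpU
  have hev : ∀ᶠ q in 𝓝[S] p, q ∈ U ∧ q ∈ S := by
    filter_upwards [mem_nhdsWithin_of_mem_nhds hUp, self_mem_nhdsWithin] with q h1 h2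
      using ⟨h1, h2⟩
  obtain ⟨-, -, -, e1, e2, -⟩ := hU p hpU hp.1
  have h1 : DifferentiableWithinAt ℝ (ell S e) S p := by
    refine ((cl.contDiffAt hUp).differentiableAt (by simp)).differentiableWithinAt
      |>.congr_of_eventuallyEq ?_ e1
    filter_upwards [hev] with q hq using (hU q hq.1 hq.2).2.2.2.1
  have h2 : DifferentiableWithinAt ℝ (fun q => (c - ell S e q) / (2 * n - 2)) S p := by
    simp only [div_eq_mul_inv]
    exact (h1.const_sub c).mul_const _
  refine ⟨h1, h2, ?_⟩
  refine ((cA.contDiffAt hUp).differentiableAt (by simp)).differentiableWithinAt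
    |>.congr_of_eventuallyEq ?_ e2
  filter_upwards [hev] with q hq using (hU q hq.1 hq.2).2.2.2.2.1

theorem hasFDerivWithinAt_cross (h : IsUmbilicCMC S e α c) (hp : p ∈ regularSet S) :
    HasFDerivWithinAt (fun q => (kap c S e q - ell S e q) • e q - α q • normal e q)
      (dCross c S e α p) S p := by
  obtain ⟨hν, hα⟩ := h.frame.differentiableWithinAt hp (h.levelSet p hp.1)
  obtain ⟨hl, hk, -⟩ := h.differentiableWithinAt hp
  refine HasFDerivWithinAt.sub ?_ (hα.hasFDerivWithinAt.smul hν.hasFDerivWithinAt)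
  refine (hk.hasFDerivWithinAt.sub hl.hasFDerivWithinAt).smul ?_
  have h1 := (JL.hasFDerivAt.comp_hasFDerivWithinAt p hν.hasFDerivWithinAt).neg
  refine h1.congr_of_eventuallyEq (Eventually.of_forall fun q => ?_) ?_ <;> simp [normal]

/-- The symmetry of the second derivative of the horizontal normal. -/
theorem codazzi (h : IsUmbilicCMC S e α c) (hp : p ∈ regularSet S) {X Y : H n}
    (hX : X ∈ tangent S p) (hY : Y ∈ tangent S p) :
    fderivWithin ℝ (kap c S e) S p Y • X.1 - fderivWithin ℝ α S p Y • J X.1 -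
      (contactForm p X • fderivWithin ℝ (transversal c S e α) S p Y +
        ⟪X.1, J Y.1⟫ • transversal c S e α p) -
      (⟪e p, X.1⟫ • dCross c S e α p Y - ⟪X.1, J (dNormal S e p Y)⟫ •
        ((kap c S e p - ell S e p) • e p - α p • normal e p)) =
    fderivWithin ℝ (kap c S e) S p X • Y.1 - fderivWithin ℝ α S p X • J Y.1 -
      (contactForm p Y • fderivWithin ℝ (transversal c S e α) S p X +
        ⟪Y.1, J X.1⟫ • transversal c S e α p) -
      (⟪e p, Y.1⟫ • dCross c S e α p X - ⟪Y.1, J (dNormal S e p X)⟫ •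
        ((kap c S e p - ell S e p) • e p - α p • normal e p)) := by
  obtain ⟨U, u, ν, A, a, l, hpU, hu, cν, cA, ca, cl, hU⟩ := h.exists_extension hp
  have hUp : U ∈ 𝓝 p := hu.isOpen.mem_nhds hpU
  have hev : ∀ᶠ q in 𝓝[S] p, q ∈ U ∧ q ∈ S := by
    filter_upwards [mem_nhdsWithin_of_mem_nhds hUp, self_mem_nhdsWithin] with q h1 h2
      using ⟨h1, h2⟩
  obtain ⟨hν, hα⟩ := h.frame.differentiableWithinAt hp (h.levelSet p hp.1)
  obtain ⟨-, hk, hA⟩ := h.differentiableWithinAt hp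
  have hD : HasFDerivAt (fderiv ℝ ν) (fderiv ℝ (fderiv ℝ ν) p) p :=
    (((cν.fderiv_of_isOpen hu.isOpen (m := ∞) (by simp)).contDiffAt hUp).differentiableAt
      (by simp)).hasFDerivAt
  have hsymm : IsSymmSndFDerivAt ℝ ν p :=
    (cν.contDiffAt hUp).isSymmSndFDerivAt (by simpa using two_le_infty)
  -- The vanishing form is dν minus its expression in `dNormal_apply`. The second derivative of the
  -- smooth extension of ν is symmetric and drops out, leaving only first derivatives of k, l, α and
  -- the transversal vector.
  have key := hu.symmetric_of_vanishing two_le_infty hpU hp.1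
    (θ := fun q => (fderiv ℝ ν q : H n →ₗ[ℝ] Cn n) +
      (kap c S e q • LinearMap.fst ℝ (Cn n) ℝ - α q • J ∘ₗ LinearMap.fst ℝ (Cn n) ℝ) -
      (contactForm q).smulRight (transversal c S e α q) -
      (innerₛₗ ℝ (e q) ∘ₗ LinearMap.fst ℝ (Cn n) ℝ).smulRight
        ((kap c S e q - ell S e q) • e q - α q • normal e q))
    (θ' := fun X => (ContinuousLinearMap.apply ℝ (Cn n) X).comp (fderiv ℝ (fderiv ℝ ν) p) +
      ((fderivWithin ℝ (kap c S e) S p).smulRight X.1 -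
        (fderivWithin ℝ α S p).smulRight (J X.1)) -
      (contactForm p X • fderivWithin ℝ (transversal c S e α) S p +
        (((innerSL ℝ X.1).comp JL).comp (ContinuousLinearMap.fst ℝ (Cn n) ℝ)).smulRight
          (transversal c S e α p)) -
      (⟪e p, X.1⟫ • dCross c S e α p + ((innerSL ℝ X.1).comp
        (-(JL.comp (dNormal S e p)))).smulRight
          ((kap c S e p - ell S e p) • e p - α p • normal e p))) (fun X => by
      refine HasFDerivWithinAt.sub (HasFDerivWithinAt.sub (HasFDerivWithinAt.add ?_
        (HasFDerivWithinAt.sub ?_ ?_)) ?_) ?_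
      · exact ((ContinuousLinearMap.apply ℝ (Cn n) X).hasFDerivAt.comp p hD).hasFDerivWithinAt
      · exact hk.hasFDerivWithinAt.smul_const _
      · exact hα.hasFDerivWithinAt.smul_const _
      · exact (IsHorizontalFrame.hasFDerivWithinAt_contactForm S p X).smul hA.hasFDerivWithinAt
      · have h1 := (JL.hasFDerivAt.comp_hasFDerivWithinAt p hν.hasFDerivWithinAt).neg
        have h2 := (innerSL ℝ X.1).hasFDerivAt.comp_hasFDerivWithinAt p h1
        have h3 : HasFDerivWithinAt (fun q => ⟪e q, X.1⟫)
            ((innerSL ℝ X.1).comp (-(JL.comp (dNormal S e p)))) S p := by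
          refine h2.congr_of_eventuallyEq (Eventually.of_forall fun q => ?_) ?_ <;>
          simp [normal, real_inner_comm]
        exact h3.smul (h.hasFDerivWithinAt_cross hp)) (by
      filter_upwards [hev] with q hq X hX
      obtain ⟨hr, -, -, -, -, hd⟩ := hU q hq.1 hq.2
      have h1 := h.dNormal_apply hr hX
      rw [hd X hX, mu_smul] at h1
      simp only [LinearMap.sub_apply, LinearMap.add_apply, ContinuousLinearMap.coe_coe, h1,
        LinearMap.smul_apply, LinearMap.comp_apply, LinearMap.fst_apply, LinearMap.smulRight_apply,
        innerₛₗ_apply_apply]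
      module) hX hY
  simp only [_root_.sub_apply, _root_.add_apply, ContinuousLinearMap.comp_apply,
    ContinuousLinearMap.apply_apply, ContinuousLinearMap.smulRight_apply, _root_.smul_apply,
    innerSL_apply_apply, _root_.neg_apply, JL_apply, ContinuousLinearMap.coe_fst',
    inner_neg_right, neg_smul, ← sub_eq_add_neg, hsymm.eq Y X, add_sub_assoc] at key
  rw [← sub_eq_zero] at key ⊢
  rw [← key]
  module

end IsUmbilicCMC

/-- In complex dimension at least two, some unit vector is orthogonal to two given vectors. -/
theorem exists_norm_eq_one_orthogonal (hn : 2 ≤ n) (a b : Cn n) :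
    ∃ v : Cn n, ‖v‖ = 1 ∧ ⟪a, v⟫ = 0 ∧ ⟪b, v⟫ = 0 := by
  have h : LinearMap.ker ((innerₛₗ ℝ a).prod (innerₛₗ ℝ b)) ≠ ⊥ := by
    apply LinearMap.ker_ne_bot_of_finrank_lt
    rw [Module.finrank_prod, finrank_Cn, Module.finrank_self]
    omega
  obtain ⟨v, hv, hv0⟩ := (Submodule.ne_bot_iff _).1 h
  replace hv : (⟪a, v⟫, ⟪b, v⟫) = ((0 : ℝ), (0 : ℝ)) := hv
  rw [Prod.mk.injEq] at hv
  refine ⟨‖v‖⁻¹ • v, ?_, ?_, ?_⟩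
  · rw [norm_smul, norm_inv, norm_norm, inv_mul_cancel₀ (norm_ne_zero_iff.2 hv0)]
  · rw [real_inner_smul_right]
    exact mul_eq_zero_of_right _ hv.1
  · rw [real_inner_smul_right]
    exact mul_eq_zero_of_right _ hv.2

namespace IsUmbilicCMC

variable {c : ℝ} {p : H n}

theorem ell_eq (h : IsUmbilicCMC S e α c) (q : H n) :
    ell S e q = c - (2 * n - 2) * kap c S e q := by
  have hn : (2 * (n : ℝ) - 2) ≠ 0 := by
    have : (2 : ℝ) ≤ n := by exact_mod_cast h.two_le
    linarith
  rw [kap, mul_div_cancel₀ _ hn]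
  ring

theorem fderivWithin_ell (h : IsUmbilicCMC S e α c) (hp : p ∈ regularSet S) {X : H n}
    (hX : X ∈ tangent S p) :
    fderivWithin ℝ (ell S e) S p X = -((2 * n - 2) * fderivWithin ℝ (kap c S e) S p X) := by
  have h1 := (h.differentiableWithinAt hp).2.1.hasFDerivWithinAt
  have h2 := (h1.const_mul (2 * (n : ℝ) - 2)).const_sub c
  rw [fderivWithin_eq_on_tangent h2 (Eventually.of_forall fun q => h.ell_eq q) hp.1 hX]
  simp

/-- Orthogonality relations of a vector of `ξ'` and its image under the complex structure. -/
theorem xi_relations {v : Cn n} (hv : ⟪normal e p, v⟫ = 0) (hv' : ⟪e p, v⟫ = 0) :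
    ⟪v, normal e p⟫ = 0 ∧ ⟪v, e p⟫ = 0 ∧ ⟪J v, normal e p⟫ = 0 ∧ ⟪J v, e p⟫ = 0 ∧
      ⟪normal e p, J v⟫ = 0 ∧ ⟪e p, J v⟫ = 0 := by
  have h1 : ⟪normal e p, J v⟫ = 0 := by rw [normal, inner_J_J, hv']
  have h2 : ⟪e p, J v⟫ = 0 := by
    have := inner_J_left (e p) v
    rw [← normal, hv] at this
    linarith
  refine ⟨?_, ?_, ?_, ?_, h1, h2⟩
  · rw [real_inner_comm, hv]
  · rw [real_inner_comm, hv']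
  · rw [real_inner_comm, h1]
  · rw [real_inner_comm, h2]

/-- The value of the derivative of the second fundamental form in the directions of `ξ'`. -/
theorem codazzi_xi_e (h : IsUmbilicCMC S e α c) (hp : p ∈ regularSet S) {v : Cn n}
    (hv1 : ‖v‖ = 1) (hv : ⟪normal e p, v⟫ = 0) (hv' : ⟪e p, v⟫ = 0) :
    fderivWithin ℝ (kap c S e) S p (horiz p v) = 0 ∧
    fderivWithin ℝ (kap c S e) S p (horiz p (e p)) = α p * (ell S e p - 2 * kap c S e p) ∧
    fderivWithin ℝ α S p (horiz p (e p)) =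
      kap c S e p ^ 2 - kap c S e p * ell S e p - α p ^ 2 := by
  obtain ⟨r1, r2, r3, r4, r5, r6⟩ := xi_relations hv hv'
  have he1 := h.frame.norm_eq_one p hp
  have hν1 := h.frame.norm_normal hp
  obtain ⟨f1, f2⟩ := h.first_order hp
  have fv := f1 v hv hv'
  have hJe : J (e p) = normal e p := rfl
  have hJν : J (normal e p) = -e p := by simp [normal]
  have tv := h.horiz_mem_tangent hp hv
  have te := h.horiz_mem_tangent hp (inner_normal_e (e := e) (p := p))
  have key := h.codazzi hp tv te
  simp only [horiz_fst, contactForm_horiz, fv, f2, hJe, r1, hv', zero_smul,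
    real_inner_self_eq_norm_sq, he1, mu_smul, map_neg, map_smul, map_sub, J_J, inner_neg_right,
    inner_sub_right, real_inner_smul_right, r6, dCross, _root_.sub_apply,
    _root_.add_apply, _root_.smul_apply, ContinuousLinearMap.smulRight_apply, _root_.neg_apply,
    ContinuousLinearMap.comp_apply, JL_apply, one_pow, one_smul, mul_zero, neg_zero, sub_zero,
    add_zero, sub_self, h.fderivWithin_ell hp tv] at key
  -- The components along e_n, v and Jv give in turn dk(v) = 0, dk(e_n) and dα(e_n). In the first
  -- one the factor 2n - 2 must be cancelled.
  have k1 := congrArg (fun x => ⟪e p, x⟫) key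
  have k2 := congrArg (fun x => ⟪v, x⟫) key
  have k3 := congrArg (fun x => ⟪J v, x⟫) key
  simp only [inner_sub_right, inner_add_right, inner_neg_right, real_inner_smul_right,
    real_inner_self_eq_norm_sq, he1, hv', r2, r1, r3, r4, r6, inner_e_normal, norm_J, hv1,
    inner_self_J, inner_J_self] at k1 k2 k3
  have hn : (2 * (n : ℝ) - 2) ≠ 0 := by
    have : (2 : ℝ) ≤ n := by exact_mod_cast h.two_le
    linarith
  refine ⟨?_, by linarith, by linarith⟩
  have : (2 * (n : ℝ) - 2) * fderivWithin ℝ (kap c S e) S p (horiz p v) = 0 := by linarith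
  exact (mul_eq_zero.1 this).resolve_left hn

/-- The first order relation `dNormal_antisymm` for v and αν + T. It gives an expression of the
ξ'-part of the transversal vector independent of the Codazzi equation. -/
theorem inner_dNormal_transversal (h : IsUmbilicCMC S e α c) (hp : p ∈ regularSet S) {v : Cn n}
    (hv : ⟪normal e p, v⟫ = 0) (hv' : ⟪e p, v⟫ = 0) :
    ⟪v, dNormal S e p (horiz p (α p • normal e p) + T)⟫ =
      -fderivWithin ℝ α S p (horiz p v) := by
  obtain ⟨r1, r2, r3, r4, r5, r6⟩ := xi_relations hv hv'
  have hJν : J (normal e p) = -e p := by simp [normal]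
  have h1 := h.frame.dNormal_antisymm hp h.levelSet (h.horiz_mem_tangent hp hv)
    (h.transversal_mem_tangent hp)
  have fv := (h.first_order hp).1 v hv hv'
  rw [real_inner_comm]
  simp only [Prod.fst_add, horiz_fst, T_fst, add_zero, map_add (contactForm p), contactForm_horiz,
    contactForm_T, zero_add, map_smul J, hJν, fv, mu_smul, inner_neg_left, inner_sub_left,
    real_inner_smul_left, real_inner_smul_right, r1, r3, hv'] at h1 ⊢
  linarith

/-- For the pair v, Jv the Codazzi equation yields 2⟨v, A⟩ = dα(v) for the transversal vector A,
whereas `inner_dNormal_transversal` yields ⟨v, A⟩ = -dα(v). Hence dα vanishes on ξ', and the same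
equation then determines A. -/
theorem codazzi_xi_xi (h : IsUmbilicCMC S e α c) (hp : p ∈ regularSet S) {v : Cn n}
    (hv1 : ‖v‖ = 1) (hv : ⟪normal e p, v⟫ = 0) (hv' : ⟪e p, v⟫ = 0) :
    fderivWithin ℝ α S p (horiz p v) = 0 ∧ transversal c S e α p =
      -(kap c S e p • ((kap c S e p - ell S e p) • e p - α p • normal e p)) := by
  obtain ⟨f1, f2⟩ := h.first_order hp
  have hJe : J (e p) = normal e p := rfl
  have key : ∀ v, ‖v‖ = 1 → ⟪normal e p, v⟫ = 0 → ⟪e p, v⟫ = 0 →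
      fderivWithin ℝ α S p (horiz p v) = 0 ∧ (2 : ℝ) • (transversal c S e α p +
        kap c S e p • ((kap c S e p - ell S e p) • e p - α p • normal e p)) =
      fderivWithin ℝ α S p (horiz p v) • v + fderivWithin ℝ α S p (horiz p (J v)) • J v := by
    intro v hv1 hv hv'
    obtain ⟨r1, r2, r3, r4, r5, r6⟩ := xi_relations hv hv'
    have tv := h.horiz_mem_tangent hp hv
    have tJ := h.horiz_mem_tangent hp r5
    have dk1 := (h.codazzi_xi_e hp hv1 hv hv').1
    have dk2 := (h.codazzi_xi_e hp (by rw [norm_J, hv1]) r5 r6).1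
    have key := h.codazzi hp tv tJ
    simp only [horiz_fst, contactForm_horiz, f1 v hv hv', f1 _ r5 r6, dk1, dk2, hv', r6, zero_smul,
      mu_smul, map_neg, map_smul, map_sub, map_add, J_J, inner_neg_right,
      inner_add_right, real_inner_smul_right, real_inner_self_eq_norm_sq, norm_J, hv1, inner_self_J,
      inner_J_self, one_pow, mul_zero, mul_one, zero_sub, zero_add,
      smul_neg, sub_neg_eq_add, one_smul] at key
    have k2 : (2 : ℝ) • (transversal c S e α p +
        kap c S e p • ((kap c S e p - ell S e p) • e p - α p • normal e p)) =
      fderivWithin ℝ α S p (horiz p v) • v + fderivWithin ℝ α S p (horiz p (J v)) • J v := by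
      rw [← sub_eq_zero] at key ⊢
      rw [← key]
      module
    refine ⟨?_, k2⟩
    have k3 := congrArg (fun x => ⟪v, x⟫) k2
    have k4 := h.inner_dNormal_transversal hp hv hv'
    simp only [transversal, mu_smul, map_smul J, inner_sub_right, inner_add_right,
      real_inner_smul_right, real_inner_self_eq_norm_sq, k4, r1, r2, hv1, inner_self_J] at k3
    have hJν : ⟪v, J (normal e p)⟫ = 0 := by
      rw [normal, J_J, inner_neg_right, r2, neg_zero]
    rw [hJν] at k3
    linarith
  obtain ⟨r1, r2, r3, r4, r5, r6⟩ := xi_relations hv hv'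
  obtain ⟨k1, k2⟩ := key v hv1 hv hv'
  have k3 := (key (J v) (by rw [norm_J, hv1]) r5 r6).1
  refine ⟨k1, ?_⟩
  rw [k1, k3, zero_smul, zero_smul, add_zero, smul_eq_zero_iff_right (by norm_num)] at k2
  exact eq_neg_of_add_eq_zero_left k2

theorem transversal_eq (h : IsUmbilicCMC S e α c) (hp : p ∈ regularSet S) :
    transversal c S e α p =
      -(kap c S e p • ((kap c S e p - ell S e p) • e p - α p • normal e p)) := by
  obtain ⟨v, hv1, hv, hv'⟩ := exists_norm_eq_one_orthogonal h.two_le (normal e p) (e p)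
  exact (h.codazzi_xi_xi hp hv1 hv hv').2

/-- The Codazzi equation for a unit vector v of ξ' and αν + T. Its components along v and Jv give dk
and dα in the last direction; both equal -k times the values on e_n, which is why only ζ enters the
structure equations. -/
theorem codazzi_transversal (h : IsUmbilicCMC S e α c) (hp : p ∈ regularSet S) :
    fderivWithin ℝ (kap c S e) S p (horiz p (α p • normal e p) + T) =
      -(kap c S e p * (α p * (ell S e p - 2 * kap c S e p))) ∧
    fderivWithin ℝ α S p (horiz p (α p • normal e p) + T) =
      -(kap c S e p * (kap c S e p ^ 2 - kap c S e p * ell S e p - α p ^ 2)) := by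
  obtain ⟨v, hv1, hv, hv'⟩ := exists_norm_eq_one_orthogonal h.two_le (normal e p) (e p)
  obtain ⟨r1, r2, r3, r4, r5, r6⟩ := xi_relations hv hv'
  obtain ⟨f1, f2⟩ := h.first_order hp
  have hJe : J (e p) = normal e p := rfl
  have hJν : J (normal e p) = -e p := by simp [normal]
  have tv := h.horiz_mem_tangent hp hv
  have tT := h.transversal_mem_tangent hp
  have dk := (h.codazzi_xi_e hp hv1 hv hv').1
  have da := (h.codazzi_xi_xi hp hv1 hv hv').1
  have da2 := (h.codazzi_xi_xi hp (by rw [norm_J, hv1]) r5 r6).1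
  have hA := (h.differentiableWithinAt hp).2.2.hasFDerivWithinAt
  have hk := (h.differentiableWithinAt hp).2.1.hasFDerivWithinAt
  -- The formula `transversal_eq` holds at all nearby points of S, so it may be differentiated;
  -- dk(v) = 0 removes one term.
  have hdA : fderivWithin ℝ (transversal c S e α) S p (horiz p v) =
      -(kap c S e p • dCross c S e α p (horiz p v)) := by
    have := fderivWithin_eq_on_tangent (hk.smul (h.hasFDerivWithinAt_cross hp)).neg
      (f := transversal c S e α) (by
        filter_upwards [h.frame.eventually_regularSet hp (h.levelSet p hp.1)] with q hq
        exact h.transversal_eq hq) hp.1 tv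
    rw [this]
    simp [dk]
  have key := h.codazzi hp tv tT
  have hd : ⟪v, J (dNormal S e p (horiz p (α p • normal e p) + T))⟫ = 0 := by
    have h1 := inner_J_left v (dNormal S e p (horiz p (α p • normal e p) + T))
    rw [h.inner_dNormal_transversal hp r5 r6, da2] at h1
    linarith
  simp only [hd, hdA, Prod.fst_add, horiz_fst, T_fst, add_zero, map_add (contactForm p),
    contactForm_horiz, contactForm_T,
    zero_add, f1 v hv hv', dk, da, hv', zero_smul, real_inner_smul_left, inner_e_normal,
      mu_smul, map_neg, map_smul J, map_sub, J_J, inner_neg_right, inner_add_right, hJν, r2, r5,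
      hv, h.fderivWithin_ell hp tv, dCross, _root_.sub_apply,
    _root_.add_apply, _root_.smul_apply, ContinuousLinearMap.smulRight_apply, _root_.neg_apply,
    ContinuousLinearMap.comp_apply, JL_apply,
      real_inner_smul_right, mul_zero, neg_zero, sub_zero,
      smul_neg, neg_neg, sub_neg_eq_add, one_smul, sub_self] at key
  have k2 := congrArg (fun x => ⟪v, x⟫) key
  have k3 := congrArg (fun x => ⟪J v, x⟫) key
  simp only [inner_sub_right, inner_add_right, real_inner_smul_right,
    real_inner_self_eq_norm_sq, norm_J, hv1,
    inner_self_J, inner_J_self] at k2 k3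
  constructor <;> linarith

/-- The form `⟨e_n, dz⟩ - k Θ` along `S`. -/
def _root_.Heisenberg.zeta (c : ℝ) (S : Set (H n)) (e : H n → Cn n) (p X : H n) : ℝ :=
  ⟪e p, X.1⟫ - kap c S e p * contactForm p X

/-- The structure equations of an umbilic hypersurface of constant `p`-mean curvature. -/
theorem structure_equations (h : IsUmbilicCMC S e α c) (hp : p ∈ regularSet S) {X : H n}
    (hX : X ∈ tangent S p) :
    dNormal S e p X = -(mu c S e α p • X.1) +
      zeta c S e p X • ((kap c S e p - ell S e p) • e p - α p • normal e p) ∧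
    fderivWithin ℝ (kap c S e) S p X = α p * (ell S e p - 2 * kap c S e p) * zeta c S e p X ∧
    fderivWithin ℝ α S p X =
      (kap c S e p ^ 2 - kap c S e p * ell S e p - α p ^ 2) * zeta c S e p X := by
  have hX' := (h.frame.mem_tangent_iff hp (h.levelSet p hp.1) X).1 hX
  have he1 := h.frame.norm_eq_one p hp
  have hν1 := h.frame.norm_normal hp
  refine ⟨?_, ?_⟩
  · rw [h.dNormal_apply hp hX, h.transversal_eq hp, zeta]
    module
  set v := X.1 - ⟪e p, X.1⟫ • e p - (α p * contactForm p X) • normal e p with hv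
  have hdec : X = horiz p v + ⟪e p, X.1⟫ • horiz p (e p) +
      contactForm p X • (horiz p (α p • normal e p) + T) := by
    conv_lhs => rw [eq_horiz_add p X]
    rw [hv]
    simp only [map_sub, map_smul]
    module
  have hvν : ⟪normal e p, v⟫ = 0 := by
    simp only [hv, inner_sub_right, real_inner_smul_right, inner_normal_e, hX',
      real_inner_self_eq_norm_sq, hν1]
    ring
  have hve : ⟪e p, v⟫ = 0 := by
    simp only [hv, inner_sub_right, real_inner_smul_right, inner_e_normal,
      real_inner_self_eq_norm_sq, he1]
    ring
  obtain ⟨w, hw1, hw, hw'⟩ := exists_norm_eq_one_orthogonal h.two_le (normal e p) (e p)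
  obtain ⟨-, c2, c3⟩ := h.codazzi_xi_e hp hw1 hw hw'
  obtain ⟨c4, c5⟩ := h.codazzi_transversal hp
  have hxi : fderivWithin ℝ (kap c S e) S p (horiz p v) = 0 ∧
      fderivWithin ℝ α S p (horiz p v) = 0 := by
    by_cases hv0 : v = 0
    · simp [hv0]
    have hn0 : ‖v‖ ≠ 0 := norm_ne_zero_iff.2 hv0
    have h1 : ‖‖v‖⁻¹ • v‖ = 1 := by
      rw [norm_smul, norm_inv, norm_norm, inv_mul_cancel₀ hn0]
    have h2 : ⟪normal e p, ‖v‖⁻¹ • v⟫ = 0 := by rw [real_inner_smul_right, hvν, mul_zero]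
    have h3 : ⟪e p, ‖v‖⁻¹ • v⟫ = 0 := by rw [real_inner_smul_right, hve, mul_zero]
    have h4 := (h.codazzi_xi_e hp h1 h2 h3).1
    have h5 := (h.codazzi_xi_xi hp h1 h2 h3).1
    rw [map_smul, map_smul, smul_eq_zero_iff_right (inv_ne_zero hn0)] at h4 h5
    exact ⟨h4, h5⟩
  constructor
  · conv_lhs => rw [hdec]
    rw [map_add, map_add, map_smul, map_smul, hxi.1, c2, c4, zeta, smul_eq_mul, smul_eq_mul]
    ring
  · conv_lhs => rw [hdec]
    rw [map_add, map_add, map_smul, map_smul, hxi.2, c3, c5, zeta, smul_eq_mul, smul_eq_mul]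
    ring

end IsUmbilicCMC

/-! ### Locally constant quantities -/

/-- `f` is differentiable within `S` at `p`, with vanishing derivative along the tangent space. -/
def TangentiallyConst {F : Type*} [NormedAddCommGroup F] [NormedSpace ℝ F] (S : Set (H n))
    (f : H n → F) (p : H n) : Prop :=
  ∃ f' : H n →L[ℝ] F, HasFDerivWithinAt f f' S p ∧ ∀ v ∈ tangent S p, f' v = 0

/-- The squared modulus of `k - i α`. -/
def modSq (c : ℝ) (S : Set (H n)) (e : H n → Cn n) (α : H n → ℝ) (q : H n) : ℝ :=
  kap c S e q ^ 2 + α q ^ 2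

/-- The centre `z + e_{2n} / (k - i α)` of the spheres foliating `S`. -/
def center (c : ℝ) (S : Set (H n)) (e : H n → Cn n) (α : H n → ℝ) (q : H n) : Cn n :=
  q.1 + ((kap c S e q * (modSq c S e α q)⁻¹) • normal e q +
    (α q * (modSq c S e α q)⁻¹) • J (normal e q))

/-- The deviation of `k` from its value on the Pansu sphere, normalized to be locally constant. -/
def deviation (c : ℝ) (S : Set (H n)) (e : H n → Cn n) (α : H n → ℝ) (q : H n) : ℝ :=
  (kap c S e q - c / (2 * n)) * (modSq c S e α q)⁻¹ ^ n

/-- The height on the Pansu sphere with parameter `lam` as a function of `α`. -/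
def heightFun (lam a : ℝ) : ℝ :=
  1 / (2 * lam ^ 2) * (Real.arctan (a / lam) + lam * a / (lam ^ 2 + a ^ 2))

theorem hasDerivAt_heightFun {lam : ℝ} (hl : 0 < lam) (a : ℝ) :
    HasDerivAt (heightFun lam) (lam / (lam ^ 2 + a ^ 2) ^ 2) a := by
  have hne : lam ^ 2 + a ^ 2 ≠ 0 := by positivity
  have hne' : 1 + (a / lam) ^ 2 ≠ 0 := by positivity
  have h1 := ((hasDerivAt_id a).div_const lam).arctan
  have h2 := ((hasDerivAt_id a).const_mul lam).div
    (((hasDerivAt_id a).pow 2).const_add (lam ^ 2)) hne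
  have h3 := (h1.add h2).const_mul (1 / (2 * lam ^ 2))
  refine HasDerivAt.congr_deriv (f := heightFun lam) h3 ?_
  simp only [id, Pi.pow_apply]
  have h4 : 1 / (1 + (a / lam) ^ 2) = lam ^ 2 / (lam ^ 2 + a ^ 2) := by field_simp
  rw [h4]
  field_simp
  push_cast
  ring

/-- The height of the centre. -/
def centerHeight (c : ℝ) (S : Set (H n)) (e : H n → Cn n) (α : H n → ℝ) (q : H n) : ℝ :=
  q.2 + ⟪J (center c S e α q), q.1⟫ - heightFun (c / (2 * n)) (α q)

namespace IsUmbilicCMC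

variable {c : ℝ} {p : H n}

/-- In d(k² + α²) the terms with l cancel, leaving -2α(k² + α²)ζ. -/
theorem hasFDerivWithinAt_modSq_inv (h : IsUmbilicCMC S e α c) (hp : p ∈ regularSet S)
    (hμ : modSq c S e α p ≠ 0) :
    ∃ f' : H n →L[ℝ] ℝ, HasFDerivWithinAt (fun q => (modSq c S e α q)⁻¹) f' S p ∧
      ∀ X ∈ tangent S p, f' X = 2 * α p * (modSq c S e α p)⁻¹ * zeta c S e p X := by
  have hα := (h.frame.differentiableWithinAt hp (h.levelSet p hp.1)).2.hasFDerivWithinAt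
  have hk := (h.differentiableWithinAt hp).2.1.hasFDerivWithinAt
  have h1 : HasFDerivWithinAt (modSq c S e α) _ S p := (hk.pow 2).add (hα.pow 2)
  have h2 := (hasDerivAt_inv hμ).comp_hasFDerivWithinAt p h1
  refine ⟨_, h2, fun X hX => ?_⟩
  obtain ⟨-, s2, s3⟩ := h.structure_equations hp hX
  simp only [_root_.smul_apply, _root_.add_apply, s2, s3, smul_eq_mul, nsmul_eq_mul]
  field_simp
  rw [modSq]
  push_cast
  ring

/-- Because l - 2k = -2n(k - c/2n), the logarithmic derivative of the first factor is -2nαζ; the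
n-th power of the inverse modulus contributes 2nαζ. -/
theorem tangentiallyConst_deviation (h : IsUmbilicCMC S e α c) (hp : p ∈ regularSet S)
    (hμ : modSq c S e α p ≠ 0) : TangentiallyConst S (deviation c S e α) p := by
  obtain ⟨f', hf, hf'⟩ := h.hasFDerivWithinAt_modSq_inv hp hμ
  have hk := (h.differentiableWithinAt hp).2.1.hasFDerivWithinAt
  refine ⟨_, (hk.sub_const (c / (2 * n))).mul (hf.pow n), fun X hX => ?_⟩
  obtain ⟨-, s2, s3⟩ := h.structure_equations hp hX
  obtain ⟨m, hm⟩ : ∃ m, n = m + 1 := ⟨n - 1, by have := h.two_le; omega⟩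
  have hn : (n : ℝ) ≠ 0 := by have := h.two_le; positivity
  simp only [_root_.smul_apply, _root_.add_apply, s2, hf' X hX, smul_eq_mul, nsmul_eq_mul,
    h.ell_eq]
  have hpow : (modSq c S e α p)⁻¹ ^ n = (modSq c S e α p)⁻¹ ^ (n - 1) * (modSq c S e α p)⁻¹ := by
    rw [← pow_succ, Nat.sub_add_cancel (by have := h.two_le; omega)]
  rw [hpow]
  field_simp
  ring

/-- Dividing -(k - iα)dz by k - iα cancels dz, and the structure equations for k and α cancel all
multiples of ζ. -/
theorem tangentiallyConst_center (h : IsUmbilicCMC S e α c) (hp : p ∈ regularSet S)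
    (hμ : modSq c S e α p ≠ 0) : TangentiallyConst S (center c S e α) p := by
  obtain ⟨f', hf, hf'⟩ := h.hasFDerivWithinAt_modSq_inv hp hμ
  obtain ⟨hν, hα⟩ := h.frame.differentiableWithinAt hp (h.levelSet p hp.1)
  have hν := hν.hasFDerivWithinAt
  have hα := hα.hasFDerivWithinAt
  have hk := (h.differentiableWithinAt hp).2.1.hasFDerivWithinAt
  have hJ := JL.hasFDerivAt.comp_hasFDerivWithinAt p hν
  have hz := (ContinuousLinearMap.fst ℝ (Cn n) ℝ).hasFDerivWithinAt (s := S) (x := p)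
  refine ⟨_, hz.add (((hk.mul hf).smul hν).add ((hα.mul hf).smul hJ)), fun X hX => ?_⟩
  obtain ⟨s1, s2, s3⟩ := h.structure_equations hp hX
  have hJν : J (normal e p) = -e p := by simp [normal]
  have hJe : J (e p) = normal e p := rfl
  change X.1 + (((_ : ℝ) • dNormal S e p X + (_ : ℝ) • normal e p) +
    ((_ : ℝ) • J (dNormal S e p X) + (_ : ℝ) • J (normal e p))) = 0
  rw [s1, mu_smul]
  simp only [_root_.smul_apply, _root_.add_apply, s2, s3, hf' X hX, smul_eq_mul, map_add, map_neg,
    map_sub, map_smul, J_J, hJν, hJe, Pi.mul_apply,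
    ContinuousLinearMap.coe_coe]
  have hR : (modSq c S e α p)⁻¹ = (kap c S e p ^ 2 + α p ^ 2)⁻¹ := rfl
  have hR' : kap c S e p ^ 2 + α p ^ 2 ≠ 0 := hμ
  -- Giving dz this factor 1 turns the claim into a polynomial identity in k, α, l and the inverse
  -- modulus.
  have hx : (X.1 : Cn n) = ((kap c S e p ^ 2 + α p ^ 2) * (modSq c S e α p)⁻¹) • X.1 := by
    rw [hR, mul_inv_cancel₀ hR', one_smul]
  nth_rw 1 [hx]
  module

/-- With k = λ and l = 2λ one has dα = -(λ² + α²)ζ. Both dt + ⟨JF, dz⟩ and the differential of h(α)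
equal -λζ/(λ² + α²). -/
theorem tangentiallyConst_centerHeight (h : IsUmbilicCMC S e α c) (hc : 0 < c)
    (hp : p ∈ regularSet S) (hk : kap c S e p = c / (2 * n)) :
    TangentiallyConst S (centerHeight c S e α) p := by
  have hn : (0 : ℝ) < n := by have := h.two_le; positivity
  have hl : 0 < c / (2 * n) := by positivity
  have hell : ell S e p = 2 * kap c S e p := by
    rw [h.ell_eq, hk]
    field_simp
    ring
  have hR' : 0 < kap c S e p ^ 2 + α p ^ 2 := by rw [hk]; positivity
  have hR'' : kap c S e p ^ 2 + α p ^ 2 ≠ 0 := hR'.ne'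
  have hR : modSq c S e α p = kap c S e p ^ 2 + α p ^ 2 := rfl
  obtain ⟨f', hf, hf'⟩ := h.tangentiallyConst_center hp hR'.ne'
  have hα := (h.frame.differentiableWithinAt hp (h.levelSet p hp.1)).2.hasFDerivWithinAt
  have hJ := JL.hasFDerivAt.comp_hasFDerivWithinAt p hf
  have hz := (ContinuousLinearMap.fst ℝ (Cn n) ℝ).hasFDerivWithinAt (s := S) (x := p)
  have ht := (ContinuousLinearMap.snd ℝ (Cn n) ℝ).hasFDerivWithinAt (s := S) (x := p)
  refine ⟨_, (ht.add (hJ.inner ℝ hz)).sub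
    ((hasDerivAt_heightFun hl (α p)).comp_hasFDerivWithinAt p hα), fun X hX => ?_⟩
  obtain ⟨-, -, s3⟩ := h.structure_equations hp hX
  have hX' := (h.frame.mem_tangent_iff hp (h.levelSet p hp.1) X).1 hX
  have hJν : J (normal e p) = -e p := by simp [normal]
  have hJe : J (e p) = normal e p := rfl
  simp only [_root_.sub_apply, _root_.add_apply, ContinuousLinearMap.comp_apply,
    ContinuousLinearMap.prod_apply, fderivInnerCLM_apply, hf' X hX, _root_.smul_apply, s3,
    ContinuousLinearMap.coe_fst', ContinuousLinearMap.coe_snd', map_zero, inner_zero_left,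
    Function.comp_apply, JL_apply]
  have hΘ := contactForm_apply p X
  have hcen : J (center c S e α p) = J p.1 + ((kap c S e p * (modSq c S e α p)⁻¹) • (-e p) -
      (α p * (modSq c S e α p)⁻¹) • normal e p) := by
    rw [center]
    simp only [map_add, map_smul, hJν, map_neg, hJe]
    module
  have hin : ⟪J (center c S e α p), X.1⟫ = ⟪J p.1, X.1⟫ -
      kap c S e p * (modSq c S e α p)⁻¹ * ⟪e p, X.1⟫ -
      α p * (modSq c S e α p)⁻¹ * (α p * contactForm p X) := by
    rw [hcen]
    simp only [inner_add_left, inner_sub_left, real_inner_smul_left, inner_neg_left, hX']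
    ring
  change X.2 + (⟪J (center c S e α p), X.1⟫ + 0) - _ = 0
  rw [hin, hell, hR, zeta, smul_eq_mul, ← hk]
  have hX2 : X.2 = contactForm p X - ⟪J p.1, X.1⟫ := by rw [hΘ]; ring
  rw [hX2]
  field_simp
  ring

/-- A tangentially constant function is locally constant. -/
theorem _root_.Heisenberg.eventually_eq_of_tangentiallyConst (hn : 1 ≤ n) {F : Type*}
    [NormedAddCommGroup F] [NormedSpace ℝ F] (hS : IsRegularLevelSetAt 2 S p) (hp : p ∈ S)
    {f : H n → F} (hf : ∀ᶠ q in 𝓝[S] p, TangentiallyConst S f q) :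
    ∀ᶠ q in 𝓝[S] p, f q = f p := by
  obtain ⟨a, ha⟩ := eventually_const_of_tangential hn hS (by norm_num) hp
    (hf.filter_mono (nhdsWithin_mono p sdiff_subset))
  have hcont : ContinuousWithinAt f S p := by
    obtain ⟨f', hf', -⟩ := hf.self_of_nhdsWithin hp
    exact hf'.continuousWithinAt
  have := neBot_punctured hn hS (by norm_num) hp
  have hpa : f p = a := by
    refine tendsto_nhds_unique (l := 𝓝[S \ {p}] p)
      (hcont.tendsto.mono_left (nhdsWithin_mono p sdiff_subset)) ?_
    exact tendsto_const_nhds.congr' (ha.mono fun q hq => hq.symm)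
  rw [eventually_nhdsWithin_iff] at ha ⊢
  filter_upwards [ha] with q hq hqS
  by_cases hqp : q = p
  · rw [hqp]
  · rw [hpa]
    exact hq ⟨hqS, hqp⟩

end IsUmbilicCMC

/-! ### Limits of horizontal vectors and of linear maps. -/

theorem tendsto_horiz {ι : Type*} {l : Filter ι} {f : ι → H n} {g : ι → Cn n} {q : H n} {v : Cn n}
    (hf : Tendsto f l (𝓝 q)) (hg : Tendsto g l (𝓝 v)) :
    Tendsto (fun i => horiz (f i) (g i)) l (𝓝 (horiz q v)) := by
  have h1 := continuous_horiz.tendsto (q, v)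
  have h2 := h1.comp (hf.prodMk_nhds hg)
  exact h2

theorem tendsto_clm_apply {ι E F : Type*} [NormedAddCommGroup E] [NormedSpace ℝ E]
    [NormedAddCommGroup F] [NormedSpace ℝ F] {l : Filter ι} {f : ι → E →L[ℝ] F} {g : ι → E}
    {L : E →L[ℝ] F} {x : E} (hf : Tendsto f l (𝓝 L)) (hg : Tendsto g l (𝓝 x)) :
    Tendsto (fun i => f i (g i)) l (𝓝 (L x)) :=
  ((isBoundedBilinearMap_apply (𝕜 := ℝ)).continuous.tendsto (L, x)).comp (hf.prodMk_nhds hg)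

/-! ### Singular points -/

/-- A real endomorphism `M` of `ℂⁿ` such that `M + κ J` is symmetric is injective if it satisfies
the umbilicity relation with respect to all directions in its range. -/
theorem injective_of_umbilic_range (hn : 2 ≤ n) {M : Cn n →ₗ[ℝ] Cn n} {κ : ℝ} (hκ : κ ≠ 0)
    (hsymm : ∀ x y, ⟪M y, x⟫ + κ * ⟪J y, x⟫ = ⟪M x, y⟫ + κ * ⟪J x, y⟫)
    (humb : ∀ w v, M w ≠ 0 → ⟪M w, v⟫ = 0 → ⟪J (M w), v⟫ = 0 → ⟪M (J v), v⟫ = κ * ‖v‖ ^ 2) :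
    Function.Injective M := by
  rw [LinearMap.injective_iff_surjective, ← LinearMap.range_eq_top,
    ← Submodule.orthogonal_eq_bot_iff, Submodule.eq_bot_iff]
  intro w hw
  rw [Submodule.mem_orthogonal] at hw
  replace hw : ∀ v, ⟪M v, w⟫ = 0 := fun v => hw _ (LinearMap.mem_range_self M v)
  -- Let w be orthogonal to the range of M. If such an x exists, w is orthogonal to the complex line
  -- of Mx, and the umbilicity relation gives κ|w|² = ⟨M(Jw), w⟩ = 0.
  by_cases hex : ∃ x, M x ≠ 0 ∧ ⟪M x, J w⟫ = 0
  · obtain ⟨x, hx, hxw⟩ := hex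
    have h1 := humb x w hx (hw x) (by rw [inner_J_left, hxw, neg_zero])
    rw [hw, eq_comm, mul_eq_zero, or_iff_right hκ] at h1
    simpa using h1
  · push Not at hex
    exfalso
    -- Otherwise the functional ⟨Jw, M·⟩ detects every nonzero value of M. Two real conditions leave
    -- some v ≠ 0 with Mv = M(Jv) = 0, as 2 < 2n, and symmetry of M + κJ on the pair v, Jv is
    -- violated.
    have hker : LinearMap.ker ((innerₛₗ ℝ (J w) ∘ₗ M).prod (innerₛₗ ℝ (J w) ∘ₗ M ∘ₗ J)) ≠ ⊥ := by
      apply LinearMap.ker_ne_bot_of_finrank_lt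
      rw [Module.finrank_prod, finrank_Cn, Module.finrank_self]
      omega
    obtain ⟨v, hv, hv0⟩ := (Submodule.ne_bot_iff _).1 hker
    replace hv : (⟪J w, M v⟫, ⟪J w, M (J v)⟫) = ((0 : ℝ), (0 : ℝ)) := hv
    rw [Prod.mk.injEq] at hv
    have h1 : M v = 0 := by
      by_contra h0
      exact hex v h0 (by rw [real_inner_comm]; exact hv.1)
    have h2 : M (J v) = 0 := by
      by_contra h0
      exact hex (J v) h0 (by rw [real_inner_comm]; exact hv.2)
    have h3 := hsymm v (J v)
    rw [h1, h2, J_J, inner_zero_left, inner_zero_left, inner_neg_left, inner_J_J,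
      real_inner_self_eq_norm_sq] at h3
    have h4 : κ * ‖v‖ ^ 2 = 0 := by linarith
    rw [mul_eq_zero, or_iff_right hκ] at h4
    exact hv0 (by simpa using h4)

namespace IsUmbilicCMC

variable {c : ℝ} {p : H n} {U : Set (H n)} {u : H n → ℝ}

/-- First order relations between a defining function and the geometry of `S`. -/
theorem hgrad_relations (h : IsUmbilicCMC S e α c) (hu : IsDefiningFunction 2 S U u)
    (hpU : p ∈ U) (hp : p ∈ regularSet S) :
    |⟪hgrad u p, normal e p⟫| = ‖hgrad u p‖ ∧
    fderiv ℝ u p T = -(α p * ⟪hgrad u p, normal e p⟫) ∧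
    ∀ v w, ⟪hgrad u p, v⟫ = 0 → ⟪J (hgrad u p), v⟫ = 0 → ⟪hgrad u p, w⟫ = 0 →
      ⟪J (hgrad u p), w⟫ = 0 → ⟪fderiv ℝ (hgrad u) p (horiz p v), w⟫ =
        ⟪hgrad u p, normal e p⟫ * ⟪-(mu c S e α p • v), w⟫ := by
  have hUp : U ∈ 𝓝 p := hu.isOpen.mem_nhds hpU
  have key : ∀ q ∈ U, q ∈ regularSet S → hgrad u q = ⟪hgrad u q, normal e q⟫ • normal e q ∧
      |⟪hgrad u q, normal e q⟫| = ‖hgrad u q‖ := by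
    intro q hq hqr
    obtain ⟨h1, h2, -⟩ := h.frame.J_eq hu (by norm_num) hq hqr
    have hN := norm_smul_unitNormal u q
    have hN0 : hgrad u q ≠ 0 := (hu.mem_regularSet_iff (by norm_num) hq hqr.1).1 hqr
    have hν1 := norm_unitNormal hN0
    set s := ⟪J (e q), unitNormal u q⟫ with hs
    have hs2 : s * s = 1 := by
      rw [← pow_two, ← sq_abs, h2, one_pow]
    have hin : ⟪hgrad u q, normal e q⟫ = ‖hgrad u q‖ * s := by
      rw [normal, h1]
      nth_rw 1 [← hN]
      rw [real_inner_smul_left, real_inner_smul_right, real_inner_self_eq_norm_sq, hν1]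
      ring
    rw [hin]
    refine ⟨?_, ?_⟩
    · rw [normal, h1, smul_smul, mul_assoc, hs2, mul_one, hN]
    · rw [abs_mul, h2, mul_one, abs_of_nonneg (norm_nonneg _)]
  obtain ⟨hN, habs⟩ := key p hpU hp
  have hN0 : hgrad u p ≠ 0 := (hu.mem_regularSet_iff (by norm_num) hpU hp.1).1 hp
  have hν1 := h.frame.norm_normal hp
  refine ⟨habs, ?_, ?_⟩
  · have h1 := (hu.mem_tangent_iff (by norm_num) hpU hp.1 _).1 (h.frame.alpha_mem p hp)
    simp only [Prod.fst_add, horiz_fst, T_fst, add_zero, map_add, contactForm_horiz,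
      contactForm_T, zero_add, one_mul, real_inner_smul_right] at h1
    rw [normal]
    linarith
  · intro v w hv hv' hw hw'
    have hσ0 : ⟪hgrad u p, normal e p⟫ ≠ 0 := by
      rw [← abs_ne_zero, habs]
      exact norm_ne_zero_iff.2 hN0
    have hperp : ∀ v, ⟪hgrad u p, v⟫ = 0 → ⟪normal e p, v⟫ = 0 := fun v hv => by
      rw [hN, real_inner_smul_left] at hv
      exact (mul_eq_zero.1 hv).resolve_left hσ0
    have hperp' : ∀ v, ⟪J (hgrad u p), v⟫ = 0 → ⟪e p, v⟫ = 0 := fun v hv => by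
      rw [hN, map_smul, real_inner_smul_left] at hv
      have h2 := (mul_eq_zero.1 hv).resolve_left hσ0
      rw [normal, J_J, inner_neg_left] at h2
      linarith
    have hd : HasFDerivWithinAt (hgrad u) (fderiv ℝ (hgrad u) p) S p :=
      (((hu.contDiffOn_hgrad (m := 1) (by norm_num)).contDiffAt hUp).differentiableAt
        (by simp)).hasFDerivAt.hasFDerivWithinAt
    have hν := (h.frame.differentiableWithinAt hp (h.levelSet p hp.1)).1.hasFDerivWithinAt
    -- Differentiate N = ⟨N, ν⟩ν along S, where N is the horizontal gradient. The derivative of the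
    -- coefficient contributes a multiple of ν, orthogonal to w.
    have h2 := (hd.inner ℝ hν).smul hν
    have hev : hgrad u =ᶠ[𝓝[S] p] fun q => ⟪hgrad u q, normal e q⟫ • normal e q := by
      filter_upwards [mem_nhdsWithin_of_mem_nhds hUp,
        h.frame.eventually_regularSet hp (h.levelSet p hp.1)] with q h3 h4 using (key q h3 h4).1
    rw [eq_on_tangent hd h2 hev hp.1 (h.horiz_mem_tangent hp (hperp v hv))]
    have h3 := (h.first_order hp).1 v (hperp v hv) (hperp' v hv')
    rw [_root_.add_apply, inner_add_left, ContinuousLinearMap.smulRight_apply,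
      real_inner_smul_left, hperp w hw, mul_zero, add_zero, _root_.smul_apply,
      real_inner_smul_left]
    congr 2

/-- The relation of umbilicity on the span of `v` and `J v`, orthogonal to a vector in the range of
the differential of the horizontal gradient, in the limit at a singular point. -/
theorem inner_fderiv_hgrad_of_singular (h : IsUmbilicCMC S e α c) (hp : p ∈ S)
    {U : Set (H n)} {u : H n → ℝ} (hpU : p ∈ U) (hu : IsDefiningFunction 2 S U u)
    (hN0 : hgrad u p = 0) {w x m : Cn n} (hm : fderiv ℝ (hgrad u) p (horiz p w) = m) (hw : m ≠ 0)
    (hx : ⟪m, x⟫ = 0) (hx' : ⟪J m, x⟫ = 0) :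
    ⟪fderiv ℝ (hgrad u) p (horiz p (J x)), x⟫ = fderiv ℝ u p T * ‖x‖ ^ 2 := by
  have hUp : U ∈ 𝓝 p := hu.isOpen.mem_nhds hpU
  have cN : ContDiffOn ℝ 1 (hgrad u) U := hu.contDiffOn_hgrad (by norm_num)
  have cT : ContDiffOn ℝ 1 (fun q => fderiv ℝ u q T) U := hu.contDiffOn_fderiv_T (by norm_num)
  have dN : HasFDerivAt (hgrad u) (fderiv ℝ (hgrad u) p) p :=
    ((cN.contDiffAt hUp).differentiableAt (by simp)).hasFDerivAt
  obtain ⟨γ, hγ0, hγS, hγ⟩ := hu.exists_curve (by norm_num) hpU hp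
    (v := horiz p w) (by rw [← inner_hgrad, hN0, inner_zero_left])
  have hNγ : HasDerivAt (hgrad u ∘ γ) m 0 := by
    rw [← hm]
    refine HasFDerivAt.comp_hasDerivAt 0 ?_ hγ
    rwa [hγ0]
  have hslope : Tendsto (fun s : ℝ => s⁻¹ • hgrad u (γ s)) (𝓝[≠] 0) (𝓝 m) := by
    have := hNγ.tendsto_slope_zero
    simpa [hγ0, hN0] using this
  have hγt : Tendsto γ (𝓝[≠] 0) (𝓝 p) := by
    have := hγ.continuousAt.tendsto
    rw [hγ0] at this
    exact this.mono_left nhdsWithin_le_nhds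
  -- V a is |a|² times the projection of x to the complement of the complex line of a; the factor
  -- makes it continuous in a. The gradient along γ, divided by s, tends to m, so V tends to |m|² x.
  obtain ⟨V, hV⟩ : ∃ V : Cn n → Cn n, ∀ a, V a = ‖a‖ ^ 2 • x - ⟪a, x⟫ • a - ⟪J a, x⟫ • J a :=
    ⟨_, fun a => rfl⟩
  have hVcont : Continuous V := by
    rw [funext hV]
    have hJc : Continuous fun a : Cn n => J a := (JL (n := n)).continuous
    have h1 : Continuous fun a : Cn n => ‖a‖ ^ 2 • x := by fun_prop
    have h2 : Continuous fun a : Cn n => ⟪a, x⟫ • a :=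
      (Continuous.inner (𝕜 := ℝ) continuous_id' continuous_const).smul continuous_id'
    have h3 : Continuous fun a : Cn n => ⟪J a, x⟫ • J a :=
      (Continuous.inner (𝕜 := ℝ) hJc continuous_const).smul hJc
    exact (h1.sub h2).sub h3
  have hVt : Tendsto (fun s : ℝ => V (s⁻¹ • hgrad u (γ s))) (𝓝[≠] 0) (𝓝 (V m)) :=
    (hVcont.tendsto _).comp hslope
  have hVw : V m = ‖m‖ ^ 2 • x := by simp [hV, hx, hx']
  -- Pairing the derivative in the direction JV with V eliminates k, and α enters only through Tu,
  -- which is continuous at p. So this relation passes to the limit.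
  have hrel : ∀ᶠ s : ℝ in 𝓝[≠] 0,
      ⟪fderiv ℝ (hgrad u) (γ s) (horiz (γ s) (J (V (s⁻¹ • hgrad u (γ s))))),
        V (s⁻¹ • hgrad u (γ s))⟫ =
      fderiv ℝ u (γ s) T * ‖V (s⁻¹ • hgrad u (γ s))‖ ^ 2 := by
    have hne : ∀ᶠ s : ℝ in 𝓝[≠] 0, s⁻¹ • hgrad u (γ s) ≠ 0 := hslope.eventually_ne hw
    filter_upwards [hne, hγt.eventually_mem hUp, hγS.filter_mono nhdsWithin_le_nhds]
      with s h1 h2 h3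
    have hs0 : hgrad u (γ s) ≠ 0 := fun h0 => h1 (by rw [h0, smul_zero])
    have hs1 : s⁻¹ ≠ 0 := fun h0 => h1 (by rw [h0, zero_smul])
    have hr : γ s ∈ regularSet S := (hu.mem_regularSet_iff (by norm_num) h2 h3).2 hs0
    set a := s⁻¹ • hgrad u (γ s) with ha
    have o1 : ⟪a, V a⟫ = 0 := by
      simp only [hV, inner_sub_right, real_inner_smul_right, inner_self_J,
        real_inner_self_eq_norm_sq]
      ring
    have o2 : ⟪J a, V a⟫ = 0 := by
      simp only [hV, inner_sub_right, real_inner_smul_right, inner_J_self,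
        real_inner_self_eq_norm_sq, norm_J]
      ring
    have o1' : ⟪hgrad u (γ s), V a⟫ = 0 := by
      rw [ha, real_inner_smul_left] at o1
      exact (mul_eq_zero.1 o1).resolve_left hs1
    have o2' : ⟪J (hgrad u (γ s)), V a⟫ = 0 := by
      rw [ha, map_smul, real_inner_smul_left] at o2
      exact (mul_eq_zero.1 o2).resolve_left hs1
    obtain ⟨-, r2, r3⟩ := h.hgrad_relations hu h2 hr
    rw [r3 (J (V a)) (V a) (by rw [← neg_eq_zero, ← inner_J_left, o2'])
      (by rw [inner_J_J, o1']) o1' o2', r2, mu_smul, J_J, smul_neg, inner_neg_left,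
      inner_sub_left, inner_neg_left, real_inner_smul_left, real_inner_smul_left, inner_J_self,
      real_inner_self_eq_norm_sq]
    ring
  have hfc : ContinuousAt (fderiv ℝ (hgrad u)) p :=
    ((cN.contDiffAt hUp).fderiv_right (m := 0) (by norm_num)).continuousAt
  have hTc : ContinuousAt (fun q => fderiv ℝ u q T) p := (cT.contDiffAt hUp).continuousAt
  have hJc : Continuous fun a : Cn n => J a := (JL (n := n)).continuous
  have hlim1 : Tendsto (fun s : ℝ =>
      ⟪fderiv ℝ (hgrad u) (γ s) (horiz (γ s) (J (V (s⁻¹ • hgrad u (γ s))))),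
        V (s⁻¹ • hgrad u (γ s))⟫) (𝓝[≠] 0)
      (𝓝 ⟪fderiv ℝ (hgrad u) p (horiz p (J (V m))), V m⟫) := by
    have h1 : Tendsto (fun s : ℝ => horiz (γ s) (J (V (s⁻¹ • hgrad u (γ s))))) (𝓝[≠] 0)
        (𝓝 (horiz p (J (V m)))) :=
      tendsto_horiz hγt ((hJc.tendsto _).comp hVt)
    exact Tendsto.inner (𝕜 := ℝ) (tendsto_clm_apply (hfc.tendsto.comp hγt) h1) hVt
  have hlim2 : Tendsto (fun s : ℝ => fderiv ℝ u (γ s) T * ‖V (s⁻¹ • hgrad u (γ s))‖ ^ 2)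
      (𝓝[≠] 0) (𝓝 (fderiv ℝ u p T * ‖V m‖ ^ 2)) :=
    (hTc.tendsto.comp hγt).mul (hVt.norm.pow 2)
  have hfin := tendsto_nhds_unique (hlim1.congr' hrel) hlim2
  have hr0 : ‖m‖ ^ 2 ≠ 0 := pow_ne_zero _ (norm_ne_zero_iff.2 hw)
  rw [hVw, map_smul, map_smul, map_smul, real_inner_smul_left, real_inner_smul_right, norm_smul,
    Real.norm_of_nonneg (by positivity)] at hfin
  have : (‖m‖ ^ 2) ^ 2 * ⟪fderiv ℝ (hgrad u) p (horiz p (J x)), x⟫ =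
      (‖m‖ ^ 2) ^ 2 * (fderiv ℝ u p T * ‖x‖ ^ 2) := by
    linear_combination hfin
  exact mul_left_cancel₀ (pow_ne_zero 2 hr0) this

/-- Singular points are isolated. -/
theorem eventually_regular_of_singular (h : IsUmbilicCMC S e α c) (hp : p ∈ singularSet S) :
    ∀ᶠ q in 𝓝[S \ {p}] p, q ∈ regularSet S := by
  obtain ⟨U, u, hpU, hu⟩ := (h.levelSet p hp.1).exists_isDefiningFunction
  have hUp : U ∈ 𝓝 p := hu.isOpen.mem_nhds hpU
  have hN0 : hgrad u p = 0 := (hu.mem_singularSet_iff (by norm_num) hpU hp.1).1 hp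
  have cN : ContDiffOn ℝ 1 (hgrad u) U := hu.contDiffOn_hgrad (by norm_num)
  have cT : ContDiffOn ℝ 1 (fun q => fderiv ℝ u q T) U := hu.contDiffOn_fderiv_T (by norm_num)
  have dN : HasFDerivAt (hgrad u) (fderiv ℝ (hgrad u) p) p :=
    ((cN.contDiffAt hUp).differentiableAt (by simp)).hasFDerivAt
  have dT : HasFDerivAt (fun q => fderiv ℝ u q T) (fderiv ℝ (fun q => fderiv ℝ u q T) p) p :=
    ((cT.contDiffAt hUp).differentiableAt (by simp)).hasFDerivAt
  set κ := fderiv ℝ u p T with hκdef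
  have hκ : κ ≠ 0 := by
    intro hκ0
    refine hu.fderiv_ne p hpU (ContinuousLinearMap.ext fun X => ?_)
    rw [fderiv_apply_eq, hN0, ← hκdef, hκ0]
    simp
  have htan : ∀ w, horiz p w ∈ tangent S p := fun w => by
    rw [hu.mem_tangent_iff (by norm_num) hpU hp.1, hN0]
    simp
  set M : Cn n →ₗ[ℝ] Cn n := (fderiv ℝ (hgrad u) p : H n →ₗ[ℝ] Cn n) ∘ₗ horiz p with hM
  have hMap : ∀ w, M w = fderiv ℝ (hgrad u) p (horiz p w) := fun w => rfl
  have hsymm : ∀ x y, ⟪M y, x⟫ + κ * ⟪J y, x⟫ = ⟪M x, y⟫ + κ * ⟪J x, y⟫ := by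
    intro x y
    have key := hu.symmetric_of_vanishing le_rfl hpU hp.1
      (θ := fun q => innerₛₗ ℝ (hgrad u q) ∘ₗ LinearMap.fst ℝ (Cn n) ℝ +
        fderiv ℝ u q T • contactForm q)
      (θ' := fun X => (innerSL ℝ X.1).comp (fderiv ℝ (hgrad u) p) +
        (κ • (((innerSL ℝ X.1).comp JL).comp (ContinuousLinearMap.fst ℝ (Cn n) ℝ)) +
          contactForm p X • fderiv ℝ (fun q => fderiv ℝ u q T) p)) (fun X => by
        refine HasFDerivWithinAt.add ?_ ?_
        · have := (innerSL ℝ X.1).hasFDerivAt.comp_hasFDerivWithinAt p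
            (dN.hasFDerivWithinAt (s := S))
          refine this.congr_of_eventuallyEq (Eventually.of_forall fun q => ?_) ?_ <;>
          simp [real_inner_comm]
        · exact dT.hasFDerivWithinAt.mul
            (IsHorizontalFrame.hasFDerivWithinAt_contactForm S p X)) (by
        filter_upwards [mem_nhdsWithin_of_mem_nhds hUp, self_mem_nhdsWithin] with q hq hqS X hX
        rw [hu.mem_tangent_iff (by norm_num) hq hqS] at hX
        rw [← hX]
        simp [mul_comm]) (htan x) (htan y)
    simp only [_root_.add_apply, ContinuousLinearMap.comp_apply, innerSL_apply_apply,
      _root_.smul_apply, JL_apply, ContinuousLinearMap.coe_fst', horiz_fst, contactForm_horiz,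
      zero_smul, add_zero, smul_eq_mul] at key
    rw [hMap, hMap, real_inner_comm x, real_inner_comm x (J y), real_inner_comm y,
      real_inner_comm y (J x)]
    exact key
  have humb : ∀ w v, M w ≠ 0 → ⟪M w, v⟫ = 0 → ⟪J (M w), v⟫ = 0 →
      ⟪M (J v), v⟫ = κ * ‖v‖ ^ 2 := fun w v hw hv hv' =>
    h.inner_fderiv_hgrad_of_singular hp.1 hpU hu hN0 (hMap w).symm hw hv hv'
  have hinj := injective_of_umbilic_range h.two_le hκ hsymm humb
  obtain ⟨Ψ, π, h0, hπ0, hπ, hΨ, hS, hinv⟩ := hu.exists_chart (by norm_num) hpU hp.1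
  have hcomp : HasFDerivAt (hgrad u ∘ Ψ)
      ((fderiv ℝ (hgrad u) p).comp (fderiv ℝ u p).ker.subtypeL) 0 := by
    refine HasFDerivAt.comp 0 ?_ hΨ
    rwa [h0]
  have hker : LinearMap.ker (((fderiv ℝ (hgrad u) p).comp (fderiv ℝ u p).ker.subtypeL :
      (fderiv ℝ u p).ker →L[ℝ] Cn n) : (fderiv ℝ u p).ker →ₗ[ℝ] Cn n) = ⊥ := by
    rw [LinearMap.ker_eq_bot']
    rintro ⟨X, hX⟩ hX0
    have hXk : fderiv ℝ u p X = 0 := hX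
    rw [fderiv_apply_eq, hN0, inner_zero_left, zero_add, mul_eq_zero, or_iff_left hκ] at hXk
    have hXh : X = horiz p X.1 := by
      conv_lhs => rw [eq_horiz_add p X, hXk, zero_smul, add_zero]
    have hM0 : M X.1 = M 0 := by
      rw [map_zero, hMap, ← hXh]
      exact hX0
    have hX1 := hinj hM0
    rw [hX1, map_zero] at hXh
    exact Subtype.ext hXh
  -- An injective derivative in finite dimension is bounded below, so in the chart the horizontal
  -- gradient has an isolated zero.
  obtain ⟨K, -, hK⟩ := LinearMap.exists_antilipschitzWith _ hker
  have hne := hcomp.eventually_ne (c := 0) ⟨K, hK⟩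
  rw [eventually_nhdsWithin_iff] at hne
  have hπt : Tendsto π (𝓝 p) (𝓝 0) := by
    have := hπ.tendsto p
    rwa [hπ0] at this
  rw [eventually_nhdsWithin_iff]
  filter_upwards [hinv, hπt.eventually hne, hUp] with q h1 h2 h3 h4
  rw [hu.mem_regularSet_iff (by norm_num) h3 h4.1]
  have h5 := h2 (fun h6 => h4.2 (by
    rw [mem_singleton_iff] at h6 ⊢
    rw [← h1 h4.1, h6, h0]))
  rwa [Function.comp_apply, h1 h4.1] at h5

/-- The function `α` blows up at singular points, and dominates `k` there. -/
theorem alpha_of_singular (h : IsUmbilicCMC S e α c) (hp : p ∈ singularSet S) :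
    (∀ᶠ q in 𝓝[S \ {p}] p, α q ≠ 0) ∧ Tendsto (fun q => (α q)⁻¹) (𝓝[S \ {p}] p) (𝓝 0) ∧
      ∃ C, ∀ᶠ q in 𝓝[S \ {p}] p, |kap c S e q| ≤ C * |α q| := by
  have hreg := h.eventually_regular_of_singular hp
  obtain ⟨U, u, hpU, hu⟩ := (h.levelSet p hp.1).exists_isDefiningFunction
  have hUp : U ∈ 𝓝 p := hu.isOpen.mem_nhds hpU
  have hN0 : hgrad u p = 0 := (hu.mem_singularSet_iff (by norm_num) hpU hp.1).1 hp
  have cN : ContDiffOn ℝ 1 (hgrad u) U := hu.contDiffOn_hgrad (by norm_num)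
  have cT : ContDiffOn ℝ 1 (fun q => fderiv ℝ u q T) U := hu.contDiffOn_fderiv_T (by norm_num)
  have hTc : ContinuousAt (fun q => fderiv ℝ u q T) p := (cT.contDiffAt hUp).continuousAt
  have hNc : ContinuousAt (hgrad u) p := (cN.contDiffAt hUp).continuousAt
  have hfc : ContinuousAt (fderiv ℝ (hgrad u)) p :=
    ((cN.contDiffAt hUp).fderiv_right (m := 0) (by norm_num)).continuousAt
  have hκ : fderiv ℝ u p T ≠ 0 := by
    intro hκ0
    refine hu.fderiv_ne p hpU (ContinuousLinearMap.ext fun X => ?_)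
    rw [fderiv_apply_eq, hN0, hκ0]
    simp
  have hT0 : ∀ᶠ q in 𝓝 p, fderiv ℝ u q T ≠ 0 := hTc.eventually_ne hκ
  have hUev : ∀ᶠ q in 𝓝[S \ {p}] p, q ∈ U ∧ q ∈ regularSet S ∧ fderiv ℝ u q T ≠ 0 := by
    filter_upwards [mem_nhdsWithin_of_mem_nhds hUp, hreg, hT0.filter_mono nhdsWithin_le_nhds]
      with q h1 h2 h3 using ⟨h1, h2, h3⟩
  have habs : ∀ᶠ q in 𝓝[S \ {p}] p, α q ≠ 0 ∧
      |(α q)⁻¹| = ‖hgrad u q‖ / |fderiv ℝ u q T| := by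
    filter_upwards [hUev] with q hq
    obtain ⟨r1, r2, -⟩ := h.hgrad_relations hu hq.1 hq.2.1
    have hne := hq.2.2
    rw [r2] at hne ⊢
    have hα0 : α q ≠ 0 := fun h0 => hne (by rw [h0]; simp)
    have hσ : ⟪hgrad u q, normal e q⟫ ≠ 0 := fun h0 => hne (by rw [h0]; simp)
    refine ⟨hα0, ?_⟩
    rw [abs_neg, abs_mul, r1, abs_inv]
    rw [← r1]
    have := abs_ne_zero.2 hσ
    have := abs_ne_zero.2 hα0
    field_simp
  refine ⟨habs.mono fun q hq => hq.1, ?_, ?_⟩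
  · rw [tendsto_zero_iff_abs_tendsto_zero]
    have h1 : Tendsto (fun q => ‖hgrad u q‖ / |fderiv ℝ u q T|) (𝓝[S \ {p}] p)
        (𝓝 (‖hgrad u p‖ / |fderiv ℝ u p T|)) :=
      ((hNc.norm.div hTc.abs (abs_ne_zero.2 hκ)).tendsto).mono_left nhdsWithin_le_nhds
    rw [hN0, norm_zero, zero_div] at h1
    exact h1.congr' (habs.mono fun q hq => hq.2.symm)
  · set B := ‖fderiv ℝ (hgrad u) p‖ + 1 with hB
    set D := 1 + ‖p.1‖ + 1 with hD
    have hB' : ∀ᶠ q in 𝓝 p, ‖fderiv ℝ (hgrad u) q‖ < B :=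
      hfc.norm.eventually_lt_const (by rw [hB]; linarith)
    have hD' : ∀ᶠ q in 𝓝 p, ‖q.1‖ < ‖p.1‖ + 1 :=
      (continuous_fst.norm.continuousAt).eventually_lt_const (by linarith)
    have hT' : ∀ᶠ q in 𝓝 p, |fderiv ℝ u p T| / 2 < |fderiv ℝ u q T| :=
      hTc.abs.eventually_const_lt (by have := abs_pos.2 hκ; linarith)
    refine ⟨B * D / (|fderiv ℝ u p T| / 2), ?_⟩
    filter_upwards [hUev, hB'.filter_mono nhdsWithin_le_nhds, hD'.filter_mono nhdsWithin_le_nhds,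
      hT'.filter_mono nhdsWithin_le_nhds] with q hq h1 h2 h3
    obtain ⟨r1, r2, r3⟩ := h.hgrad_relations hu hq.1 hq.2.1
    obtain ⟨v, hv1, hv, hv'⟩ := exists_norm_eq_one_orthogonal h.two_le (hgrad u q) (J (hgrad u q))
    -- Taking w = v eliminates α because ⟨Jv, v⟩ = 0. So |k| times |⟨N, ν⟩| is bounded near p, while
    -- |α| times |⟨N, ν⟩| is |Tu|, bounded below.
    have h4 := r3 v v hv hv' hv hv'
    rw [mu_smul, inner_neg_left, inner_sub_left, real_inner_smul_left, real_inner_smul_left,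
      inner_J_self, real_inner_self_eq_norm_sq, hv1] at h4
    have hhor : ‖horiz q v‖ ≤ D := by
      rw [horiz_apply, Prod.norm_def]
      refine max_le ?_ ?_
      · change ‖v‖ ≤ D
        rw [hv1, hD]
        have := norm_nonneg p.1
        linarith
      · change ‖-⟪J q.1, v⟫‖ ≤ D
        rw [norm_neg]
        refine (norm_inner_le_norm _ _).trans ?_
        rw [norm_J, hv1, mul_one, hD]
        linarith
    have h5 : |⟪fderiv ℝ (hgrad u) q (horiz q v), v⟫| ≤ B * D := by
      have h6 := norm_inner_le_norm (𝕜 := ℝ) (fderiv ℝ (hgrad u) q (horiz q v)) v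
      rw [hv1, mul_one, Real.norm_eq_abs] at h6
      refine h6.trans (((fderiv ℝ (hgrad u) q).le_opNorm _).trans ?_)
      exact mul_le_mul h1.le hhor (norm_nonneg _) ((norm_nonneg _).trans h1.le)
    have h7 : |⟪hgrad u q, normal e q⟫| * |kap c S e q| ≤ B * D := by
      rw [h4] at h5
      rw [← abs_mul]
      refine le_trans (le_of_eq ?_) h5
      rw [← abs_neg]
      congr 1
      ring
    have hσ : 0 < |⟪hgrad u q, normal e q⟫| := by
      rw [abs_pos]
      intro h0
      exact hq.2.2 (by rw [r2, h0]; simp)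
    have h8 : |fderiv ℝ u q T| = |α q| * |⟪hgrad u q, normal e q⟫| := by
      rw [r2, abs_neg, abs_mul]
    have hpos := abs_pos.2 hκ
    rw [h8] at h3
    have hBD : 0 ≤ B * D := (abs_nonneg _).trans h5
    rw [div_mul_eq_mul_div, le_div_iff₀ (by positivity)]
    calc |kap c S e q| * (|fderiv ℝ u p T| / 2)
        ≤ |kap c S e q| * (|α q| * |⟪hgrad u q, normal e q⟫|) := by gcongr
      _ = (|⟪hgrad u q, normal e q⟫| * |kap c S e q|) * |α q| := by ring
      _ ≤ B * D * |α q| := by gcongr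

end IsUmbilicCMC

/-! ### From local to global constancy -/

namespace IsUmbilicCMC

variable {c : ℝ} {p : H n}

theorem eventually_regular (h : IsUmbilicCMC S e α c) (hp : p ∈ S) :
    ∀ᶠ q in 𝓝[S \ {p}] p, q ∈ regularSet S := by
  by_cases hs : contactPlane p = tangent S p
  · exact h.eventually_regular_of_singular ⟨hp, hs⟩
  · exact (h.frame.eventually_regularSet ⟨hp, hs⟩ (h.levelSet p hp)).filter_mono
      (nhdsWithin_mono p sdiff_subset)

theorem neBot_punctured (h : IsUmbilicCMC S e α c) (hp : p ∈ S) : (𝓝[S \ {p}] p).NeBot :=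
  Heisenberg.neBot_punctured (by have := h.two_le; omega) (h.levelSet p hp) (by norm_num) hp

theorem exists_eq_of_tangentiallyConst (h : IsUmbilicCMC S e α c) (hS : IsConnected S)
    {F : Type*} [NormedAddCommGroup F] [NormedSpace ℝ F] {f : H n → F}
    (hf : ∀ q ∈ regularSet S, TangentiallyConst S f q) : ∃ a, ∀ q ∈ regularSet S, f q = a := by
  have hn : 1 ≤ n := by have := h.two_le; omega
  -- The value of f on punctured neighbourhoods makes sense at singular points too, and is locally
  -- constant on all of S.
  let E : H n → F → Prop := fun x a => ∀ᶠ q in 𝓝[S \ {x}] x, f q = a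
  have hE : ∀ x ∈ S, ∃ a, E x a := fun x hx =>
    eventually_const_of_tangential hn (h.levelSet x hx) (by norm_num) hx
      ((h.eventually_regular hx).mono fun q hq => hf q hq)
  have huniq : ∀ x ∈ S, ∀ a b, E x a → E x b → a = b := fun x hx a b ha hb => by
    have := h.neBot_punctured hx
    obtain ⟨q, h1, h2⟩ := (ha.and hb).exists
    rw [← h1, ← h2]
  have hreg : ∀ x ∈ regularSet S, E x (f x) := fun x hx =>
    (eventually_eq_of_tangentiallyConst hn (h.levelSet x hx.1) hx.1
      ((h.frame.eventually_regularSet hx (h.levelSet x hx.1)).mono fun q hq => hf q hq)).filter_mono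
      (nhdsWithin_mono x sdiff_subset)
  have hconn : ∀ x ∈ S, ∀ y ∈ S, ∃ a, E x a ∧ E y a := by
    intro x hx y hy
    refine hS.isPreconnected.induction₂ (fun x y => ∃ a, E x a ∧ E y a) ?_ ?_ ?_ hx hy
    · intro x hx
      obtain ⟨a, ha⟩ := hE x hx
      have h1 := eventually_eventually_nhdsWithin.2 ha
      rw [eventually_nhdsWithin_iff] at h1 ⊢
      filter_upwards [h1] with y h2 hy
      rcases eq_or_ne y x with rfl | hne
      · exact ⟨a, ha, ha⟩
      · refine ⟨a, ha, ?_⟩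
        have h3 := h2 ⟨hy, hne⟩
        have h4 : {x}ᶜ ∈ 𝓝 y := isOpen_compl_singleton.mem_nhds hne
        rw [eventually_nhdsWithin_iff] at h3
        change ∀ᶠ q in 𝓝[S \ {y}] y, f q = a
        rw [eventually_nhdsWithin_iff]
        filter_upwards [h3, h4] with q h5 h6 h7 using h5 ⟨h7.1, h6⟩
    · rintro x y z hx hy hz ⟨a, h1, h2⟩ ⟨b, h3, h4⟩
      rw [huniq y hy b a h3 h2] at h4
      exact ⟨a, h1, h4⟩
    · rintro x y hx hy ⟨a, h1, h2⟩
      exact ⟨a, h2, h1⟩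
  obtain ⟨x, hx⟩ := hS.nonempty
  obtain ⟨a, ha⟩ := hE x hx
  refine ⟨a, fun q hq => ?_⟩
  obtain ⟨b, hb, hb'⟩ := hconn x hx q hq.1
  rw [huniq q hq.1 _ _ (hreg q hq) hb', huniq x hx _ _ ha hb]

theorem modSq_pos_of_alpha {q : H n} (hα : α q ≠ 0) : 0 < modSq c S e α q := by
  have := sq_pos_of_ne_zero hα
  have := sq_nonneg (kap c S e q)
  unfold modSq
  linarith

/-- Near a singular point, the eigenvalue `k` is the one of the Pansu sphere. -/
theorem eventually_kap_eq_of_singular (h : IsUmbilicCMC S e α c) (hc : 0 < c)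
    (hp : p ∈ singularSet S) : ∀ᶠ q in 𝓝[S \ {p}] p, kap c S e q = c / (2 * n) := by
  have hn : 1 ≤ n := by have := h.two_le; omega
  have hn' : (0 : ℝ) < n := by exact_mod_cast hn
  have hl : 0 < c / (2 * n) := by positivity
  have := h.neBot_punctured hp.1
  obtain ⟨h1, h2, C, h3⟩ := h.alpha_of_singular hp
  obtain ⟨a, ha⟩ := eventually_const_of_tangential hn (h.levelSet p hp.1) (by norm_num) hp.1
    (f := deviation c S e α) (by
      filter_upwards [h1, h.eventually_regular hp.1] with q hq hq'
      exact h.tangentiallyConst_deviation hq' (modSq_pos_of_alpha hq).ne')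
  have hlim : Tendsto (deviation c S e α) (𝓝[S \ {p}] p) (𝓝 0) := by
    have hb : Tendsto (fun q => |(α q)⁻¹|) (𝓝[S \ {p}] p) (𝓝 0) := by
      simpa using h2.abs
    -- The majorant combines |k - c/2n| ≤ C|α| + c/2n with (k² + α²)^{-n} ≤ α^{-2}, valid once |α| >
    -- 1.
    have hmaj : Tendsto (fun q => C * |(α q)⁻¹| + c / (2 * n) * |(α q)⁻¹| ^ 2)
        (𝓝[S \ {p}] p) (𝓝 0) := by
      simpa using (hb.const_mul C).add ((hb.pow 2).const_mul (c / (2 * n)))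
    refine squeeze_zero_norm' ?_ hmaj
    filter_upwards [h1, h3, hb.eventually_lt_const (zero_lt_one)] with q q1 q2 q3
    have hm := modSq_pos_of_alpha (c := c) (S := S) (e := e) q1
    have hα := abs_pos.2 q1
    have hmb : (modSq c S e α q)⁻¹ ≤ |(α q)⁻¹| ^ 2 := by
      rw [abs_inv, inv_pow, sq_abs]
      exact inv_anti₀ (sq_pos_of_ne_zero q1) (by unfold modSq; linarith [sq_nonneg (kap c S e q)])
    have hpow : (modSq c S e α q)⁻¹ ^ n ≤ |(α q)⁻¹| ^ 2 := by
      refine (pow_le_of_le_one (by positivity) (hmb.trans ?_) (by omega)).trans hmb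
      exact pow_le_one₀ (abs_nonneg _) q3.le
    rw [deviation, Real.norm_eq_abs, abs_mul, abs_of_nonneg (pow_nonneg (inv_nonneg.2 hm.le) n)]
    have hk : |kap c S e q - c / (2 * n)| ≤ C * |α q| + c / (2 * n) := by
      refine (abs_sub _ _).trans ?_
      rw [abs_of_pos hl]
      linarith
    calc _ ≤ (C * |α q| + c / (2 * n)) * |(α q)⁻¹| ^ 2 :=
          mul_le_mul hk hpow (by positivity) ((abs_nonneg _).trans hk)
      _ = _ := by
        rw [abs_inv]
        field_simp
  have ha0 : a = 0 := tendsto_nhds_unique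
    (tendsto_const_nhds.congr' (ha.mono fun q hq => hq.symm)) hlim
  filter_upwards [ha, h1] with q q1 q2
  rw [ha0, deviation] at q1
  have := (mul_eq_zero.1 q1).resolve_right
    (pow_ne_zero _ (inv_ne_zero (modSq_pos_of_alpha q2).ne'))
  linarith

/-- The eigenvalue `k` is the one of the Pansu sphere. -/
theorem kap_eq (h : IsUmbilicCMC S e α c) (hc : 0 < c) (hS : IsConnected S)
    (hs : (singularSet S).Nonempty) {q : H n} (hq : q ∈ regularSet S) :
    kap c S e q = c / (2 * n) := by
  have hn : 1 ≤ n := by have := h.two_le; omega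
  have hn' : (0 : ℝ) < n := by exact_mod_cast hn
  have hl : 0 < c / (2 * n) := by positivity
  -- Y holds vacuously at singular points, which lets the connectedness argument start at one and
  -- pass through them.
  let Y : H n → Prop := fun q => q ∈ regularSet S → kap c S e q = c / (2 * n)
  obtain ⟨p, hp⟩ := hs
  have hYp : Y p := fun hr => absurd hp.2 hr.2
  suffices key : ∀ x ∈ S, ∀ᶠ y in 𝓝[S] x, (Y x ↔ Y y) from
    (hS.isPreconnected.induction₂ (fun x y => Y x ↔ Y y) key
      (fun x y z _ _ _ h1 h2 => h1.trans h2) (fun x y _ _ h1 => h1.symm) hp.1 hq.1).1 hYp hq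
  intro x hx
  by_cases hr : contactPlane x = tangent S x
  · have hYx : Y x := fun hr' => absurd hr hr'.2
    have h1 := h.eventually_kap_eq_of_singular hc ⟨hx, hr⟩
    rw [eventually_nhdsWithin_iff] at h1 ⊢
    filter_upwards [h1] with y h2 hy
    rcases eq_or_ne y x with rfl | hne
    · exact Iff.rfl
    · exact iff_of_true hYx fun _ => h2 ⟨hy, hne⟩
  · have hr' : x ∈ regularSet S := ⟨hx, hr⟩
    have hreg := h.frame.eventually_regularSet hr' (h.levelSet x hx)
    have hkc : ContinuousWithinAt (kap c S e) S x :=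
      (h.differentiableWithinAt hr').2.1.continuousWithinAt
    by_cases hk : kap c S e x = c / (2 * n)
    -- Positivity of c keeps k² + α² away from 0 near x, so the deviation is defined nearby and
    -- stays equal to its value 0 at x.
    · have hpos : ∀ᶠ y in 𝓝[S] x, 0 < kap c S e y :=
        hkc.eventually_const_lt (by rw [hk]; exact hl)
      have hm : ∀ y, 0 < kap c S e y → modSq c S e α y ≠ 0 := fun y hy => by
        unfold modSq
        positivity
      have hev := eventually_eq_of_tangentiallyConst hn (h.levelSet x hx) hx
        (f := deviation c S e α) (by
          filter_upwards [hreg, hpos] with y h1 h2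
          exact h.tangentiallyConst_deviation h1 (hm y h2))
      filter_upwards [hev, hpos] with y h1 h2
      refine iff_of_true (fun _ => hk) fun _ => ?_
      rw [deviation, deviation, hk, sub_self, zero_mul] at h1
      have := (mul_eq_zero.1 h1).resolve_right (pow_ne_zero _ (inv_ne_zero (hm y h2)))
      linarith
    · filter_upwards [hreg, hkc.eventually_ne hk] with y h1 h2
      exact iff_of_false (fun h3 => hk (h3 hr')) fun h3 => h2 (h3 h1)

end IsUmbilicCMC

/-! ### The Pansu sphere -/

section Pansu

variable {lam : ℝ}

theorem strictMono_heightFun (hl : 0 < lam) : StrictMono (heightFun lam) :=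
  strictMono_of_hasDerivAt_pos (fun a => hasDerivAt_heightFun hl a) fun a => by positivity

theorem heightFun_zero : heightFun lam 0 = 0 := by simp [heightFun]

theorem heightFun_neg (a : ℝ) : heightFun lam (-a) = -heightFun lam a := by
  simp only [heightFun, neg_div, Real.arctan_neg, neg_sq, mul_neg]
  ring

/-- Here λ|z| = cos(arctan(a/λ)). Nonnegative a parametrizes the upper half, a = 0 the equator, and
the poles correspond to a → ±∞. -/
theorem pansuHeight_eq_heightFun (hl : 0 < lam) {z : Cn n} {a : ℝ} (ha : 0 ≤ a)
    (hz : ‖z‖ ^ 2 = (lam ^ 2 + a ^ 2)⁻¹) : pansuHeight lam z = heightFun lam a := by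
  have hs : 0 < lam ^ 2 + a ^ 2 := by positivity
  have hcos : lam * ‖z‖ = Real.cos (Real.arctan (a / lam)) := by
    have hz' : ‖z‖ = (√(lam ^ 2 + a ^ 2))⁻¹ := by
      rw [← Real.sqrt_inv, ← hz, Real.sqrt_sq (norm_nonneg z)]
    have h1 : 1 + (a / lam) ^ 2 = (lam ^ 2 + a ^ 2) / lam ^ 2 := by field_simp
    rw [Real.cos_arctan, hz', h1, Real.sqrt_div hs.le, Real.sqrt_sq hl.le]
    field_simp
  have harc : Real.arccos (lam * ‖z‖) = Real.arctan (a / lam) := by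
    rw [hcos, Real.arccos_cos (Real.arctan_nonneg.2 (by positivity))
      ((Real.arctan_lt_pi_div_two _).le.trans (by linarith [Real.pi_pos]))]
  have hroot : lam * ‖z‖ * √(1 - lam ^ 2 * ‖z‖ ^ 2) = lam * a / (lam ^ 2 + a ^ 2) := by
    rw [← Real.sqrt_sq (by positivity : 0 ≤ lam * ‖z‖), ← Real.sqrt_mul (by positivity),
      ← Real.sqrt_sq (by positivity : 0 ≤ lam * a / (lam ^ 2 + a ^ 2)), mul_pow, hz]
    congr 1
    field_simp
    ring
  rw [pansuHeight, heightFun, harc, hroot, add_comm]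

theorem mem_pansuSphere_of_heightFun (hl : 0 < lam) {p : H n} {a : ℝ}
    (hz : ‖p.1‖ ^ 2 = (lam ^ 2 + a ^ 2)⁻¹) (ht : p.2 = heightFun lam a) :
    p ∈ pansuSphere n lam := by
  have hb : ‖p.1‖ ^ 2 ≤ (1 / lam) ^ 2 := by
    rw [hz, one_div, inv_pow]
    exact inv_anti₀ (by positivity) (by linarith [sq_nonneg a])
  refine ⟨le_of_sq_le_sq hb (by positivity), ?_⟩
  rcases le_total 0 a with ha | ha
  · exact Or.inl (by rw [ht, pansuHeight_eq_heightFun hl ha hz])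
  · refine Or.inr ?_
    rw [pansuHeight_eq_heightFun hl (neg_nonneg.2 ha) (by rw [neg_sq, hz]), heightFun_neg, ht,
      neg_neg]

theorem exists_heightFun_of_mem_pansuSphere (hl : 0 < lam) {p : H n} (hp : p ∈ pansuSphere n lam)
    (hz : p.1 ≠ 0) : ∃ a, ‖p.1‖ ^ 2 = (lam ^ 2 + a ^ 2)⁻¹ ∧ p.2 = heightFun lam a := by
  have hz' : 0 < ‖p.1‖ := norm_pos_iff.2 hz
  have hb : lam ^ 2 ≤ (‖p.1‖ ^ 2)⁻¹ := by
    rw [le_inv_comm₀ (by positivity) (by positivity), ← inv_pow, ← one_div]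
    exact pow_le_pow_left₀ hz'.le hp.1 2
  have ha : ‖p.1‖ ^ 2 = (lam ^ 2 + √((‖p.1‖ ^ 2)⁻¹ - lam ^ 2) ^ 2)⁻¹ := by
    rw [Real.sq_sqrt (sub_nonneg.2 hb), add_sub_cancel, inv_inv]
  have hh := pansuHeight_eq_heightFun hl (Real.sqrt_nonneg _) ha
  rcases hp.2 with h | h
  · exact ⟨_, ha, by rw [h, hh]⟩
  · refine ⟨-√((‖p.1‖ ^ 2)⁻¹ - lam ^ 2), by rw [neg_sq, ← ha], ?_⟩
    rw [h, hh, heightFun_neg]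

theorem continuous_pansuHeight : Continuous (pansuHeight (n := n) lam) := by
  unfold pansuHeight
  have := Real.continuous_arccos
  fun_prop

theorem isClosed_pansuSphere : IsClosed (pansuSphere n lam) := by
  have hc := (continuous_pansuHeight (n := n) (lam := lam)).comp (continuous_fst (Y := ℝ))
  have h1 : IsClosed {p : H n | ‖p.1‖ ≤ 1 / lam} :=
    isClosed_le continuous_fst.norm continuous_const
  exact h1.inter ((isClosed_eq continuous_snd hc).union (isClosed_eq continuous_snd hc.neg))

/-- The two halves are graphs over a closed ball and share the equator, which is nonempty for n ≥ 1.
-/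
theorem isPreconnected_pansuSphere (hn : 1 ≤ n) (hl : 0 < lam) :
    IsPreconnected (pansuSphere n lam) := by
  have hball : IsPreconnected (Metric.closedBall (0 : Cn n) (1 / lam)) :=
    (convex_closedBall _ _).isPreconnected
  have hc := continuous_pansuHeight (n := n) (lam := lam)
  have h1 := hball.image _ ((continuous_id.prodMk hc).continuousOn)
  have h2 := hball.image _ ((continuous_id.prodMk hc.neg).continuousOn)
  have : Nonempty (Fin n) := ⟨⟨0, hn⟩⟩
  obtain ⟨z, hz⟩ := exists_norm_eq (Cn n) (by positivity : 0 ≤ 1 / lam)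
  have hz0 : pansuHeight lam z = 0 := by
    rw [pansuHeight, hz, mul_one_div_cancel hl.ne', Real.arccos_one]
    have : 1 - lam ^ 2 * (1 / lam) ^ 2 = 0 := by field_simp; ring
    rw [this, Real.sqrt_zero]
    simp
  have hzb : z ∈ Metric.closedBall (0 : Cn n) (1 / lam) := by simp [hz]
  have h3 := h1.union (z, (0 : ℝ)) (by exact ⟨z, hzb, by simp [hz0]⟩)
    (by exact ⟨z, hzb, by simp [hz0]⟩) h2
  convert h3 using 1
  ext ⟨w, t⟩
  simp only [pansuSphere, mem_ofPred_eq, mem_union, mem_image, mem_closedBall_zero_iff, id,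
    Prod.mk.injEq]
  constructor
  · rintro ⟨hw, rfl | rfl⟩
    · exact Or.inl ⟨w, hw, rfl, rfl⟩
    · exact Or.inr ⟨w, hw, rfl, rfl⟩
  · rintro (⟨_, hw, rfl, rfl⟩ | ⟨_, hw, rfl, rfl⟩)
    · exact ⟨hw, Or.inl rfl⟩
    · exact ⟨hw, Or.inr rfl⟩

end Pansu

/-! ### The hypersurface is a Pansu sphere -/

/-- Lines in a direction transversal to a hypersurface meet it. -/
theorem IsDefiningFunction.eventually_exists_add_smul_mem {k : WithTop ℕ∞} {U : Set (H n)}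
    {u : H n → ℝ} (hu : IsDefiningFunction k S U u) (hk : 1 ≤ k) {q X : H n} (hqU : q ∈ U)
    (hq : q ∈ S) (hX : X ∉ tangent S q) {ε : ℝ} (hε : 0 < ε) :
    ∀ᶠ q' in 𝓝 q, ∃ s : ℝ, |s| < ε ∧ q' + s • X ∈ S := by
  have hUq : U ∈ 𝓝 q := hu.isOpen.mem_nhds hqU
  have hX' : fderiv ℝ u q X ≠ 0 := fun h0 => hX (by
    rw [hu.tangent_eq_ker hk hqU hq]
    exact h0)
  have hcont : Continuous fun x : H n × ℝ => x.1 + x.2 • X := by fun_prop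
  have hline : HasDerivAt (fun s : ℝ => u (q + s • X)) (fderiv ℝ u q X) 0 := by
    have h1 : HasDerivAt (fun s : ℝ => q + s • X) X 0 := by
      simpa using ((hasDerivAt_id (0 : ℝ)).smul_const X).const_add q
    refine HasFDerivAt.comp_hasDerivAt 0 ?_ h1
    rw [zero_smul, add_zero]
    exact (hu.differentiableAt hk hqU).hasFDerivAt
  have huq : u q = 0 := (hu.mem_iff q hqU).1 hq
  have hslope : Tendsto (fun s : ℝ => s⁻¹ * u (q + s • X)) (𝓝[≠] 0) (𝓝 (fderiv ℝ u q X)) := by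
    simpa [huq] using hline.tendsto_slope_zero
  have hprod : ∀ᶠ x : H n × ℝ in 𝓝 (q, 0), x.1 + x.2 • X ∈ U := by
    refine hcont.continuousAt.eventually_mem ?_
    simpa using hUq
  obtain ⟨δ₀, hδ₀, hball⟩ := Metric.eventually_nhds_iff_ball.1 hprod
  have hU' : ∀ q' ∈ Metric.ball q δ₀, ∀ s : ℝ, |s| < δ₀ → q' + s • X ∈ U := fun q' hq' s hs =>
    hball (q', s) (by
      rw [← ball_prod_same]
      exact ⟨hq', by simpa using hs⟩)
  have hsign : ∀ᶠ s : ℝ in 𝓝[≠] 0, 0 < fderiv ℝ u q X * (s⁻¹ * u (q + s • X)) :=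
    (hslope.const_mul _).eventually_const_lt (mul_self_pos.2 hX')
  rw [eventually_nhdsWithin_iff] at hsign
  obtain ⟨δ₁, hδ₁, hsign⟩ := Metric.eventually_nhds_iff_ball.1 hsign
  obtain ⟨δ, hδ, hδm⟩ := exists_between (lt_min hε (lt_min hδ₀ hδ₁))
  rw [lt_min_iff, lt_min_iff] at hδm
  obtain ⟨hδε, hδδ₀, hδδ₁⟩ := hδm
  -- Multiplied by du(X), the function u is positive at one end of the segment through q and
  -- negative at the other. These strict signs persist on the parallel segments through nearby
  -- points, and the intermediate value theorem yields a zero.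
  have hpos : 0 < fderiv ℝ u q X * u (q + δ • X) := by
    have h1 := hsign δ (by simpa [abs_of_pos hδ] using hδδ₁) hδ.ne'
    have h2 := mul_pos hδ h1
    have h3 : δ * (fderiv ℝ u q X * (δ⁻¹ * u (q + δ • X))) =
        fderiv ℝ u q X * u (q + δ • X) := by field_simp
    rwa [h3] at h2
  have hneg : fderiv ℝ u q X * u (q + (-δ) • X) < 0 := by
    have h1 := hsign (-δ) (by simpa [abs_of_pos hδ] using hδδ₁) (neg_ne_zero.2 hδ.ne')
    have h2 := mul_pos hδ h1
    have h3 : δ * (fderiv ℝ u q X * ((-δ)⁻¹ * u (q + (-δ) • X))) =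
        -(fderiv ℝ u q X * u (q + (-δ) • X)) := by
      rw [inv_neg]
      field_simp
    rw [h3] at h2
    linarith
  have hqb := Metric.mem_ball_self (x := q) hδ₀
  have hc : ∀ s : ℝ, |s| < δ₀ → ContinuousAt (fun q' => fderiv ℝ u q X * u (q' + s • X)) q := by
    intro s hs
    refine ContinuousAt.const_mul ?_ _
    have h1 := (hu.differentiableAt hk (hU' q hqb s hs)).continuousAt
    exact ContinuousAt.comp (f := fun q' => q' + s • X) h1 (by fun_prop)
  have hδabs : |δ| < δ₀ := by rwa [abs_of_pos hδ]
  filter_upwards [Metric.ball_mem_nhds q hδ₀, (hc δ hδabs).eventually_const_lt hpos,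
    (hc (-δ) (by rwa [abs_neg])).eventually_lt_const hneg] with q' h1 h2 h3
  have hcs : ContinuousOn (fun s : ℝ => fderiv ℝ u q X * u (q' + s • X)) (Icc (-δ) δ) := by
    intro s hs
    have hs' : |s| < δ₀ := (abs_le.2 hs).trans_lt hδδ₀
    have h4 := (hu.differentiableAt hk (hU' q' h1 s hs')).continuousAt
    refine (ContinuousAt.const_mul ?_ _).continuousWithinAt
    exact ContinuousAt.comp (f := fun s : ℝ => q' + s • X) h4 (by fun_prop)
  obtain ⟨s, hs, hs0⟩ := intermediate_value_Icc (by linarith) hcs ⟨h3.le, h2.le⟩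
  have hs' : |s| ≤ δ := abs_le.2 hs
  refine ⟨s, hs'.trans_lt hδε, ?_⟩
  rw [hu.mem_iff _ (hU' q' h1 s (hs'.trans_lt hδδ₀))]
  exact (mul_eq_zero.1 hs0).resolve_left hX'

/-! ### Left translations and their inverses. -/

theorem leftTranslation_neg_apply (F : Cn n) (τ : ℝ) (q : H n) :
    leftTranslation (-F, -τ) q = (q.1 - F, q.2 + ⟪J F, q.1⟫ - τ) := by
  simp only [leftTranslation, sympl_eq_inner, map_neg, inner_neg_left]
  exact Prod.ext (by simp only; abel) (by ring)

theorem leftTranslation_neg_leftTranslation (F : Cn n) (τ : ℝ) (q : H n) :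
    leftTranslation (-F, -τ) (leftTranslation (F, τ) q) = q := by
  rw [leftTranslation_neg_apply]
  simp only [leftTranslation, sympl_eq_inner, inner_add_right, inner_J_self]
  exact Prod.ext (by simp) (by simp)

theorem leftTranslation_leftTranslation_neg (F : Cn n) (τ : ℝ) (q : H n) :
    leftTranslation (F, τ) (leftTranslation (-F, -τ) q) = q := by
  rw [leftTranslation_neg_apply]
  simp only [leftTranslation, sympl_eq_inner, inner_sub_right, inner_J_self]
  exact Prod.ext (by simp) (by ring)

theorem continuous_leftTranslation (p : H n) : Continuous (leftTranslation p) := by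
  unfold leftTranslation
  simp only [sympl_eq_inner]
  fun_prop

section Pansu

variable {lam : ℝ}

/-- The Pansu sphere meets vertical lines discretely off its equator. -/
theorem eq_zero_of_vertical {q : H n} {s : ℝ} (hq : q ∈ pansuSphere n lam)
    (hq' : (q.1, q.2 + s) ∈ pansuSphere n lam) (hs : |s| < 2 * |q.2|) : s = 0 := by
  have h1 : |q.2| = |pansuHeight lam q.1| := by
    rcases hq.2 with h | h <;> rw [h]
    rw [abs_neg]
  have h2 : |q.2 + s| = |pansuHeight lam q.1| := by
    rcases hq'.2 with h | h <;> simp only at h <;> rw [h]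
    rw [abs_neg]
  rcases abs_eq_abs.1 (h2.trans h1.symm) with h | h
  · linarith
  -- The only other intersection is the mirror image at height -t, excluded by the bound on s.
  · have h3 : s = -(2 * q.2) := by linarith
    rw [h3, abs_neg, abs_mul, abs_two] at hs
    exact absurd hs (lt_irrefl _)

/-- The Pansu sphere meets radial lines discretely off its poles. -/
theorem eq_zero_of_radial (hl : 0 < lam) {q : H n} {s : ℝ} {v : Cn n} (hv : ‖v‖ = 1)
    (hq : q ∈ pansuSphere n lam) (hq' : (q.1 + s • v, q.2) ∈ pansuSphere n lam)
    (hs : |s| < -⟪q.1, v⟫) : s = 0 := by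
  have hv' : ⟪q.1 + s • v, v⟫ = ⟪q.1, v⟫ + s := by
    rw [inner_add_left, real_inner_smul_left, real_inner_self_eq_norm_sq, hv]
    ring
  have hs' := abs_lt.1 hs
  have h0 : q.1 ≠ 0 := fun h0 => by
    rw [h0, inner_zero_left] at hs
    linarith [abs_nonneg s]
  have h0' : q.1 + s • v ≠ 0 := fun h0 => by
    rw [h0, inner_zero_left] at hv'
    linarith
  obtain ⟨a, ha, hta⟩ := exists_heightFun_of_mem_pansuSphere hl hq h0
  obtain ⟨b, hb, htb⟩ := exists_heightFun_of_mem_pansuSphere hl hq' h0'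
  -- Equal heights have equal parameters, hence equal norms of z. The resulting quadratic in s has
  -- as its other root the reflected point s = -2⟨z, v⟩, which is out of range.
  have hab : a = b := (strictMono_heightFun hl).injective (hta.symm.trans htb)
  rw [← hab, ← ha] at hb
  simp only at hb
  rw [norm_add_sq_real, real_inner_smul_right, norm_smul, hv, mul_one, Real.norm_eq_abs,
    sq_abs] at hb
  have h3 : s * (s + 2 * ⟪q.1, v⟫) = 0 := by linarith
  rcases mul_eq_zero.1 h3 with h | h
  · exact h
  · linarith

end Pansu

namespace IsUmbilicCMC

variable {c : ℝ} {p : H n}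

/-- After a left translation, the regular points of the hypersurface are given by `α` and the
horizontal normal as on the Pansu sphere. -/
theorem exists_leftTranslation (h : IsUmbilicCMC S e α c) (hc : 0 < c) (hS : IsConnected S)
    (hs : (singularSet S).Nonempty) : ∃ (F : Cn n) (τ : ℝ), ∀ q ∈ regularSet S,
      ‖(leftTranslation (-F, -τ) q).1‖ ^ 2 = ((c / (2 * n)) ^ 2 + α q ^ 2)⁻¹ ∧
      (leftTranslation (-F, -τ) q).2 = heightFun (c / (2 * n)) (α q) ∧
      ⟪(leftTranslation (-F, -τ) q).1, normal e q⟫ =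
        -(c / (2 * n) * ((c / (2 * n)) ^ 2 + α q ^ 2)⁻¹) := by
  have hn' : (0 : ℝ) < n := by have := h.two_le; positivity
  have hl : 0 < c / (2 * n) := by positivity
  have hk : ∀ q ∈ regularSet S, kap c S e q = c / (2 * n) := fun q hq => h.kap_eq hc hS hs hq
  have hm : ∀ q ∈ regularSet S, modSq c S e α q = (c / (2 * n)) ^ 2 + α q ^ 2 := fun q hq => by
    rw [modSq, hk q hq]
  obtain ⟨F, hF⟩ := h.exists_eq_of_tangentiallyConst hS (f := center c S e α) fun q hq =>
    h.tangentiallyConst_center hq (by rw [hm q hq]; positivity)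
  obtain ⟨τ, hτ⟩ := h.exists_eq_of_tangentiallyConst hS (f := centerHeight c S e α) fun q hq =>
    h.tangentiallyConst_centerHeight hc hq (hk q hq)
  refine ⟨F, τ, fun q hq => ?_⟩
  have h1 := hF q hq
  have h2 := hτ q hq
  rw [centerHeight, h1] at h2
  rw [leftTranslation_neg_apply]
  have hν : ⟪normal e q, normal e q⟫ = 1 := by
    rw [real_inner_self_eq_norm_sq, h.frame.norm_normal hq, one_pow]
  -- That is, z - F = -ν/(λ - iα), which yields both the norm and the component along ν.
  have h3 : q.1 - F = -(((c / (2 * n)) * ((c / (2 * n)) ^ 2 + α q ^ 2)⁻¹) • normal e q +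
      (α q * ((c / (2 * n)) ^ 2 + α q ^ 2)⁻¹) • J (normal e q)) := by
    rw [← h1, center, hm q hq, hk q hq]
    abel
  refine ⟨?_, by simp only; linarith, ?_⟩
  · simp only [h3]
    rw [norm_neg, ← real_inner_self_eq_norm_sq]
    simp only [inner_add_left, inner_add_right, real_inner_smul_left, real_inner_smul_right,
      inner_J_J, inner_J_self, inner_self_J, hν]
    field_simp
    ring
  · simp only [h3, inner_neg_left, inner_add_left, real_inner_smul_left, inner_J_self, hν]
    ring

/-- Used to send singular points to the poles: |z|² at neighbouring regular points tends to 0. -/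
theorem tendsto_of_singular (h : IsUmbilicCMC S e α c) (hp : p ∈ singularSet S) {lam : ℝ} :
    Tendsto (fun q => (lam ^ 2 + α q ^ 2)⁻¹) (𝓝[S \ {p}] p) (𝓝 0) := by
  obtain ⟨h1, h2, -⟩ := h.alpha_of_singular hp
  have h3 : Tendsto (fun q => (α q)⁻¹ ^ 2) (𝓝[S \ {p}] p) (𝓝 0) := by simpa using h2.pow 2
  refine squeeze_zero' (Eventually.of_forall fun q => by positivity) ?_ h3
  filter_upwards [h1] with q hq
  rw [inv_pow]
  exact inv_anti₀ (sq_pos_of_ne_zero hq) (by linarith [sq_nonneg lam])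

/-- A compact connected umbilic hypersurface of constant positive `p`-mean curvature with a
singular point is a left translate of a Pansu sphere. -/
theorem exists_image_eq_pansuSphere (h : IsUmbilicCMC S e α c) (hc : 0 < c) (hS : IsConnected S)
    (hcomp : IsCompact S) (hs : (singularSet S).Nonempty) :
    ∃ p : H n, leftTranslation p '' S = pansuSphere n (c / (2 * n)) := by
  have hn : 1 ≤ n := by have := h.two_le; omega
  have hn' : (0 : ℝ) < n := by exact_mod_cast hn
  obtain ⟨F, τ, hF⟩ := h.exists_leftTranslation hc hS hs
  refine ⟨(-F, -τ), ?_⟩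
  set lam := c / (2 * n) with hlam
  have hl : 0 < lam := by positivity
  set Φ := leftTranslation (-F, -τ) with hΦ
  have hΦc : Continuous Φ := continuous_leftTranslation _
  have hreg : ∀ q ∈ regularSet S, Φ q ∈ pansuSphere n lam := fun q hq =>
    mem_pansuSphere_of_heightFun hl (hF q hq).1 (hF q hq).2.1
  have hsub : ∀ q ∈ S, Φ q ∈ pansuSphere n lam := fun q hq => by
    have := h.neBot_punctured hq
    exact isClosed_pansuSphere.mem_of_tendsto
      ((hΦc.tendsto q).mono_left nhdsWithin_le_nhds)
      ((h.eventually_regular hq).mono fun q' hq' => hreg q' hq')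
  have hpole : ∀ q ∈ singularSet S, (Φ q).1 = 0 := fun q hq => by
    have := h.neBot_punctured hq.1
    have h1 : Tendsto (fun q' => ‖(Φ q').1‖ ^ 2) (𝓝[S \ {q}] q) (𝓝 (‖(Φ q).1‖ ^ 2)) :=
      ((hΦc.fst.norm.pow 2).tendsto q).mono_left nhdsWithin_le_nhds
    have h2 := (h.tendsto_of_singular hq (lam := lam)).congr'
      ((h.eventually_regular hq.1).mono fun q' hq' => (hF q' hq').1.symm)
    simpa using tendsto_nhds_unique h1 h2
  -- If Φ q' lies on the sphere, the vertical line through q' meets S close to q'. That point also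
  -- maps into the sphere, which vertical lines meet only once locally off the equator, so it is q'
  -- itself.
  have hvert : ∀ q ∈ S, (Φ q).2 ≠ 0 → T ∉ tangent S q →
      ∀ᶠ q' in 𝓝 q, Φ q' ∈ pansuSphere n lam → q' ∈ S := by
    intro q hq ht hT
    obtain ⟨U, u, hqU, hu⟩ := (h.levelSet q hq).exists_isDefiningFunction
    have ht' : 0 < |(Φ q).2| := abs_pos.2 ht
    filter_upwards [hu.eventually_exists_add_smul_mem (by norm_num) hqU hq hT ht',
      (hΦc.snd.abs.continuousAt (x := q)).eventually_const_lt
        (by linarith : |(Φ q).2| / 2 < |(Φ q).2|)] with q' h1 h2 h3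
    obtain ⟨s, hs, hsS⟩ := h1
    have h4 := hsub _ hsS
    have h5 : Φ (q' + s • T) = ((Φ q').1, (Φ q').2 + s) := by
      rw [hΦ, leftTranslation_neg_apply, leftTranslation_neg_apply]
      simp only [T, Prod.fst_add, Prod.snd_add, Prod.smul_mk, smul_zero, add_zero, smul_eq_mul,
        mul_one]
      exact Prod.ext rfl (by ring)
    rw [h5] at h4
    rw [eq_zero_of_vertical h3 h4 (by linarith), zero_smul, add_zero] at hsS
    exact hsS
  have hopen : ∀ q ∈ S, ∀ᶠ q' in 𝓝 q, Φ q' ∈ pansuSphere n lam → q' ∈ S := by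
    intro q hq
    by_cases hr : contactPlane q = tangent S q
    -- A singular point maps to a pole, of height ±π/(4λ²) ≠ 0, and T is transversal to ξ = TS
    -- there.
    · refine hvert q hq (fun h0 => ?_) fun hT => ?_
      · have h1 := (hsub q hq).2
        rw [hpole q ⟨hq, hr⟩, h0] at h1
        simp only [pansuHeight, norm_zero, mul_zero, zero_mul, Real.arccos_zero, zero_add] at h1
        have : 0 < 1 / (2 * lam ^ 2) * (Real.pi / 2) := by positivity
        rcases h1 with h1 | h1 <;> linarith
      · rw [← hr, contactPlane, LinearMap.mem_ker, contactForm_T] at hT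
        exact one_ne_zero hT
    · have hr' : q ∈ regularSet S := ⟨hq, hr⟩
      obtain ⟨-, f2, f3⟩ := hF q hr'
      -- The points with α = 0 map to the equator, where T is tangent to S. There the radial
      -- direction ν replaces the vertical one; its t-component is chosen so that Φ makes the line
      -- horizontal in coordinates.
      by_cases hα : α q = 0
      · set v := normal e q with hv
        have hv1 : ‖v‖ = 1 := h.frame.norm_normal hr'
        have hX : ((v, -⟪J F, v⟫) : H n) ∉ tangent S q := by
          rw [h.frame.mem_tangent_iff hr' (h.levelSet q hq), hα, zero_mul]
          simp only
          rw [← hv, real_inner_self_eq_norm_sq, hv1]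
          norm_num
        have hin : ⟪(Φ q).1, v⟫ < -(1 / (2 * lam)) := by
          rw [f3, hα]
          have h1 : lam * (lam ^ 2 + 0 ^ 2)⁻¹ = 1 / (2 * lam) + 1 / (2 * lam) := by
            field_simp
            ring
          have : 0 < 1 / (2 * lam) := by positivity
          linarith
        obtain ⟨U, u, hqU, hu⟩ := (h.levelSet q hq).exists_isDefiningFunction
        have hic : Continuous fun q' => ⟪(Φ q').1, v⟫ :=
          Continuous.inner (𝕜 := ℝ) hΦc.fst continuous_const
        filter_upwards [hu.eventually_exists_add_smul_mem (by norm_num) hqU hq hX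
          (by positivity : 0 < 1 / (2 * lam)), hic.continuousAt.eventually_lt_const hin]
          with q' h1 h2 h3
        obtain ⟨s, hs, hsS⟩ := h1
        have h4 := hsub _ hsS
        have h5 : Φ (q' + s • (v, -⟪J F, v⟫)) = ((Φ q').1 + s • v, (Φ q').2) := by
          rw [hΦ, leftTranslation_neg_apply, leftTranslation_neg_apply]
          simp only [Prod.fst_add, Prod.snd_add, Prod.smul_mk, smul_eq_mul, inner_add_right,
            real_inner_smul_right]
          exact Prod.ext (by simp only; abel) (by simp only; ring)
        rw [h5] at h4
        rw [eq_zero_of_radial hl hv1 h3 h4 (by linarith), zero_smul, add_zero] at hsS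
        exact hsS
      · refine hvert q hq (fun h0 => hα ?_) fun hT => hα ?_
        · rw [f2, ← heightFun_zero (lam := lam)] at h0
          exact (strictMono_heightFun hl).injective h0
        · rw [h.frame.mem_tangent_iff hr' (h.levelSet q hq), contactForm_T] at hT
          simpa [T] using hT.symm
  have hclosed : IsClosed (Φ '' S) := (hcomp.image hΦc).isClosed
  have hΨc : Continuous (leftTranslation (F, τ)) := continuous_leftTranslation _
  refine Subset.antisymm (image_subset_iff.2 hsub) fun y hy => ?_
  obtain ⟨x, hx⟩ := hS.nonempty
  -- Membership in Φ(S) is locally constant on the connected sphere: `hopen` gives openness, and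
  -- compactness of S gives closedness.
  refine (isPreconnected_pansuSphere hn hl).induction₂' (fun a b => a ∈ Φ '' S → b ∈ Φ '' S) ?_
    (fun a b d _ _ _ h1 h2 h3 => h2 (h1 h3)) (hsub x hx) hy (mem_image_of_mem Φ hx)
  intro a ha
  by_cases haS : a ∈ Φ '' S
  · obtain ⟨q, hq, rfl⟩ := haS
    have h1 := hΨc.tendsto (Φ q)
    rw [leftTranslation_leftTranslation_neg] at h1
    rw [eventually_nhdsWithin_iff]
    filter_upwards [h1.eventually (hopen q hq)] with b hb hbP
    rw [hΦ, leftTranslation_neg_leftTranslation] at hb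
    exact ⟨fun _ => ⟨_, hb hbP, leftTranslation_neg_leftTranslation F τ b⟩,
      fun _ => mem_image_of_mem Φ hq⟩
  · filter_upwards [mem_nhdsWithin_of_mem_nhds (hclosed.isOpen_compl.mem_nhds haS)] with b hb
    exact ⟨fun h1 => absurd h1 haS, fun h1 => absurd h1 hb⟩

end IsUmbilicCMC

end Heisenberg

end

theorem mainTheorem6 (n : ℕ) (hn : 2 ≤ n) (c : ℝ) (hc : 0 < c)
    (S : Set (Heisenberg.H n)) (hS : Heisenberg.IsHypersurface S)
    (hcompact : IsCompact S) (hconnected : IsConnected S)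
    (e : Heisenberg.H n → Heisenberg.Cn n) (α : Heisenberg.H n → ℝ)
    (hframe : Heisenberg.IsHorizontalFrame S e α)
    (hH : ∀ p ∈ Heisenberg.regularSet S, Heisenberg.pMeanCurvature S e α p = c)
    (humbilic : ∀ p ∈ Heisenberg.regularSet S, Heisenberg.IsUmbilicAt S e α p)
    (hsingular : (Heisenberg.singularSet S).Nonempty) :
    ∃ Φ : Heisenberg.H n → Heisenberg.H n, Heisenberg.IsRigidMotion Φ ∧
      Φ '' S = Heisenberg.pansuSphere n (c / (2 * n)) := by
  obtain ⟨p, hp⟩ := Heisenberg.IsUmbilicCMC.exists_image_eq_pansuSphere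
    ⟨hn, hS, hframe, hH, humbilic⟩ hc hconnected hcompact hsingular
  -- No rotation is needed, as the Pansu sphere is invariant under U(n).
  exact ⟨_, ⟨p, LinearIsometryEquiv.refl ℂ _, fun q => rfl⟩, hp⟩
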